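/- Let $\Bbbk$ be a field of characteristic different from $2$. For a graded vector space $V=(V^n)_{n\ge 0}$ let $\Lambda V$ be the free graded commutative algebra on $V$, augmented by $V\mapsto 0$, with augmentation ideal $\Lambda^{+}V$, and put $\Lambda^{\ge 2}V=(\Lambda^{+}V)^2$. Let $\Gamma V$ be the free divided powers algebra on $V$, that is, the tensor product of the free divided powers algebra on $V^{\mathrm{even}}$, with divided powers $\gamma^i(v)$ of degree $i|v|$, and of the exterior algebra on $V^{\mathrm{odd}}$; its augmentation ideal is $\Gamma^{+}V$. If $V$ is concentrated in degrees $\ge 2$, a minimal Sullivan model $(\Lambda V,d)$ is $\Lambda V$ with a derivation $d$ of degree $+1$ such that $d^2=0$ and $d(V)\subseteq\Lambda^{\ge 2}V$. Let $X$ and $Y$ be graded vector spaces concentrated in degrees $\ge 2$, and let $\Psi:(\Lambda Y,d)\to(\Lambda X,d)$ be a morphism of commutative cochain algebras between minimal Sullivan models. Let $\varphi:Y\to X$ be the composite $Y\hookrightarrow\Lambda Y\xrightarrow{\Psi}\Lambda X\twoheadrightarrow X$, where the last map is the projection on the linear part (with kernel $\Bbbk\oplus\Lambda^{\ge 2}X$),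 and let $s\ker\varphi$ be the graded vector space with $(s\ker\varphi)^n=(\ker\varphi)^{n+1}$. Equip $P=\Lambda Y\otimes\Lambda\operatorname{coker}\varphi\otimes\Gamma s\ker\varphi$ with the product, grading and augmentation of a tensor product of augmented graded commutative algebras. Then there are a differential $D$ on $P$ and a map $p:P\to\Lambda X$ such that: * $(P,D)$ is an augmented commutative cochain algebra and $D$ is a $\Gamma$-derivation, i.e. a derivation with $D(\gamma^i(w))=D(w)\,\gamma^{i-1}(w)$ for all $i\ge 1$ and all $w\in s\ker\varphi$ of even degree; * the inclusion $i:(\Lambda Y,d)\to(P,D)$, $a\mapsto a\otimes 1\otimes 1$, is an injective morphism of augmented commutative cochain algebras, and $(P,D)$ is $(\Lambda Y,d)$-semifree: it is the union of an increasing sequence of differential graded $\Lambda Y$-submodules $F_0\subseteq F_1\subseteq\cdots$ such that $F_0$ and each $F_{n+1}/F_n$ are free $\Lambda Y$-modules on a basis of homogeneous cycles; * $p:(P,D)\to(\Lambda X,d)$ is a surjective quasi-isomorphism of commutative cochain algebras vanishing on $\Gamma^{+}s\ker\varphi$; * $\Psi=p\circ i$. -/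

import Mathlib

open scoped DirectSum TensorProduct

noncomputable section

universe u v w

namespace DGFact

/-! ### Graded algebras given by homogeneous generators and relations -/

section Presented

variable {k : Type u} [Field k] {α : Type v} (deg : α → ℕ)

/-- The degree `n` part of the free algebra on generators `a : α` of degree `deg a`:
the span of all words of total degree `n`. -/
def wordGrade (n : ℕ) : Submodule k (FreeAlgebra k α) :=
  Submodule.span k
    {x | ∃ l : List α, (l.map deg).sum = n ∧ x = (l.map (FreeAlgebra.ι k)).prod}

/-- The degree `n` part of the algebra presented by the relations `r`. -/
def presGrade (r : FreeAlgebra k α → FreeAlgebra k α → Prop) (n : ℕ) :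
    Submodule k (RingQuot r) :=
  (wordGrade deg n).map (RingQuot.mkAlgHom k r).toLinearMap

variable {deg}

theorem wordGrade_word (l : List α) :
    (l.map (FreeAlgebra.ι k)).prod ∈ wordGrade (k := k) deg (l.map deg).sum :=
  Submodule.subset_span ⟨l, rfl, rfl⟩

theorem wordGrade_gen (a : α) : FreeAlgebra.ι k a ∈ wordGrade (k := k) deg (deg a) := by
  simpa using wordGrade_word (k := k) (deg := deg) [a]

theorem wordGrade_one : (1 : FreeAlgebra k α) ∈ wordGrade (k := k) deg 0 := by
  simpa using wordGrade_word (k := k) (deg := deg) []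

theorem wordGrade_mul {m n : ℕ} {x y : FreeAlgebra k α} (hx : x ∈ wordGrade deg m)
    (hy : y ∈ wordGrade deg n) : x * y ∈ wordGrade deg (m + n) := by
  have h := Submodule.mul_mem_mul hx hy
  rw [wordGrade, wordGrade, Submodule.span_mul_span] at h
  refine Submodule.span_mono ?_ h
  rintro _ ⟨_, ⟨l, rfl, rfl⟩, _, ⟨l', rfl, rfl⟩, rfl⟩
  exact ⟨l ++ l', by simp, by simp⟩

theorem wordGrade_congr {m n : ℕ} {x : FreeAlgebra k α} (hx : x ∈ wordGrade deg m)
    (h : m = n) : x ∈ wordGrade deg n := h ▸ hx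

theorem wordGrade_aug (f : FreeAlgebra k α →ₐ[k] k)
    (hf : ∀ a, 0 < deg a → f (FreeAlgebra.ι k a) = 0) {n : ℕ} (hn : 0 < n) {x : FreeAlgebra k α}
    (hx : x ∈ wordGrade deg n) : f x = 0 := by
  induction hx using Submodule.span_induction with
  | mem x h =>
    obtain ⟨l, rfl, rfl⟩ := h
    induction l with
    | nil => simp at hn
    | cons a l ih =>
      simp only [List.map_cons, List.prod_cons, map_mul, List.sum_cons] at hn ⊢
      rcases Nat.eq_zero_or_pos (deg a) with h0 | h0
      · rw [ih (by omega), mul_zero]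
      · rw [hf a h0, zero_mul]
  | zero => exact map_zero f
  | add x y _ _ ihx ihy => rw [map_add, ihx, ihy, add_zero]
  | smul c x _ ih => rw [map_smul, ih, smul_zero]

instance presGrade_gradedMonoid (r : FreeAlgebra k α → FreeAlgebra k α → Prop) :
    SetLike.GradedMonoid (presGrade deg r) where
  one_mem := ⟨1, wordGrade_one, map_one (RingQuot.mkAlgHom k r)⟩
  mul_mem := by
    rintro m n _ _ ⟨x, hx, rfl⟩ ⟨y, hy, rfl⟩
    exact ⟨x * y, wordGrade_mul hx hy, map_mul (RingQuot.mkAlgHom k r) x y⟩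

/-- Lift of a generator to the external direct sum of the homogeneous parts. -/
def presAux (deg : α → ℕ) (r : FreeAlgebra k α → FreeAlgebra k α → Prop) :
    FreeAlgebra k α →ₐ[k] ⨁ n, presGrade deg r n :=
  FreeAlgebra.lift k fun a =>
    DirectSum.of (fun n => presGrade deg r n) (deg a)
      ⟨RingQuot.mkAlgHom k r (FreeAlgebra.ι k a), ⟨_, wordGrade_gen a, rfl⟩⟩

theorem presAux_word (r : FreeAlgebra k α → FreeAlgebra k α → Prop) (l : List α) :
    presAux deg r (l.map (FreeAlgebra.ι k)).prod =
      DirectSum.of (fun n => presGrade deg r n) (l.map deg).sum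
        ⟨RingQuot.mkAlgHom k r (l.map (FreeAlgebra.ι k)).prod, ⟨_, wordGrade_word l, rfl⟩⟩ := by
  induction l with
  | nil =>
    simp only [List.map_nil, List.prod_nil, map_one]
    rfl
  | cons a l ih =>
    simp only [List.map_cons, List.prod_cons, map_mul]
    rw [ih, presAux, FreeAlgebra.lift_ι_apply, DirectSum.of_mul_of]
    rfl

theorem presAux_mem (r : FreeAlgebra k α → FreeAlgebra k α → Prop) {n : ℕ}
    {x : FreeAlgebra k α} (hx : x ∈ wordGrade deg n) :
    presAux deg r x =
      DirectSum.of (fun n => presGrade deg r n) n ⟨RingQuot.mkAlgHom k r x, ⟨x, hx, rfl⟩⟩ := by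
  induction hx using Submodule.span_induction with
  | mem x h =>
    obtain ⟨l, rfl, rfl⟩ := h
    exact presAux_word r l
  | zero =>
    rw [map_zero, eq_comm, ← map_zero (DirectSum.of (fun n => presGrade deg r n) n)]
    congr 1
    exact Subtype.ext (map_zero (RingQuot.mkAlgHom k r))
  | add x y hx hy ihx ihy =>
    rw [map_add, ihx, ihy, ← map_add]
    congr 1
    exact Subtype.ext (map_add (RingQuot.mkAlgHom k r) x y).symm
  | smul c x hx ih =>
    rw [map_smul, ih, ← DirectSum.lof_eq_of k, ← map_smul]
    exact congrArg _ (Subtype.ext (map_smul (RingQuot.mkAlgHom k r) c x).symm)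

/-- An algebra presented by homogeneous generators and homogeneous relations is graded. -/
@[reducible]
def presGradedAlgebra (r : FreeAlgebra k α → FreeAlgebra k α → Prop)
    (hr : ∀ a b, r a b → ∃ n, a ∈ wordGrade deg n ∧ b ∈ wordGrade deg n) :
    GradedAlgebra (presGrade deg r) :=
  GradedAlgebra.ofAlgHom _
    (RingQuot.liftAlgHom k ⟨presAux deg r, by
      intro a b hab
      obtain ⟨n, ha, hb⟩ := hr a b hab
      rw [presAux_mem r ha, presAux_mem r hb]
      congr 1
      exact Subtype.ext (RingQuot.mkAlgHom_rel k hab)⟩)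
    (by
      apply RingQuot.ringQuot_ext'
      apply FreeAlgebra.hom_ext
      funext a
      simp only [Function.comp_apply, AlgHom.comp_apply, RingQuot.liftAlgHom_mkAlgHom_apply,
        presAux, FreeAlgebra.lift_ι_apply, DirectSum.coeAlgHom_of, AlgHom.id_apply])
    (by
      rintro n ⟨_, x, hx, rfl⟩
      simp only [AlgHom.toLinearMap_apply]
      rw [RingQuot.liftAlgHom_mkAlgHom_apply, presAux_mem r hx])

end Presented

/-! ### The free graded commutative algebra `ΛV` -/

section Lambda

variable (k : Type u) [Field k] (V : ℕ → Type v) [∀ n, AddCommGroup (V n)]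
  [∀ n, Module k (V n)]

/-- The relations of `ΛV`: linearity of `V → ΛV` and graded commutativity. As `2` will be
invertible, the square of an element of odd degree vanishes. -/
inductive LambdaRel : FreeAlgebra k (Σ n, V n) → FreeAlgebra k (Σ n, V n) → Prop
  | add (n : ℕ) (x y : V n) : LambdaRel (FreeAlgebra.ι k ⟨n, x + y⟩)
      (FreeAlgebra.ι k ⟨n, x⟩ + FreeAlgebra.ι k ⟨n, y⟩)
  | smul (n : ℕ) (c : k) (x : V n) : LambdaRel (FreeAlgebra.ι k ⟨n, c • x⟩)
      (c • FreeAlgebra.ι k ⟨n, x⟩)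
  | comm (m n : ℕ) (x : V m) (y : V n) :
      LambdaRel (FreeAlgebra.ι k ⟨m, x⟩ * FreeAlgebra.ι k ⟨n, y⟩)
        ((-1 : k) ^ (m * n) • (FreeAlgebra.ι k ⟨n, y⟩ * FreeAlgebra.ι k ⟨m, x⟩))

/-- `ΛV`, the free graded commutative algebra on the graded vector space `V = (V n)_n`. -/
abbrev Lambda : Type (max u v) := RingQuot (LambdaRel k V)

/-- The grading of `ΛV` in which elements of `V n` have degree `n`. -/
def Lambda.grade : ℕ → Submodule k (Lambda k V) :=
  presGrade (fun a : Σ n, V n => a.1) (LambdaRel k V)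

instance Lambda.gradedAlgebra : GradedAlgebra (Lambda.grade k V) :=
  presGradedAlgebra (deg := fun a : Σ n, V n => a.1) (LambdaRel k V) (by
    intro a b h
    cases h with
    | add n x y =>
      exact ⟨n, wordGrade_gen (deg := fun a : Σ n, V n => a.1) ⟨n, x + y⟩,
        add_mem (wordGrade_gen (deg := fun a : Σ n, V n => a.1) ⟨n, x⟩)
          (wordGrade_gen (deg := fun a : Σ n, V n => a.1) ⟨n, y⟩)⟩
    | smul n c x =>
      exact ⟨n, wordGrade_gen (deg := fun a : Σ n, V n => a.1) ⟨n, c • x⟩,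
        Submodule.smul_mem _ _ (wordGrade_gen (deg := fun a : Σ n, V n => a.1) ⟨n, x⟩)⟩
    | comm m n x y =>
      have hx := wordGrade_gen (k := k) (deg := fun a : Σ n, V n => a.1) ⟨m, x⟩
      have hy := wordGrade_gen (k := k) (deg := fun a : Σ n, V n => a.1) ⟨n, y⟩
      exact ⟨m + n, wordGrade_mul hx hy,
        Submodule.smul_mem _ _ (wordGrade_congr (wordGrade_mul hy hx) (add_comm _ _))⟩)

/-- The inclusion `V n → ΛV`. -/
def Lambda.ι (n : ℕ) : V n →ₗ[k] Lambda k V where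
  toFun x := RingQuot.mkAlgHom k (LambdaRel k V) (FreeAlgebra.ι k ⟨n, x⟩)
  map_add' x y := by
    rw [← map_add]
    exact RingQuot.mkAlgHom_rel k (LambdaRel.add n x y)
  map_smul' c x := by
    rw [RingHom.id_apply, ← map_smul]
    exact RingQuot.mkAlgHom_rel k (LambdaRel.smul n c x)

/-- The augmentation `ΛV → k`, sending `V` to `0`. -/
def Lambda.aug : Lambda k V →ₐ[k] k :=
  RingQuot.liftAlgHom k ⟨FreeAlgebra.lift k fun _ => 0, by
    intro a b h
    cases h <;> simp⟩

theorem Lambda.aug_of_pos {n : ℕ} (hn : 0 < n) {x : Lambda k V} (hx : x ∈ Lambda.grade k V n) :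
    Lambda.aug k V x = 0 := by
  obtain ⟨y, hy, rfl⟩ := hx
  simp only [Lambda.aug, AlgHom.toLinearMap_apply, RingQuot.liftAlgHom_mkAlgHom_apply]
  exact wordGrade_aug _ (fun a _ => by simp) hn hy

/-- The component in degree `n` of the projection `ΛV → V` on the linear part, whose kernel
consists of the scalars and of `Λ^{≥2}V`. It is the second component of the algebra morphism
`ΛV → k ⊕ V n` (with `V n` an ideal of square zero) that extends the projection `V → V n`. -/
def Lambda.linearPart (n : ℕ) : Lambda k V →ₗ[k] V n :=
  letI : Module kᵐᵒᵖ (V n) := Module.compHom _ ((RingHom.id k).fromOpposite mul_comm)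
  haveI : IsCentralScalar k (V n) := ⟨fun _ _ => rfl⟩
  (TrivSqZeroExt.sndHom k (V n)).comp
    (RingQuot.liftAlgHom k (s := LambdaRel k V)
      ⟨FreeAlgebra.lift k fun a : Σ n, V n =>
        (TrivSqZeroExt.inr (Pi.single (M := V) a.1 a.2 n) : TrivSqZeroExt k (V n)), by
        intro a b h
        cases h with
        | add m x y => simp [Pi.single_add]
        | smul m c x => simp [Pi.single_smul]
        | comm i j x y => simp⟩).toLinearMap

end Lambda

/-! ### The free divided powers algebra `ΓW` -/

section Gamma

variable (k : Type u) [Field k] (W : ℕ → Type v) [∀ n, AddCommGroup (W n)]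
  [∀ n, Module k (W n)]

/-- The generator `γ^i(x)`, for `x` of degree `n`, in the free algebra on all such symbols. -/
abbrev gammaGen {n : ℕ} (i : ℕ) (x : W n) : FreeAlgebra k (Σ n, ℕ × W n) :=
  FreeAlgebra.ι k ⟨n, i, x⟩

/-- The relations of `ΓW`. For `x` of even degree, the `γ^i(x)` satisfy the laws of divided
powers. For `x` of odd degree there are no divided powers: only `γ^1(x) = x` is kept. -/
inductive GammaRel :
    FreeAlgebra k (Σ n, ℕ × W n) → FreeAlgebra k (Σ n, ℕ × W n) → Prop
  | zero (n : ℕ) (x : W n) : GammaRel (gammaGen k W 0 x) 1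
  | one_add (n : ℕ) (x y : W n) :
      GammaRel (gammaGen k W 1 (x + y)) (gammaGen k W 1 x + gammaGen k W 1 y)
  | one_smul (n : ℕ) (c : k) (x : W n) :
      GammaRel (gammaGen k W 1 (c • x)) (c • gammaGen k W 1 x)
  | comm (m n i j : ℕ) (x : W m) (y : W n) :
      GammaRel (gammaGen k W i x * gammaGen k W j y)
        ((-1 : k) ^ ((i * m) * (j * n)) • (gammaGen k W j y * gammaGen k W i x))
  | smul (n : ℕ) (_ : Even n) (i : ℕ) (c : k) (x : W n) :
      GammaRel (gammaGen k W i (c • x)) (c ^ i • gammaGen k W i x)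
  | add (n : ℕ) (_ : Even n) (i : ℕ) (x y : W n) :
      GammaRel (gammaGen k W i (x + y))
        (∑ p ∈ Finset.HasAntidiagonal.antidiagonal i, gammaGen k W p.1 x * gammaGen k W p.2 y)
  | mul (n : ℕ) (_ : Even n) (i j : ℕ) (x : W n) :
      GammaRel (gammaGen k W i x * gammaGen k W j x)
        (((i + j).choose i : k) • gammaGen k W (i + j) x)
  | odd (n : ℕ) (_ : Odd n) (i : ℕ) (_ : 2 ≤ i) (x : W n) : GammaRel (gammaGen k W i x) 0

/-- `ΓW`, the free divided powers algebra on the graded vector space `W = (W n)_n`: the tensor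
product of the free divided powers algebra on the even part and of the exterior algebra on the
odd part of `W`. -/
abbrev Gamma : Type (max u v) := RingQuot (GammaRel k W)

/-- The grading of `ΓW` in which `γ^i(x)` has degree `i * n` for `x ∈ W n`. -/
def Gamma.grade : ℕ → Submodule k (Gamma k W) :=
  presGrade (fun a : Σ n, ℕ × W n => a.2.1 * a.1) (GammaRel k W)

set_option linter.unusedSectionVars false in
theorem gammaGen_mem {n : ℕ} (i : ℕ) (x : W n) :
    gammaGen k W i x ∈ wordGrade (k := k) (fun a : Σ n, ℕ × W n => a.2.1 * a.1) (i * n) :=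
  wordGrade_gen (k := k) (deg := fun a : Σ n, ℕ × W n => a.2.1 * a.1) ⟨n, i, x⟩

instance Gamma.gradedAlgebra : GradedAlgebra (Gamma.grade k W) :=
  presGradedAlgebra (deg := fun a : Σ n, ℕ × W n => a.2.1 * a.1) (GammaRel k W) (by
    intro a b h
    cases h with
    | zero n x =>
      exact ⟨0, wordGrade_congr (gammaGen_mem k W 0 x) (zero_mul n), wordGrade_one⟩
    | one_add n x y =>
      exact ⟨1 * n, gammaGen_mem k W 1 _, add_mem (gammaGen_mem k W 1 x) (gammaGen_mem k W 1 y)⟩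
    | one_smul n c x =>
      exact ⟨1 * n, gammaGen_mem k W 1 _, Submodule.smul_mem _ _ (gammaGen_mem k W 1 x)⟩
    | comm m n i j x y =>
      exact ⟨i * m + j * n, wordGrade_mul (gammaGen_mem k W i x) (gammaGen_mem k W j y),
        Submodule.smul_mem _ _ (wordGrade_congr
          (wordGrade_mul (gammaGen_mem k W j y) (gammaGen_mem k W i x)) (add_comm _ _))⟩
    | smul n _ i c x =>
      exact ⟨i * n, gammaGen_mem k W i _, Submodule.smul_mem _ _ (gammaGen_mem k W i x)⟩
    | add n _ i x y =>
      refine ⟨i * n, gammaGen_mem k W i _, Submodule.sum_mem _ fun p hp => ?_⟩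
      refine wordGrade_congr (wordGrade_mul (gammaGen_mem k W p.1 x) (gammaGen_mem k W p.2 y)) ?_
      rw [← add_mul, Finset.HasAntidiagonal.mem_antidiagonal.mp hp]
    | mul n _ i j x =>
      exact ⟨(i + j) * n, wordGrade_congr
        (wordGrade_mul (gammaGen_mem k W i x) (gammaGen_mem k W j x)) (add_mul _ _ _).symm,
        Submodule.smul_mem _ _ (gammaGen_mem k W (i + j) x)⟩
    | odd n _ i _ x => exact ⟨i * n, gammaGen_mem k W i x, zero_mem _⟩)

/-- The element `γ^i(x)` of `ΓW`. In particular `γ^1(x)` is the image of `x` under `W → ΓW`. -/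
def Gamma.γ {n : ℕ} (i : ℕ) (x : W n) : Gamma k W :=
  RingQuot.mkAlgHom k (GammaRel k W) (gammaGen k W i x)

/-- The augmentation `ΓW → k`, sending `γ^i(x)` to `0` for `i ≥ 1`. -/
def Gamma.aug : Gamma k W →ₐ[k] k :=
  RingQuot.liftAlgHom k ⟨FreeAlgebra.lift k fun a => if a.2.1 = 0 then 1 else 0, by
    intro a b h
    cases h with
    | zero n x => simp
    | one_add n x y => simp
    | one_smul n c x => simp
    | comm m n i j x y =>
      by_cases hi : i = 0 <;> by_cases hj : j = 0 <;> simp [hi, hj]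
    | smul n _ i c x => by_cases hi : i = 0 <;> simp [hi]
    | add n _ i x y =>
      by_cases hi : i = 0
      · subst hi
        simp
      · simp only [FreeAlgebra.lift_ι_apply, map_sum, map_mul, if_neg hi]
        refine (Finset.sum_eq_zero fun p hp => ?_).symm
        have hp' := Finset.HasAntidiagonal.mem_antidiagonal.mp hp
        by_cases h1 : p.1 = 0
        · have h2 : p.2 ≠ 0 := by omega
          simp [h2]
        · simp [h1]
    | mul n _ i j x => by_cases hi : i = 0 <;> by_cases hj : j = 0 <;> simp [hi, hj]
    | odd n _ i hi x =>
      have : i ≠ 0 := by omega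
      simp [this]⟩

theorem Gamma.aug_of_pos {n : ℕ} (hn : 0 < n) {x : Gamma k W} (hx : x ∈ Gamma.grade k W n) :
    Gamma.aug k W x = 0 := by
  obtain ⟨y, hy, rfl⟩ := hx
  simp only [Gamma.aug, AlgHom.toLinearMap_apply, RingQuot.liftAlgHom_mkAlgHom_apply]
  refine wordGrade_aug _ (fun a ha => ?_) hn hy
  have : a.2.1 ≠ 0 := fun h => by simp [h] at ha
  simp [this]

end Gamma

/-! ### Tensor products of graded algebras -/

section Tensor

open GradedTensorProduct

variable {k : Type u} [Field k] {A : Type v} {B : Type w} [Ring A] [Ring B] [Algebra k A]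
  [Algebra k B] (𝒜 : ℕ → Submodule k A) (ℬ : ℕ → Submodule k B) [GradedAlgebra 𝒜]
  [GradedAlgebra ℬ]

/-- The total grading of the graded tensor product (with the usual signs in the product). -/
def tensorGrade (n : ℕ) : Submodule k (𝒜 ᵍ⊗[k] ℬ) :=
  Submodule.span k {z | ∃ i j : ℕ, i + j = n ∧ ∃ a ∈ 𝒜 i, ∃ b ∈ ℬ j, z = a ᵍ⊗ₜ[k] b}

variable {𝒜 ℬ} in
theorem tmul_mem_tensorGrade {i j : ℕ} {a : A} {b : B} (ha : a ∈ 𝒜 i) (hb : b ∈ ℬ j) :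
    (a ᵍ⊗ₜ[k] b : 𝒜 ᵍ⊗[k] ℬ) ∈ tensorGrade 𝒜 ℬ (i + j) :=
  Submodule.subset_span ⟨i, j, rfl, a, ha, b, hb, rfl⟩

instance tensorGrade_gradedMonoid : SetLike.GradedMonoid (tensorGrade 𝒜 ℬ) where
  one_mem := tmul_mem_tensorGrade (i := 0) (j := 0) SetLike.GradedOne.one_mem
    SetLike.GradedOne.one_mem
  mul_mem := by
    intro m n x y hx hy
    have h := Submodule.mul_mem_mul hx hy
    rw [tensorGrade, tensorGrade, Submodule.span_mul_span] at h
    refine Submodule.span_le.mpr ?_ h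
    rintro _ ⟨_, ⟨i, j, rfl, a, ha, b, hb, rfl⟩, _, ⟨i', j', rfl, a', ha', b', hb', rfl⟩, rfl⟩
    have e := tmul_coe_mul_coe_tmul 𝒜 ℬ a (⟨b, hb⟩ : ℬ j) (⟨a', ha'⟩ : 𝒜 i') b'
    simp only at e
    simp only [SetLike.mem_coe]
    rw [e]
    have hm : (((a * a' : A) ᵍ⊗ₜ[k] (b * b' : B)) : 𝒜 ᵍ⊗[k] ℬ) ∈
        tensorGrade 𝒜 ℬ (i + j + (i' + j')) := by
      have := tmul_mem_tensorGrade (k := k) (SetLike.mul_mem_graded ha ha')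
        (SetLike.mul_mem_graded hb hb')
      rwa [show i + i' + (j + j') = i + j + (i' + j') by ring] at this
    rcases Int.units_eq_one_or ((-1 : ℤˣ) ^ (j * i')) with h1 | h1 <;> rw [h1]
    · simpa using hm
    · simpa using hm

/-- The decomposition of a tensor into its homogeneous components. -/
def tensorDecomposeAux : (𝒜 ᵍ⊗[k] ℬ) →ₗ[k] ⨁ n, tensorGrade 𝒜 ℬ n :=
  (TensorProduct.lift
    (LinearMap.compl₁₂
      (DirectSum.toModule k ℕ ((⨁ j, ℬ j) →ₗ[k] ⨁ n, tensorGrade 𝒜 ℬ n) fun i =>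
        LinearMap.flip (DirectSum.toModule k ℕ (𝒜 i →ₗ[k] ⨁ n, tensorGrade 𝒜 ℬ n) fun j =>
          LinearMap.mk₂ k (fun (b : ℬ j) (a : 𝒜 i) =>
            DirectSum.lof k ℕ (fun n => tensorGrade 𝒜 ℬ n) (i + j)
              ⟨(a : A) ᵍ⊗ₜ[k] (b : B), tmul_mem_tensorGrade a.2 b.2⟩)
            (fun b b' a => by
              rw [← map_add]
              congr 1
              exact Subtype.ext (TensorProduct.tmul_add (a : A) (b : B) (b' : B)))
            (fun c b a => by
              rw [← map_smul]
              congr 1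
              exact Subtype.ext (TensorProduct.tmul_smul c (a : A) (b : B)))
            (fun b a a' => by
              rw [← map_add]
              congr 1
              exact Subtype.ext (TensorProduct.add_tmul (a : A) (a' : A) (b : B)))
            (fun c b a => by
              rw [← map_smul]
              rfl)))
      (DirectSum.decomposeLinearEquiv 𝒜).toLinearMap
      (DirectSum.decomposeLinearEquiv ℬ).toLinearMap)).comp
    (GradedTensorProduct.of k 𝒜 ℬ).symm.toLinearMap

theorem tensorDecomposeAux_tmul {i j : ℕ} {a : A} {b : B} (ha : a ∈ 𝒜 i) (hb : b ∈ ℬ j) :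
    tensorDecomposeAux 𝒜 ℬ (a ᵍ⊗ₜ[k] b) =
      DirectSum.lof k ℕ (fun n => tensorGrade 𝒜 ℬ n) (i + j)
        ⟨a ᵍ⊗ₜ[k] b, tmul_mem_tensorGrade ha hb⟩ := by
  have h1 : DirectSum.decompose 𝒜 a = DirectSum.lof k ℕ (fun i => 𝒜 i) i ⟨a, ha⟩ :=
    DirectSum.decompose_of_mem 𝒜 ha
  have h2 : DirectSum.decompose ℬ b = DirectSum.lof k ℕ (fun i => ℬ i) j ⟨b, hb⟩ :=
    DirectSum.decompose_of_mem ℬ hb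
  simp only [tensorDecomposeAux, LinearMap.comp_apply, LinearEquiv.coe_coe, of_symm_of,
    TensorProduct.lift.tmul, LinearMap.compl₁₂_apply, DirectSum.decomposeLinearEquiv_apply]
  rw [h1, h2, DirectSum.toModule_lof, LinearMap.flip_apply, DirectSum.toModule_lof]
  rfl

theorem tensorDecomposeAux_mem {n : ℕ} {z : 𝒜 ᵍ⊗[k] ℬ} (hz : z ∈ tensorGrade 𝒜 ℬ n) :
    tensorDecomposeAux 𝒜 ℬ z =
      DirectSum.lof k ℕ (fun n => tensorGrade 𝒜 ℬ n) n ⟨z, hz⟩ := by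
  induction hz using Submodule.span_induction with
  | mem x h =>
    obtain ⟨i, j, rfl, a, ha, b, hb, rfl⟩ := h
    exact tensorDecomposeAux_tmul 𝒜 ℬ ha hb
  | zero =>
    rw [map_zero, eq_comm]
    exact map_zero (DirectSum.lof k ℕ (fun n => tensorGrade 𝒜 ℬ n) n)
  | add x y hx hy ihx ihy =>
    rw [map_add, ihx, ihy, ← map_add]
    rfl
  | smul c x hx ih =>
    rw [map_smul, ih, ← map_smul]
    rfl

instance tensorGrade_decomposition : DirectSum.Decomposition (tensorGrade 𝒜 ℬ) :=
  DirectSum.Decomposition.ofLinearMap (tensorGrade 𝒜 ℬ) (tensorDecomposeAux 𝒜 ℬ)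
    (by
      apply GradedTensorProduct.hom_ext
      apply TensorProduct.ext
      refine DirectSum.decompose_lhom_ext 𝒜 fun i => ?_
      ext a : 1
      refine DirectSum.decompose_lhom_ext ℬ fun j => ?_
      ext b : 1
      have := tensorDecomposeAux_tmul 𝒜 ℬ a.2 b.2
      change DirectSum.coeLinearMap (tensorGrade 𝒜 ℬ)
        (tensorDecomposeAux 𝒜 ℬ ((a : A) ᵍ⊗ₜ[k] (b : B))) = (a : A) ᵍ⊗ₜ[k] (b : B)
      rw [this, DirectSum.coeLinearMap_lof])
    (by
      ext n z : 2
      simp only [LinearMap.comp_apply, DirectSum.coeLinearMap_lof, LinearMap.id_apply]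
      exact tensorDecomposeAux_mem 𝒜 ℬ z.2)

instance tensorGrade_gradedAlgebra : GradedAlgebra (tensorGrade 𝒜 ℬ) where
  __ := tensorGrade_gradedMonoid 𝒜 ℬ
  __ := tensorGrade_decomposition 𝒜 ℬ

variable {𝒜 ℬ} in
/-- The tensor product `a ⊗ b ↦ ε(a) ε'(b)` of two augmentations. -/
def tensorAug (ε : A →ₐ[k] k) (ε' : B →ₐ[k] k) (hε : ∀ n, 0 < n → ∀ a ∈ 𝒜 n, ε a = 0) :
    (𝒜 ᵍ⊗[k] ℬ) →ₐ[k] k :=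
  GradedTensorProduct.lift 𝒜 ℬ ε ε' (by
    intro i j a b
    rcases Nat.eq_zero_or_pos i with h | h
    · subst h
      rw [mul_zero, uzpow_zero, one_smul, mul_comm]
    · rw [hε i h a a.2, zero_mul, mul_zero, smul_zero])

variable {𝒜 ℬ} in
theorem tensorAug_of_pos (ε : A →ₐ[k] k) (ε' : B →ₐ[k] k)
    (hε : ∀ n, 0 < n → ∀ a ∈ 𝒜 n, ε a = 0) (hε' : ∀ n, 0 < n → ∀ b ∈ ℬ n, ε' b = 0)
    (n : ℕ) (hn : 0 < n) (z : 𝒜 ᵍ⊗[k] ℬ) (hz : z ∈ tensorGrade 𝒜 ℬ n) :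
    tensorAug (ℬ := ℬ) ε ε' hε z = 0 := by
  induction hz using Submodule.span_induction with
  | mem x h =>
    obtain ⟨i, j, rfl, a, ha, b, hb, rfl⟩ := h
    rw [tensorAug, GradedTensorProduct.lift_tmul]
    rcases Nat.eq_zero_or_pos i with h0 | h0
    · rw [hε' j (by omega) b hb, mul_zero]
    · rw [hε i h0 a ha, zero_mul]
  | zero => exact map_zero _
  | add x y _ _ ihx ihy => rw [map_add, ihx, ihy, add_zero]
  | smul c x _ ih => rw [map_smul, ih, smul_zero]

end Tensor

/-! ### Cochain algebras -/

section DG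

variable {k : Type u} [Field k] {A : Type v} {B : Type w} [Ring A] [Ring B] [Algebra k A]
  [Algebra k B]

/-- Graded commutativity: `a b = (-1)^{|a||b|} b a`. -/
def IsGradedCommutative (𝒜 : ℕ → Submodule k A) : Prop :=
  ∀ i j : ℕ, ∀ a ∈ 𝒜 i, ∀ b ∈ 𝒜 j, a * b = (-1 : k) ^ (i * j) • (b * a)

/-- A derivation of degree `+1`. -/
structure IsGradedDerivation (𝒜 : ℕ → Submodule k A) (d : A →ₗ[k] A) : Prop where
  map_mem : ∀ n : ℕ, ∀ a ∈ 𝒜 n, d a ∈ 𝒜 (n + 1)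
  leibniz : ∀ n : ℕ, ∀ a ∈ 𝒜 n, ∀ b : A, d (a * b) = d a * b + (-1 : k) ^ n • (a * d b)

/-- `d` is the differential of a cochain algebra: a derivation of degree `+1` with `d² = 0`. -/
structure IsDifferential (𝒜 : ℕ → Submodule k A) (d : A →ₗ[k] A) : Prop
    extends IsGradedDerivation 𝒜 d where
  sq_zero : ∀ a : A, d (d a) = 0

/-- `f : (A, d) → (B, d')` is a morphism of cochain algebras: an algebra morphism of degree `0`
commuting with the differentials. -/
structure IsDGMorphism (𝒜 : ℕ → Submodule k A) (d : A →ₗ[k] A) (ℬ : ℕ → Submodule k B)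
    (d' : B →ₗ[k] B) (f : A →ₐ[k] B) : Prop where
  map_mem : ∀ n : ℕ, ∀ a ∈ 𝒜 n, f a ∈ ℬ n
  comm : ∀ a : A, f (d a) = d' (f a)

/-- The cohomology `ker d / im d`, for `d² = 0`. -/
abbrev Cohomology (d : A →ₗ[k] A) : Type v :=
  LinearMap.ker d ⧸ (LinearMap.range d).comap (LinearMap.ker d).subtype

/-- The map induced in cohomology by a linear map commuting with the differentials. -/
def cohomologyMap (d : A →ₗ[k] A) (d' : B →ₗ[k] B) (f : A →ₗ[k] B)
    (hf : ∀ a, f (d a) = d' (f a)) : Cohomology d →ₗ[k] Cohomology d' :=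
  Submodule.mapQ _ _
    (f.restrict (p := LinearMap.ker d) (q := LinearMap.ker d') fun a ha => by
      rw [LinearMap.mem_ker] at ha ⊢
      rw [← hf, ha, map_zero])
    (by
      rintro ⟨_, _⟩ ⟨b, rfl⟩
      exact ⟨f b, (hf b).symm⟩)

/-- `f` commutes with the differentials and induces an isomorphism in cohomology. -/
def IsQuasiIso (d : A →ₗ[k] A) (d' : B →ₗ[k] B) (f : A →ₐ[k] B) : Prop :=
  ∃ hf : ∀ a, f.toLinearMap (d a) = d' (f.toLinearMap a),
    Function.Bijective (cohomologyMap d d' f.toLinearMap hf)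

/-- `(P, D)`, regarded as a left module over the cochain algebra `A` through `i : A → P`, is
semifree: it is the union of an increasing sequence `F 0 ⊆ F 1 ⊆ ⋯` of sub dg modules such that
`F 0` and each `F (n + 1) / F n` are free over `A` on a basis of homogeneous cycles. Here
`S n ⊆ F n` is a set of representatives of such a basis. -/
def IsSemifree (𝒢 : ℕ → Submodule k B) (D : B →ₗ[k] B) (i : A →ₐ[k] B) : Prop :=
  letI : Module A B := Module.compHom B i.toRingHom
  ∃ F : ℕ → Submodule A B, Monotone F ∧ (∀ z : B, ∃ n, z ∈ F n) ∧
    (∀ n, ∀ z ∈ F n, D z ∈ F n) ∧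
    ∃ S : ℕ → Set B, ∀ n,
      let F' : Submodule A B := if n = 0 then ⊥ else F (n - 1)
      (∀ b ∈ S n, (∃ m, b ∈ 𝒢 m) ∧ D b ∈ F') ∧
      LinearIndependent A (fun b : S n => F'.mkQ (b : B)) ∧
      F n = F' ⊔ Submodule.span A (S n)

end DG

/-! ### Minimal Sullivan algebras, and the factorisation -/

section Sullivan

open GradedTensorProduct

variable (k : Type u) [Field k]

section

variable (V : ℕ → Type v) [∀ n, AddCommGroup (V n)] [∀ n, Module k (V n)]

/-- `(ΛV, d)` is a minimal Sullivan algebra with `V` concentrated in degrees `≥ 2`: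
`d(V) ⊆ Λ^{≥2}V`, where `Λ^{≥2}V` is the square of the augmentation ideal. For such `V`, the
nilpotence condition `d(V^n) ⊆ Λ(V^{<n})` is then automatic for degree reasons. -/
structure IsMinimalSullivan (d : Lambda k V →ₗ[k] Lambda k V) : Prop
    extends IsDifferential (Lambda.grade k V) d where
  degree_ge_two : ∀ n < 2, Subsingleton (V n)
  minimal : ∀ (n : ℕ) (x : V n),
    d (Lambda.ι k V n x) ∈ (LinearMap.ker (Lambda.aug k V).toLinearMap) ^ 2

variable {k} in
/-- `D` is a `Γ`-derivation (of degree `+1`) of `A ⊗ ΓW`: a derivation such that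
`D(γ^i(x)) = D(x) γ^{i-1}(x)` for all `i ≥ 1` and all `x ∈ W` of even degree. -/
structure IsGammaDerivation {A : Type w} [Ring A] [Algebra k A] (𝒜 : ℕ → Submodule k A)
    [GradedAlgebra 𝒜] (D : (𝒜 ᵍ⊗[k] Gamma.grade k V) →ₗ[k] (𝒜 ᵍ⊗[k] Gamma.grade k V)) : Prop
    extends IsGradedDerivation (tensorGrade 𝒜 (Gamma.grade k V)) D where
  gamma : ∀ n : ℕ, Even n → ∀ (x : V n) (i : ℕ),
    D (1 ᵍ⊗ₜ[k] Gamma.γ k V (i + 1) x) =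
      D (1 ᵍ⊗ₜ[k] Gamma.γ k V 1 x) * (1 ᵍ⊗ₜ[k] Gamma.γ k V i x)

end

variable {k}
variable {Y : ℕ → Type v} [∀ n, AddCommGroup (Y n)] [∀ n, Module k (Y n)]
  {X : ℕ → Type w} [∀ n, AddCommGroup (X n)] [∀ n, Module k (X n)]
  (Ψ : Lambda k Y →ₐ[k] Lambda k X)

/-- The composite `φ : Y → ΛY → ΛX → X` in degree `n`. -/
def phi (n : ℕ) : Y n →ₗ[k] X n :=
  (Lambda.linearPart k X n).comp (Ψ.toLinearMap.comp (Lambda.ι k Y n))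

/-- The graded vector space `coker φ`. -/
abbrev Coker (n : ℕ) : Type w := X n ⧸ LinearMap.range (phi Ψ n)

/-- The graded vector space `s ker φ`, with `(s ker φ)^n = (ker φ)^{n+1}`. -/
abbrev SKer (n : ℕ) : Type v := LinearMap.ker (phi Ψ (n + 1))

/-- The grading of `ΛY ⊗ Λ coker φ`. -/
abbrev baseGrade :=
  tensorGrade (Lambda.grade k Y) (Lambda.grade k (Coker Ψ))

/-- The graded algebra `ΛY ⊗ Λ coker φ ⊗ Γ s ker φ`. -/
abbrev Factor : Type (max u v w) := baseGrade Ψ ᵍ⊗[k] Gamma.grade k (SKer Ψ)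

/-- The grading of `ΛY ⊗ Λ coker φ ⊗ Γ s ker φ`. -/
abbrev Factor.grade : ℕ → Submodule k (Factor Ψ) :=
  tensorGrade (baseGrade Ψ) (Gamma.grade k (SKer Ψ))

/-- The inclusion `ΛY → ΛY ⊗ Λ coker φ ⊗ Γ s ker φ`, `a ↦ a ⊗ 1 ⊗ 1`. -/
def Factor.incl : Lambda k Y →ₐ[k] Factor Ψ :=
  (includeLeft (baseGrade Ψ) (Gamma.grade k (SKer Ψ))).comp
    (includeLeft (Lambda.grade k Y) (Lambda.grade k (Coker Ψ)))

/-- The inclusion `Γ s ker φ → ΛY ⊗ Λ coker φ ⊗ Γ s ker φ`, `z ↦ 1 ⊗ 1 ⊗ z`. -/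
def Factor.inclGamma : Gamma k (SKer Ψ) →ₐ[k] Factor Ψ :=
  includeRight (baseGrade Ψ) (Gamma.grade k (SKer Ψ))

/-- The augmentation `ε ⊗ ε ⊗ ε` of `ΛY ⊗ Λ coker φ ⊗ Γ s ker φ`. -/
def Factor.aug : Factor Ψ →ₐ[k] k :=
  tensorAug
    (tensorAug (Lambda.aug k Y) (Lambda.aug k (Coker Ψ))
      fun _ hn _ ha => Lambda.aug_of_pos k Y hn ha)
    (Gamma.aug k (SKer Ψ))
    (tensorAug_of_pos _ _ _ fun _ hn _ ha => Lambda.aug_of_pos k (Coker Ψ) hn ha)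

end Sullivan

end DGFact

end

/-! Put `K = ker φ`. The middle algebra of the factorisation is a disguised Koszul extension `E = ΛX
⊗ ΛK ⊗ Γ sK` of `ΛX`. The differential of `E` extends that of `ΛX`, kills `K`, sends `sx` to `x` and
obeys the divided power rule. On `E` most of the requirements are visible: the projection to `ΛX` is
a surjective morphism of cochain algebras that vanishes on `Γ⁺ sK`. The work is to show that this
projection is a quasi-isomorphism, to lift `Ψ` to `E`, and to recognise `E` as `ΛY ⊗ Λ coker φ ⊗ Γ
sK`.

Quasi-isomorphism (`IsKoszulDifferential.exists_sub_proj_eq`). The pairs `x, sx` can be removed one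
basis vector `x` of `K` at a time, and a given element involves finitely many of them. If `x` is
even, then `sx` squares to zero and `D(sx · x^n) = x^(n+1)`. If `x` is odd, then `x² = 0` and `D
γ^(n+1)(sx) = x γ^n(sx)`. No division by integers occurs, so divided powers make the argument work
in positive characteristic; only `2` has to be invertible, for odd elements to have square zero.

Lift (`IsKoszulDifferential.exists_lift`). Fix a retraction `κ : Y → K`. By minimality `d(Y^n)` lies
in the subalgebra generated by `Y^{<n}`, so `i` can be built by induction on the degree. The
obstruction at `y` is a cycle killed by the projection, hence the boundary of some `v`. This `v` can
be chosen in the kernel of the projection and without linear part, and it is added to `Ψ y + κ y`.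
The lift therefore has linear part `(φ, κ)`.

Recognition (`Factor.toKoszul_bijective`). A splitting of `φ` gives `Y ⊕ coker φ ≅ X ⊕ K`. Together
with the identity of `Γ sK`, the lift and a section of `X → coker φ` define a morphism from the
factorisation algebra to `E` which, after this linear identification, is the identity modulo terms
of smaller weight. It is thus bijective, and the differential of `E` is transported along it.

Semifreeness (`isSemifree_of_tensor`) uses only that `ΛY` is `k` in degree `0` and zero in degree
`1`, and that `P = ΛY ⊗ B` with `B` graded in degrees `≥ 0`. Filtering by the degree in `B` fails,
since the differential `δ` induced on `B` raises it. Instead a basis of `B` is adapted to `δ`: basis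
elements that are boundaries `δ u` are replaced by the cycles `D(1 ⊗ u)` and enter the filtration
before the remaining elements of one degree less. -/

noncomputable section

universe u v w u' v'

namespace DGFact

/-! ### Algebras presented by homogeneous generators and relations -/

section Presented

variable {k : Type u} [Field k] {α : Type v}

/-- The class of a generator in the algebra presented by the relations `r`. -/
def presGen (r : FreeAlgebra k α → FreeAlgebra k α → Prop) (a : α) : RingQuot r :=
  RingQuot.mkAlgHom k r (FreeAlgebra.ι k a)

variable {deg : α → ℕ} {r : FreeAlgebra k α → FreeAlgebra k α → Prop}

theorem presGen_mem (a : α) : presGen r a ∈ presGrade deg r (deg a) :=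
  ⟨_, wordGrade_gen a, rfl⟩

theorem pres_prod_word (l : List α) :
    RingQuot.mkAlgHom k r (l.map (FreeAlgebra.ι k)).prod = (l.map (presGen r)).prod := by
  rw [map_list_prod, List.map_map]
  rfl

theorem presGrade_eq_span (n : ℕ) : presGrade deg r n =
    Submodule.span k {x | ∃ l : List α, (l.map deg).sum = n ∧ x = (l.map (presGen r)).prod} := by
  rw [presGrade, wordGrade, Submodule.map_span]
  congr 1
  ext x
  constructor
  · rintro ⟨_, ⟨l, hl, rfl⟩, rfl⟩
    exact ⟨l, hl, pres_prod_word l⟩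
  · rintro ⟨l, hl, rfl⟩
    exact ⟨_, ⟨l, hl, rfl⟩, pres_prod_word l⟩

theorem pres_adjoin (r : FreeAlgebra k α → FreeAlgebra k α → Prop) :
    Algebra.adjoin k (Set.range (presGen r)) = ⊤ := by
  have h := FreeAlgebra.adjoin_range_ι k α
  have h2 : (Algebra.adjoin k (Set.range (FreeAlgebra.ι k (X := α)))).map
      (RingQuot.mkAlgHom k r) = ⊤ := by
    rw [h, Algebra.map_top, AlgHom.range_eq_top]
    exact RingQuot.mkAlgHom_surjective k r
  rw [AlgHom.map_adjoin, ← Set.range_comp] at h2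
  exact h2

theorem pres_algHom_ext {B : Type w} [Semiring B] [Algebra k B] {f g : RingQuot r →ₐ[k] B}
    (h : ∀ a, f (presGen r a) = g (presGen r a)) : f = g := by
  apply RingQuot.ringQuot_ext'
  apply FreeAlgebra.hom_ext
  funext a
  exact h a

/-- Induction for algebras given by generators. -/
theorem pres_induction {p : RingQuot r → Prop} (hs : ∀ c : k, p (algebraMap k _ c))
    (hg : ∀ a, p (presGen r a)) (hadd : ∀ x y, p x → p y → p (x + y))
    (hmul : ∀ x y, p x → p y → p (x * y)) (x : RingQuot r) : p x := by
  have hx : x ∈ Algebra.adjoin k (Set.range (presGen r)) := by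
    rw [pres_adjoin]; trivial
  induction hx using Algebra.adjoin_induction with
  | mem x h => obtain ⟨a, rfl⟩ := h; exact hg a
  | algebraMap c => exact hs c
  | add x y _ _ h1 h2 => exact hadd x y h1 h2
  | mul x y _ _ h1 h2 => exact hmul x y h1 h2

theorem word_map_mem {B : Type w} [Ring B] [Algebra k B] {ℬ : ℕ → Submodule k B}
    [SetLike.GradedMonoid ℬ] {f : α → B} (hf : ∀ a, f a ∈ ℬ (deg a)) (l : List α) :
    (l.map f).prod ∈ ℬ (l.map deg).sum := by
  induction l with
  | nil => simpa using SetLike.GradedOne.one_mem (A := ℬ)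
  | cons a l ih =>
    simpa using SetLike.GradedMul.mul_mem (hf a) ih

theorem pres_map_mem {B : Type w} [Ring B] [Algebra k B] {ℬ : ℕ → Submodule k B}
    [SetLike.GradedMonoid ℬ] (f : RingQuot r →ₐ[k] B) (hf : ∀ a, f (presGen r a) ∈ ℬ (deg a))
    {n : ℕ} {x : RingQuot r} (hx : x ∈ presGrade deg r n) : f x ∈ ℬ n := by
  rw [presGrade_eq_span] at hx
  induction hx using Submodule.span_induction with
  | mem x h =>
    obtain ⟨l, rfl, rfl⟩ := h
    rw [map_list_prod, List.map_map]
    exact word_map_mem (deg := deg) hf l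
  | zero => simp
  | add x y _ _ h1 h2 => rw [map_add]; exact add_mem h1 h2
  | smul c x _ h => rw [map_smul]; exact Submodule.smul_mem _ _ h

/-- Commutation up to a sign can be checked on words. -/
theorem word_comm {B : Type w} [Ring B] [Algebra k B] {β : Type u'} {deg' : β → ℕ} {f : α → B}
    {g : β → B} (h : ∀ a b, f a * g b = (-1 : k) ^ (deg a * deg' b) • (g b * f a))
    (l : List α) (l' : List β) :
    (l.map f).prod * (l'.map g).prod =
      (-1 : k) ^ ((l.map deg).sum * (l'.map deg').sum) • ((l'.map g).prod * (l.map f).prod) := by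
  induction l with
  | nil => simp
  | cons a l ih =>
    have h1 : f a * (l'.map g).prod =
        (-1 : k) ^ (deg a * (l'.map deg').sum) • ((l'.map g).prod * f a) := by
      clear ih
      induction l' with
      | nil => simp
      | cons b l' ih =>
        simp only [List.map_cons, List.prod_cons, List.sum_cons]
        rw [← mul_assoc, h, smul_mul_assoc, mul_assoc, ih, mul_smul_comm, smul_smul, mul_add,
          pow_add, mul_assoc]
    simp only [List.map_cons, List.prod_cons, List.sum_cons]
    rw [mul_assoc, ih, mul_smul_comm, ← mul_assoc, h1, smul_mul_assoc, smul_smul, add_mul, pow_add,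
      mul_assoc, mul_comm ((-1 : k) ^ _)]

/-- Commutation up to a sign of the images of two algebra morphisms can be checked on
generators. -/
theorem pres_comm {B : Type w} [Ring B] [Algebra k B] {β : Type u'} {deg' : β → ℕ}
    {r' : FreeAlgebra k β → FreeAlgebra k β → Prop} (f : RingQuot r →ₐ[k] B)
    (g : RingQuot r' →ₐ[k] B)
    (h : ∀ a b, f (presGen r a) * g (presGen r' b) =
      (-1 : k) ^ (deg a * deg' b) • (g (presGen r' b) * f (presGen r a)))
    {m n : ℕ} {x : RingQuot r} {y : RingQuot r'} (hx : x ∈ presGrade deg r m)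
    (hy : y ∈ presGrade deg' r' n) : f x * g y = (-1 : k) ^ (m * n) • (g y * f x) := by
  rw [presGrade_eq_span] at hx hy
  induction hx using Submodule.span_induction with
  | mem x hx =>
    obtain ⟨l, rfl, rfl⟩ := hx
    induction hy using Submodule.span_induction with
    | mem y hy =>
      obtain ⟨l', rfl, rfl⟩ := hy
      rw [map_list_prod, map_list_prod, List.map_map, List.map_map]
      exact word_comm (f := f ∘ presGen r) (g := g ∘ presGen r') h l l'
    | zero => simp
    | add y y' _ _ h1 h2 => rw [map_add, mul_add, add_mul, h1, h2, smul_add]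
    | smul c y _ h1 => rw [map_smul, mul_smul_comm, h1, smul_mul_assoc, smul_comm]
  | zero => simp
  | add y y' _ _ h1 h2 => rw [map_add, mul_add, add_mul, h1, h2, smul_add]
  | smul c y _ h1 => rw [map_smul, mul_smul_comm, smul_mul_assoc, h1, smul_comm]

theorem pres_gradedCommutative
    (h : ∀ a b, presGen r a * presGen r b =
      (-1 : k) ^ (deg a * deg b) • (presGen r b * presGen r a)) :
    IsGradedCommutative (presGrade deg r) := fun _ _ _ ha _ hb =>
  pres_comm (deg := deg) (deg' := deg) (AlgHom.id k _) (AlgHom.id k _) h ha hb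

/-- The upper right entry of a matrix. -/
def upperRight (k : Type u) [Field k] (B : Type w) [Ring B] [Algebra k B] :
    Matrix (Fin 2) (Fin 2) B →ₗ[k] B where
  toFun M := M 0 1
  map_add' _ _ := rfl
  map_smul' _ _ := rfl

theorem upperRight_apply (k : Type u) [Field k] {B : Type w} [Ring B] [Algebra k B]
    (M : Matrix (Fin 2) (Fin 2) B) : upperRight k B M = M 0 1 := rfl

/-- A twisted derivation on a free algebra, with prescribed values on generators. -/
theorem free_exists_derivation {B : Type w} [Ring B] [Algebra k B]
    (f g : FreeAlgebra k α →ₐ[k] B) (δ : α → B) :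
    ∃ D : FreeAlgebra k α →ₗ[k] B, (∀ a, D (FreeAlgebra.ι k a) = δ a) ∧
      ∀ x y, D (x * y) = D x * g y + f x * D y := by
  -- For upper triangular matrices with diagonal `f, g`, multiplicativity of the corner entry is
  -- exactly the twisted Leibniz rule. A derivation is thus an algebra morphism, and freeness
  -- provides it.
  let F : FreeAlgebra k α →ₐ[k] Matrix (Fin 2) (Fin 2) B :=
    FreeAlgebra.lift k fun a => !![f (FreeAlgebra.ι k a), δ a; 0, g (FreeAlgebra.ι k a)]
  have hF : ∀ x, F x 0 0 = f x ∧ F x 1 0 = 0 ∧ F x 1 1 = g x := by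
    intro x
    induction x using FreeAlgebra.induction with
    | grade0 c =>
      rw [AlgHom.commutes, AlgHom.commutes, AlgHom.commutes]
      simp [Matrix.algebraMap_matrix_apply]
    | grade1 a => simp [F]
    | mul x y hx hy =>
      simp [map_mul, Matrix.mul_apply, Fin.sum_univ_two, hx, hy]
    | add x y hx hy => simp [map_add, hx, hy]
  refine ⟨(upperRight k B).comp F.toLinearMap, fun a => ?_, fun x y => ?_⟩
  · simp [F, upperRight_apply]
  · simp [upperRight_apply, map_mul, Matrix.mul_apply, Fin.sum_univ_two, hF, add_comm]

/-- A twisted derivation on an algebra given by generators and relations. -/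
theorem pres_exists_derivation {B : Type w} [Ring B] [Algebra k B]
    (f g : RingQuot r →ₐ[k] B) (D' : FreeAlgebra k α →ₗ[k] B)
    (hD' : ∀ x y, D' (x * y) = D' x * g (RingQuot.mkAlgHom k r y) +
      f (RingQuot.mkAlgHom k r x) * D' y)
    (hr : ∀ x y, r x y → D' x = D' y) :
    ∃ D : RingQuot r →ₗ[k] B, (∀ x, D (RingQuot.mkAlgHom k r x) = D' x) ∧
      ∀ x y, D (x * y) = D x * g y + f x * D y := by
  have h1 : D' 1 = 0 := by
    have := hD' 1 1
    simp only [mul_one, map_one, one_mul] at this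
    simpa using this
  let F : FreeAlgebra k α →ₐ[k] Matrix (Fin 2) (Fin 2) B :=
    AlgHom.ofLinearMap
      { toFun := fun x => !![f (RingQuot.mkAlgHom k r x), D' x; 0, g (RingQuot.mkAlgHom k r x)]
        map_add' := fun x y => by ext i j; fin_cases i <;> fin_cases j <;> simp
        map_smul' := fun c x => by ext i j; fin_cases i <;> fin_cases j <;> simp }
      (by ext i j; fin_cases i <;> fin_cases j <;> simp [h1])
      (fun x y => by
        ext i j
        fin_cases i <;> fin_cases j <;>
          simp [Matrix.mul_apply, Fin.sum_univ_two, hD', add_comm])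
  have hF : ∀ x, F x = !![f (RingQuot.mkAlgHom k r x), D' x; 0, g (RingQuot.mkAlgHom k r x)] :=
    fun x => rfl
  -- The diagonal respects the relations because `f` and `g` live on the quotient; the corner does
  -- by `hr`.
  let F' : RingQuot r →ₐ[k] Matrix (Fin 2) (Fin 2) B := RingQuot.liftAlgHom k ⟨F, by
    intro x y hxy
    rw [hF, hF, hr x y hxy, RingQuot.mkAlgHom_rel k hxy]⟩
  have hF' : ∀ x, F' (RingQuot.mkAlgHom k r x) = F x := fun x =>
    RingQuot.liftAlgHom_mkAlgHom_apply k _ _ _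
  have hD : ∀ x, (upperRight k B).comp F'.toLinearMap (RingQuot.mkAlgHom k r x) =
      D' x := by
    intro x
    simp [upperRight_apply, hF', hF]
  refine ⟨(upperRight k B).comp F'.toLinearMap, hD, fun x y => ?_⟩
  obtain ⟨x, rfl⟩ := RingQuot.mkAlgHom_surjective k r x
  obtain ⟨y, rfl⟩ := RingQuot.mkAlgHom_surjective k r y
  rw [← map_mul, hD, hD, hD, hD']

end Presented

/-! ### The sign automorphism -/

section Sign

variable {k : Type u} [Field k] {A : Type v} [Ring A] [Algebra k A] (𝒜 : ℕ → Submodule k A)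
  [GradedAlgebra 𝒜]

/-- The linear map that multiplies elements of degree `n` by `(-1)^n`. -/
def signLin : A →ₗ[k] A :=
  (DirectSum.toModule k ℕ A fun n => (-1 : k) ^ n • (𝒜 n).subtype).comp
    (DirectSum.decomposeLinearEquiv 𝒜).toLinearMap

variable {𝒜} in
theorem signLin_of_mem {n : ℕ} {a : A} (ha : a ∈ 𝒜 n) : signLin 𝒜 a = (-1 : k) ^ n • a := by
  have : DirectSum.decompose 𝒜 a = DirectSum.lof k ℕ (fun i => 𝒜 i) n ⟨a, ha⟩ :=
    DirectSum.decompose_of_mem 𝒜 ha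
  simp only [signLin, LinearMap.comp_apply, LinearEquiv.coe_coe,
    DirectSum.decomposeLinearEquiv_apply]
  rw [this, DirectSum.toModule_lof]
  rfl

theorem homogeneous_induction {p : A → Prop} (h : ∀ n, ∀ a ∈ 𝒜 n, p a)
    (hadd : ∀ x y, p x → p y → p (x + y)) (a : A) : p a := by
  classical
  rw [← DirectSum.sum_support_decompose 𝒜 a]
  refine Finset.sum_induction _ p hadd ?_ fun n _ => h n _ (SetLike.coe_mem _)
  exact h 0 0 (zero_mem _)

/-- The automorphism `a ↦ (-1)^{|a|} a`. -/
def signHom : A →ₐ[k] A :=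
  AlgHom.ofLinearMap (signLin 𝒜)
    (by simpa using signLin_of_mem (𝒜 := 𝒜) SetLike.GradedOne.one_mem)
    (by
      intro x y
      induction x using homogeneous_induction 𝒜 with
      | h n x hx =>
        induction y using homogeneous_induction 𝒜 with
        | h m y hy =>
          rw [signLin_of_mem (SetLike.GradedMul.mul_mem hx hy), signLin_of_mem hx,
            signLin_of_mem hy, smul_mul_smul_comm, pow_add]
        | hadd y y' h1 h2 => rw [mul_add, map_add, map_add, mul_add, h1, h2]
      | hadd y y' h1 h2 => rw [add_mul, map_add, map_add, add_mul, h1, h2])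

variable {𝒜} in
theorem signHom_of_mem {n : ℕ} {a : A} (ha : a ∈ 𝒜 n) : signHom 𝒜 a = (-1 : k) ^ n • a :=
  signLin_of_mem ha

end Sign

/-! ### Universal properties of `ΛV` and `ΓW` -/

section Lambda

variable {k : Type u} [Field k] {V : ℕ → Type v} [∀ n, AddCommGroup (V n)] [∀ n, Module k (V n)]

theorem Lambda.ι_mem (n : ℕ) (x : V n) : Lambda.ι k V n x ∈ Lambda.grade k V n :=
  presGen_mem (k := k) (deg := fun a : Σ n, V n => a.1) (r := LambdaRel k V) ⟨n, x⟩

theorem Lambda.ι_comm (m n : ℕ) (x : V m) (y : V n) : Lambda.ι k V m x * Lambda.ι k V n y =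
    (-1 : k) ^ (m * n) • (Lambda.ι k V n y * Lambda.ι k V m x) := by
  have := RingQuot.mkAlgHom_rel k (LambdaRel.comm (k := k) m n x y)
  rw [map_mul, map_smul, map_mul] at this
  exact this

theorem Lambda.gradedCommutative : IsGradedCommutative (Lambda.grade k V) :=
  pres_gradedCommutative fun a b => Lambda.ι_comm a.1 b.1 a.2 b.2

/-- The algebra morphism from `ΛV` with prescribed graded commuting values on `V`. -/
def Lambda.lift {B : Type w} [Ring B] [Algebra k B] (f : ∀ n, V n →ₗ[k] B)
    (hf : ∀ m n x y, f m x * f n y = (-1 : k) ^ (m * n) • (f n y * f m x)) :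
    Lambda k V →ₐ[k] B :=
  RingQuot.liftAlgHom k ⟨FreeAlgebra.lift k fun a : Σ n, V n => f a.1 a.2, by
    intro a b h
    cases h with
    | add n x y => simp
    | smul n c x => simp
    | comm m n x y => simpa using hf m n x y⟩

@[simp]
theorem Lambda.lift_ι {B : Type w} [Ring B] [Algebra k B] (f : ∀ n, V n →ₗ[k] B)
    (hf : ∀ m n x y, f m x * f n y = (-1 : k) ^ (m * n) • (f n y * f m x)) (n : ℕ) (x : V n) :
    Lambda.lift f hf (Lambda.ι k V n x) = f n x := by
  refine (RingQuot.liftAlgHom_mkAlgHom_apply k _ _ _).trans ?_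
  simp

theorem Lambda.algHom_ext {B : Type w} [Semiring B] [Algebra k B] {f g : Lambda k V →ₐ[k] B}
    (h : ∀ n x, f (Lambda.ι k V n x) = g (Lambda.ι k V n x)) : f = g :=
  pres_algHom_ext fun a => h a.1 a.2

theorem Lambda.map_mem {B : Type w} [Ring B] [Algebra k B] {ℬ : ℕ → Submodule k B}
    [SetLike.GradedMonoid ℬ] (f : Lambda k V →ₐ[k] B)
    (hf : ∀ n x, f (Lambda.ι k V n x) ∈ ℬ n) {n : ℕ} {x : Lambda k V}
    (hx : x ∈ Lambda.grade k V n) : f x ∈ ℬ n :=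
  pres_map_mem (deg := fun a : Σ n, V n => a.1) f (fun a => hf a.1 a.2) hx

@[simp]
theorem Lambda.aug_ι (n : ℕ) (x : V n) : Lambda.aug k V (Lambda.ι k V n x) = 0 := by
  refine (RingQuot.liftAlgHom_mkAlgHom_apply k _ _ _).trans ?_
  simp

/-- The algebra morphism `ΛV → ΛV'` induced by a linear map `V → V'`. -/
def Lambda.map {V' : ℕ → Type v'} [∀ n, AddCommGroup (V' n)] [∀ n, Module k (V' n)]
    (f : ∀ n, V n →ₗ[k] V' n) : Lambda k V →ₐ[k] Lambda k V' :=
  Lambda.lift (fun n => (Lambda.ι k V' n).comp (f n)) fun _ _ _ _ => Lambda.ι_comm _ _ _ _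

@[simp]
theorem Lambda.map_ι {V' : ℕ → Type v'} [∀ n, AddCommGroup (V' n)] [∀ n, Module k (V' n)]
    (f : ∀ n, V n →ₗ[k] V' n) (n : ℕ) (x : V n) :
    Lambda.map f (Lambda.ι k V n x) = Lambda.ι k V' n (f n x) :=
  Lambda.lift_ι _ _ _ _

end Lambda

section Gamma

variable {k : Type u} [Field k] {W : ℕ → Type v} [∀ n, AddCommGroup (W n)] [∀ n, Module k (W n)]

/-- The laws satisfied by the elements `γ^i(x)` of `ΓW`. -/
structure IsGammaSystem {B : Type w} [Ring B] [Algebra k B] (c : ∀ n, ℕ → W n → B) : Prop where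
  zero (n : ℕ) (x : W n) : c n 0 x = 1
  one_add (n : ℕ) (x y : W n) : c n 1 (x + y) = c n 1 x + c n 1 y
  one_smul (n : ℕ) (a : k) (x : W n) : c n 1 (a • x) = a • c n 1 x
  comm (m n i j : ℕ) (x : W m) (y : W n) :
    c m i x * c n j y = (-1 : k) ^ ((i * m) * (j * n)) • (c n j y * c m i x)
  smul (n : ℕ) (_ : Even n) (i : ℕ) (a : k) (x : W n) : c n i (a • x) = a ^ i • c n i x
  add (n : ℕ) (_ : Even n) (i : ℕ) (x y : W n) : c n i (x + y) =
    ∑ p ∈ Finset.HasAntidiagonal.antidiagonal i, c n p.1 x * c n p.2 y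
  mul (n : ℕ) (_ : Even n) (i j : ℕ) (x : W n) :
    c n i x * c n j x = ((i + j).choose i : k) • c n (i + j) x
  odd (n : ℕ) (_ : Odd n) (i : ℕ) (_ : 2 ≤ i) (x : W n) : c n i x = 0

theorem IsGammaSystem.map {B : Type w} [Ring B] [Algebra k B] {c : ∀ n, ℕ → W n → B}
    (hc : IsGammaSystem (k := k) c) {C : Type u'} [Ring C] [Algebra k C] (f : B →ₐ[k] C) :
    IsGammaSystem (k := k) fun n i x => f (c n i x) where
  zero n x := by rw [hc.zero, map_one]
  one_add n x y := by rw [hc.one_add, map_add]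
  one_smul n a x := by rw [hc.one_smul, map_smul]
  comm m n i j x y := by rw [← map_mul, ← map_mul, hc.comm, map_smul]
  smul n hn i a x := by rw [hc.smul n hn, map_smul]
  add n hn i x y := by simp only [hc.add n hn, map_sum, map_mul]
  mul n hn i j x := by rw [← map_mul, hc.mul n hn, map_smul]
  odd n hn i hi x := by rw [hc.odd n hn i hi, map_zero]

theorem IsGammaSystem.precomp {B : Type w} [Ring B] [Algebra k B] {c : ∀ n, ℕ → W n → B}
    (hc : IsGammaSystem (k := k) c) {W' : ℕ → Type v'} [∀ n, AddCommGroup (W' n)]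
    [∀ n, Module k (W' n)] (f : ∀ n, W' n →ₗ[k] W n) :
    IsGammaSystem (k := k) fun n i x => c n i (f n x) where
  zero n x := hc.zero _ _
  one_add n x y := by rw [map_add, hc.one_add]
  one_smul n a x := by rw [map_smul, hc.one_smul]
  comm m n i j x y := hc.comm _ _ _ _ _ _
  smul n hn i a x := by rw [map_smul, hc.smul n hn]
  add n hn i x y := by rw [map_add, hc.add n hn]
  mul n hn i j x := hc.mul n hn _ _ _
  odd n hn i hi x := hc.odd n hn i hi _

theorem Gamma.isGammaSystem : IsGammaSystem (k := k) fun n i (x : W n) => Gamma.γ k W i x where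
  zero n x := by
    simpa [Gamma.γ] using RingQuot.mkAlgHom_rel k (GammaRel.zero (k := k) n x)
  one_add n x y := by
    simpa [Gamma.γ] using RingQuot.mkAlgHom_rel k (GammaRel.one_add (k := k) n x y)
  one_smul n a x := by
    simpa [Gamma.γ] using RingQuot.mkAlgHom_rel k (GammaRel.one_smul (k := k) n a x)
  comm m n i j x y := by
    simpa [Gamma.γ] using RingQuot.mkAlgHom_rel k (GammaRel.comm (k := k) m n i j x y)
  smul n hn i a x := by
    simpa [Gamma.γ] using RingQuot.mkAlgHom_rel k (GammaRel.smul (k := k) n hn i a x)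
  add n hn i x y := by
    simpa only [map_sum, map_mul, Gamma.γ] using RingQuot.mkAlgHom_rel k (GammaRel.add (k := k) n hn i x y)
  mul n hn i j x := by
    simpa [Gamma.γ] using RingQuot.mkAlgHom_rel k (GammaRel.mul (k := k) n hn i j x)
  odd n hn i hi x := by
    simpa [Gamma.γ] using RingQuot.mkAlgHom_rel k (GammaRel.odd (k := k) n hn i hi x)

theorem Gamma.γ_mem {n : ℕ} (i : ℕ) (x : W n) : Gamma.γ k W i x ∈ Gamma.grade k W (i * n) :=
  presGen_mem (k := k) (deg := fun a : Σ n, ℕ × W n => a.2.1 * a.1) (r := GammaRel k W) ⟨n, i, x⟩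

theorem Gamma.gradedCommutative : IsGradedCommutative (Gamma.grade k W) :=
  pres_gradedCommutative fun a b => Gamma.isGammaSystem.comm a.1 b.1 a.2.1 b.2.1 a.2.2 b.2.2

/-- The algebra morphism from `ΓW` with prescribed values on the `γ^i(x)`. -/
def Gamma.lift {B : Type w} [Ring B] [Algebra k B] (c : ∀ n, ℕ → W n → B)
    (hc : IsGammaSystem (k := k) c) : Gamma k W →ₐ[k] B :=
  RingQuot.liftAlgHom k ⟨FreeAlgebra.lift k fun a : Σ n, ℕ × W n => c a.1 a.2.1 a.2.2, by
    intro a b h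
    cases h with
    | zero n x => simpa using hc.zero n x
    | one_add n x y => simpa using hc.one_add n x y
    | one_smul n c x => simpa using hc.one_smul n c x
    | comm m n i j x y => simpa using hc.comm m n i j x y
    | smul n hn i c x => simpa using hc.smul n hn i c x
    | add n hn i x y => simpa using hc.add n hn i x y
    | mul n hn i j x => simpa using hc.mul n hn i j x
    | odd n hn i hi x => simpa using hc.odd n hn i hi x⟩

@[simp]
theorem Gamma.lift_γ {B : Type w} [Ring B] [Algebra k B] (c : ∀ n, ℕ → W n → B)
    (hc : IsGammaSystem (k := k) c) {n : ℕ} (i : ℕ) (x : W n) :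
    Gamma.lift c hc (Gamma.γ k W i x) = c n i x := by
  refine (RingQuot.liftAlgHom_mkAlgHom_apply k _ _ _).trans ?_
  simp

theorem Gamma.algHom_ext {B : Type w} [Semiring B] [Algebra k B] {f g : Gamma k W →ₐ[k] B}
    (h : ∀ n i (x : W n), f (Gamma.γ k W i x) = g (Gamma.γ k W i x)) : f = g :=
  pres_algHom_ext fun a => h a.1 a.2.1 a.2.2

theorem Gamma.map_mem {B : Type w} [Ring B] [Algebra k B] {ℬ : ℕ → Submodule k B}
    [SetLike.GradedMonoid ℬ] (f : Gamma k W →ₐ[k] B)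
    (hf : ∀ n i (x : W n), f (Gamma.γ k W i x) ∈ ℬ (i * n)) {n : ℕ} {x : Gamma k W}
    (hx : x ∈ Gamma.grade k W n) : f x ∈ ℬ n :=
  pres_map_mem (deg := fun a : Σ n, ℕ × W n => a.2.1 * a.1) f (fun a => hf a.1 a.2.1 a.2.2) hx

theorem Gamma.aug_γ {n : ℕ} (i : ℕ) (x : W n) :
    Gamma.aug k W (Gamma.γ k W i x) = if i = 0 then 1 else 0 := by
  refine (RingQuot.liftAlgHom_mkAlgHom_apply k _ _ _).trans ?_
  simp

end Gamma

/-! ### The algebra `ΛV ⊗ ΓW` by generators and relations -/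

section LG

/-- The generators of `ΛV ⊗ ΓW`. -/
abbrev FreeGen (V : ℕ → Type v) (W : ℕ → Type w) : Type (max v w) :=
  (Σ n, V n) ⊕ (Σ n, ℕ × W n)

/-- The degree of a generator. -/
def FreeGen.deg {V : ℕ → Type v} {W : ℕ → Type w} : FreeGen V W → ℕ :=
  Sum.elim (fun a => a.1) (fun a => a.2.1 * a.1)

variable (k : Type u) [Field k] (V : ℕ → Type v) [∀ n, AddCommGroup (V n)]
  [∀ n, Module k (V n)] (W : ℕ → Type w) [∀ n, AddCommGroup (W n)] [∀ n, Module k (W n)]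

/-- The relations of `ΛV ⊗ ΓW`. -/
inductive LGRel : FreeAlgebra k (FreeGen V W) → FreeAlgebra k (FreeGen V W) → Prop
  | lambda (a b : FreeAlgebra k (Σ n, V n)) (_ : LambdaRel k V a b) :
      LGRel (FreeAlgebra.lift k (fun x => FreeAlgebra.ι k (Sum.inl x)) a)
        (FreeAlgebra.lift k (fun x => FreeAlgebra.ι k (Sum.inl x)) b)
  | gamma (a b : FreeAlgebra k (Σ n, ℕ × W n)) (_ : GammaRel k W a b) :
      LGRel (FreeAlgebra.lift k (fun x => FreeAlgebra.ι k (Sum.inr x)) a)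
        (FreeAlgebra.lift k (fun x => FreeAlgebra.ι k (Sum.inr x)) b)
  | comm (m : ℕ) (x : V m) (n i : ℕ) (y : W n) :
      LGRel (FreeAlgebra.ι k (Sum.inl ⟨m, x⟩) * FreeAlgebra.ι k (Sum.inr ⟨n, i, y⟩))
        ((-1 : k) ^ (m * (i * n)) •
          (FreeAlgebra.ι k (Sum.inr ⟨n, i, y⟩) * FreeAlgebra.ι k (Sum.inl ⟨m, x⟩)))

/-- The algebra `ΛV ⊗ ΓW`, given by generators and relations. -/
abbrev LG : Type (max u v w) := RingQuot (LGRel k V W)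

/-- The grading of `ΛV ⊗ ΓW`. -/
def LG.grade : ℕ → Submodule k (LG k V W) := presGrade FreeGen.deg (LGRel k V W)

variable {k V W}

theorem lambdaRel_homogeneous {a b : FreeAlgebra k (Σ n, V n)} (h : LambdaRel k V a b) :
    ∃ n, a ∈ wordGrade (fun a : Σ n, V n => a.1) n ∧
      b ∈ wordGrade (fun a : Σ n, V n => a.1) n := by
  have hg := fun n (x : V n) => wordGrade_gen (k := k) (deg := fun a : Σ n, V n => a.1) ⟨n, x⟩
  cases h with
  | add n x y => exact ⟨n, hg n _, add_mem (hg n x) (hg n y)⟩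
  | smul n c x => exact ⟨n, hg n _, Submodule.smul_mem _ _ (hg n x)⟩
  | comm m n x y =>
    exact ⟨m + n, wordGrade_mul (hg m x) (hg n y),
      Submodule.smul_mem _ _ (wordGrade_congr (wordGrade_mul (hg n y) (hg m x)) (add_comm _ _))⟩

theorem gammaRel_homogeneous {a b : FreeAlgebra k (Σ n, ℕ × W n)} (h : GammaRel k W a b) :
    ∃ n, a ∈ wordGrade (fun a : Σ n, ℕ × W n => a.2.1 * a.1) n ∧
      b ∈ wordGrade (fun a : Σ n, ℕ × W n => a.2.1 * a.1) n := by
  cases h with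
  | zero n x =>
    exact ⟨0, wordGrade_congr (gammaGen_mem k W 0 x) (zero_mul n), wordGrade_one⟩
  | one_add n x y =>
    exact ⟨1 * n, gammaGen_mem k W 1 _, add_mem (gammaGen_mem k W 1 x) (gammaGen_mem k W 1 y)⟩
  | one_smul n c x =>
    exact ⟨1 * n, gammaGen_mem k W 1 _, Submodule.smul_mem _ _ (gammaGen_mem k W 1 x)⟩
  | comm m n i j x y =>
    exact ⟨i * m + j * n, wordGrade_mul (gammaGen_mem k W i x) (gammaGen_mem k W j y),
      Submodule.smul_mem _ _ (wordGrade_congr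
        (wordGrade_mul (gammaGen_mem k W j y) (gammaGen_mem k W i x)) (add_comm _ _))⟩
  | smul n _ i c x =>
    exact ⟨i * n, gammaGen_mem k W i _, Submodule.smul_mem _ _ (gammaGen_mem k W i x)⟩
  | add n _ i x y =>
    refine ⟨i * n, gammaGen_mem k W i _, Submodule.sum_mem _ fun p hp => ?_⟩
    refine wordGrade_congr (wordGrade_mul (gammaGen_mem k W p.1 x) (gammaGen_mem k W p.2 y)) ?_
    rw [← add_mul, Finset.HasAntidiagonal.mem_antidiagonal.mp hp]
  | mul n _ i j x =>
    exact ⟨(i + j) * n, wordGrade_congr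
      (wordGrade_mul (gammaGen_mem k W i x) (gammaGen_mem k W j x)) (add_mul _ _ _).symm,
      Submodule.smul_mem _ _ (gammaGen_mem k W (i + j) x)⟩
  | odd n _ i _ x => exact ⟨i * n, gammaGen_mem k W i x, zero_mem _⟩

theorem wordGrade_relabel {α : Type v} {β : Type w} {deg : α → ℕ} {deg' : β → ℕ} (e : α → β)
    (he : ∀ a, deg' (e a) = deg a) {n : ℕ} {x : FreeAlgebra k α} (hx : x ∈ wordGrade deg n) :
    FreeAlgebra.lift k (fun a => FreeAlgebra.ι k (e a)) x ∈ wordGrade (k := k) deg' n := by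
  induction hx using Submodule.span_induction with
  | mem x h =>
    obtain ⟨l, rfl, rfl⟩ := h
    refine Submodule.subset_span ⟨l.map e, ?_, ?_⟩
    · rw [List.map_map]
      congr 2
      funext a
      exact he a
    · rw [map_list_prod, List.map_map, List.map_map]
      congr 2
      funext a
      simp
  | zero => simp
  | add x y _ _ h1 h2 => rw [map_add]; exact add_mem h1 h2
  | smul c x _ h => rw [map_smul]; exact Submodule.smul_mem _ _ h

instance LG.gradedAlgebra : GradedAlgebra (LG.grade k V W) :=
  presGradedAlgebra (deg := FreeGen.deg) (LGRel k V W) (by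
    intro a b h
    cases h with
    | lambda a b h =>
      obtain ⟨n, h1, h2⟩ := lambdaRel_homogeneous h
      exact ⟨n, wordGrade_relabel _ (fun _ => rfl) h1, wordGrade_relabel _ (fun _ => rfl) h2⟩
    | gamma a b h =>
      obtain ⟨n, h1, h2⟩ := gammaRel_homogeneous h
      exact ⟨n, wordGrade_relabel _ (fun _ => rfl) h1, wordGrade_relabel _ (fun _ => rfl) h2⟩
    | comm m x n i y =>
      have h1 := wordGrade_gen (k := k) (deg := FreeGen.deg (V := V) (W := W)) (Sum.inl ⟨m, x⟩)
      have h2 := wordGrade_gen (k := k) (deg := FreeGen.deg (V := V) (W := W)) (Sum.inr ⟨n, i, y⟩)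
      exact ⟨_, wordGrade_mul h1 h2,
        Submodule.smul_mem _ _ (wordGrade_congr (wordGrade_mul h2 h1) (add_comm _ _))⟩)

variable (k V W)

/-- The inclusion `ΛV → ΛV ⊗ ΓW`. -/
def LG.inL : Lambda k V →ₐ[k] LG k V W :=
  RingQuot.liftAlgHom k ⟨(RingQuot.mkAlgHom k (LGRel k V W)).comp
    (FreeAlgebra.lift k (fun x => FreeAlgebra.ι k (Sum.inl x))), fun a b h =>
      RingQuot.mkAlgHom_rel k (LGRel.lambda a b h)⟩

/-- The inclusion `ΓW → ΛV ⊗ ΓW`. -/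
def LG.inR : Gamma k W →ₐ[k] LG k V W :=
  RingQuot.liftAlgHom k ⟨(RingQuot.mkAlgHom k (LGRel k V W)).comp
    (FreeAlgebra.lift k (fun x => FreeAlgebra.ι k (Sum.inr x))), fun a b h =>
      RingQuot.mkAlgHom_rel k (LGRel.gamma a b h)⟩

/-- The inclusion `V → ΛV ⊗ ΓW`. -/
def LG.ι (n : ℕ) : V n →ₗ[k] LG k V W := (LG.inL k V W).toLinearMap.comp (Lambda.ι k V n)

variable {W} in
/-- The element `1 ⊗ γ^i(x)` of `ΛV ⊗ ΓW`. -/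
def LG.γ {n : ℕ} (i : ℕ) (x : W n) : LG k V W := LG.inR k V W (Gamma.γ k W i x)

variable {k V W}

theorem LG.inL_ι (n : ℕ) (x : V n) : LG.inL k V W (Lambda.ι k V n x) = LG.ι k V W n x := rfl

theorem LG.inR_γ {n : ℕ} (i : ℕ) (x : W n) : LG.inR k V W (Gamma.γ k W i x) = LG.γ k V i x := rfl

theorem LG.presGen_inl (n : ℕ) (x : V n) :
    presGen (LGRel k V W) (Sum.inl ⟨n, x⟩) = LG.ι k V W n x := by
  refine Eq.symm ((RingQuot.liftAlgHom_mkAlgHom_apply k _ _ _).trans ?_)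
  simp [presGen]

theorem LG.presGen_inr (n i : ℕ) (x : W n) :
    presGen (LGRel k V W) (Sum.inr ⟨n, i, x⟩) = LG.γ k V i x := by
  refine Eq.symm ((RingQuot.liftAlgHom_mkAlgHom_apply k _ _ _).trans ?_)
  simp [presGen]

theorem LG.ι_mem (n : ℕ) (x : V n) : LG.ι k V W n x ∈ LG.grade k V W n := by
  rw [← LG.presGen_inl]
  exact presGen_mem (deg := FreeGen.deg) (Sum.inl ⟨n, x⟩)

theorem LG.γ_mem {n : ℕ} (i : ℕ) (x : W n) : LG.γ k V i x ∈ LG.grade k V W (i * n) := by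
  rw [← LG.presGen_inr]
  exact presGen_mem (deg := FreeGen.deg) (Sum.inr ⟨n, i, x⟩)

theorem LG.isGammaSystem : IsGammaSystem (k := k) fun n i (x : W n) => LG.γ k V i x :=
  Gamma.isGammaSystem.map (LG.inR k V W)

theorem LG.ι_comm_γ (m : ℕ) (x : V m) (n i : ℕ) (y : W n) :
    LG.ι k V W m x * LG.γ k V i y =
      (-1 : k) ^ (m * (i * n)) • (LG.γ k V i y * LG.ι k V W m x) := by
  have := RingQuot.mkAlgHom_rel k (LGRel.comm (k := k) m x n i y)
  rw [map_mul, map_smul, map_mul] at this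
  rw [← LG.presGen_inl, ← LG.presGen_inr]
  exact this

theorem LG.gradedCommutative : IsGradedCommutative (LG.grade k V W) := by
  refine pres_gradedCommutative fun a b => ?_
  rcases a with ⟨m, x⟩ | ⟨m, i, x⟩ <;> rcases b with ⟨n, y⟩ | ⟨n, j, y⟩ <;>
    simp only [LG.presGen_inl, LG.presGen_inr, FreeGen.deg, Sum.elim_inl, Sum.elim_inr]
  · rw [← LG.inL_ι, ← LG.inL_ι, ← map_mul, Lambda.ι_comm, map_smul, map_mul]
  · exact LG.ι_comm_γ _ _ _ _ _
  · rw [LG.ι_comm_γ, smul_smul, mul_comm n, ← pow_add, Even.neg_one_pow ⟨_, rfl⟩, one_smul]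
  · exact LG.isGammaSystem.comm _ _ _ _ _ _

/-- The universal property of `ΛV ⊗ ΓW`. -/
def LG.lift {B : Type u'} [Ring B] [Algebra k B] (f : Lambda k V →ₐ[k] B) (g : Gamma k W →ₐ[k] B)
    (h : ∀ (m : ℕ) (x : V m) (n i : ℕ) (y : W n), f (Lambda.ι k V m x) * g (Gamma.γ k W i y) =
      (-1 : k) ^ (m * (i * n)) • (g (Gamma.γ k W i y) * f (Lambda.ι k V m x))) :
    LG k V W →ₐ[k] B :=
  RingQuot.liftAlgHom k ⟨FreeAlgebra.lift k (Sum.elim (fun a : Σ n, V n => f (Lambda.ι k V a.1 a.2))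
      (fun a : Σ n, ℕ × W n => g (Gamma.γ k W a.2.1 a.2.2))), by
    intro a b hab
    have hf : ∀ a, FreeAlgebra.lift k (Sum.elim (fun a : Σ n, V n => f (Lambda.ι k V a.1 a.2))
        (fun a : Σ n, ℕ × W n => g (Gamma.γ k W a.2.1 a.2.2)))
        (FreeAlgebra.lift k (fun x => FreeAlgebra.ι k (Sum.inl x)) a) =
        f (RingQuot.mkAlgHom k (LambdaRel k V) a) := fun a => by
      refine DFunLike.congr_fun (f := AlgHom.comp _ (FreeAlgebra.lift k _)) (g := AlgHom.comp f _)
        (FreeAlgebra.hom_ext ?_) a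
      funext x
      simp [Lambda.ι]
    have hg : ∀ a, FreeAlgebra.lift k (Sum.elim (fun a : Σ n, V n => f (Lambda.ι k V a.1 a.2))
        (fun a : Σ n, ℕ × W n => g (Gamma.γ k W a.2.1 a.2.2)))
        (FreeAlgebra.lift k (fun x => FreeAlgebra.ι k (Sum.inr x)) a) =
        g (RingQuot.mkAlgHom k (GammaRel k W) a) := fun a => by
      refine DFunLike.congr_fun (f := AlgHom.comp _ (FreeAlgebra.lift k _)) (g := AlgHom.comp g _)
        (FreeAlgebra.hom_ext ?_) a
      funext x
      simp [Gamma.γ]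
    cases hab with
    | lambda a b hab => rw [hf, hf, RingQuot.mkAlgHom_rel k hab]
    | gamma a b hab => rw [hg, hg, RingQuot.mkAlgHom_rel k hab]
    | comm m x n i y => simpa using h m x n i y⟩

section

variable {B : Type u'} [Ring B] [Algebra k B] (f : Lambda k V →ₐ[k] B) (g : Gamma k W →ₐ[k] B)
    (h : ∀ (m : ℕ) (x : V m) (n i : ℕ) (y : W n), f (Lambda.ι k V m x) * g (Gamma.γ k W i y) =
      (-1 : k) ^ (m * (i * n)) • (g (Gamma.γ k W i y) * f (Lambda.ι k V m x)))

@[simp]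
theorem LG.lift_ι (n : ℕ) (x : V n) : LG.lift f g h (LG.ι k V W n x) = f (Lambda.ι k V n x) := by
  rw [← LG.presGen_inl]
  refine (RingQuot.liftAlgHom_mkAlgHom_apply k _ _ _).trans ?_
  simp

@[simp]
theorem LG.lift_γ {n : ℕ} (i : ℕ) (x : W n) :
    LG.lift f g h (LG.γ k V i x) = g (Gamma.γ k W i x) := by
  rw [← LG.presGen_inr]
  refine (RingQuot.liftAlgHom_mkAlgHom_apply k _ _ _).trans ?_
  simp

@[simp]
theorem LG.lift_inL (a : Lambda k V) : LG.lift f g h (LG.inL k V W a) = f a := by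
  refine DFunLike.congr_fun (f := (LG.lift f g h).comp (LG.inL k V W)) ?_ a
  exact Lambda.algHom_ext fun n x => LG.lift_ι f g h n x

@[simp]
theorem LG.lift_inR (a : Gamma k W) : LG.lift f g h (LG.inR k V W a) = g a := by
  refine DFunLike.congr_fun (f := (LG.lift f g h).comp (LG.inR k V W)) ?_ a
  exact Gamma.algHom_ext fun n i x => LG.lift_γ f g h i x

end

theorem LG.algHom_ext {B : Type u'} [Semiring B] [Algebra k B] {f g : LG k V W →ₐ[k] B}
    (h : ∀ n x, f (LG.ι k V W n x) = g (LG.ι k V W n x))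
    (h' : ∀ n i (x : W n), f (LG.γ k V i x) = g (LG.γ k V i x)) : f = g := by
  refine pres_algHom_ext fun a => ?_
  rcases a with ⟨n, x⟩ | ⟨n, i, x⟩
  · rw [LG.presGen_inl, h]
  · rw [LG.presGen_inr, h']

theorem LG.induction {p : LG k V W → Prop} (hs : ∀ c : k, p (algebraMap k _ c))
    (hι : ∀ n x, p (LG.ι k V W n x)) (hγ : ∀ n i (x : W n), p (LG.γ k V i x))
    (hadd : ∀ x y, p x → p y → p (x + y)) (hmul : ∀ x y, p x → p y → p (x * y))
    (x : LG k V W) : p x := by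
  refine pres_induction hs (fun a => ?_) hadd hmul x
  rcases a with ⟨n, x⟩ | ⟨n, i, x⟩
  · rw [LG.presGen_inl]; exact hι n x
  · rw [LG.presGen_inr]; exact hγ n i x

theorem LG.map_mem {B : Type u'} [Ring B] [Algebra k B] {ℬ : ℕ → Submodule k B}
    [SetLike.GradedMonoid ℬ] (f : LG k V W →ₐ[k] B) (h : ∀ n x, f (LG.ι k V W n x) ∈ ℬ n)
    (h' : ∀ n i (x : W n), f (LG.γ k V i x) ∈ ℬ (i * n)) {n : ℕ} {x : LG k V W}
    (hx : x ∈ LG.grade k V W n) : f x ∈ ℬ n := by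
  refine pres_map_mem (deg := FreeGen.deg) f (fun a => ?_) hx
  rcases a with ⟨n, x⟩ | ⟨n, i, x⟩
  · rw [LG.presGen_inl]; exact h n x
  · rw [LG.presGen_inr]; exact h' n i x

theorem LG.inR_mem {n : ℕ} {a : Gamma k W} (ha : a ∈ Gamma.grade k W n) :
    LG.inR k V W a ∈ LG.grade k V W n :=
  Gamma.map_mem _ (fun _ i x => LG.γ_mem i x) ha

/-- The projection `ΛV ⊗ ΓW → ΛV`. -/
def LG.projL : LG k V W →ₐ[k] Lambda k V :=
  LG.lift (AlgHom.id k _) ((Algebra.ofId k (Lambda k V)).comp (Gamma.aug k W)) (by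
    intro m x n i y
    rcases Nat.eq_zero_or_pos i with rfl | hi
    · simp [Gamma.aug_γ]
    · simp [Gamma.aug_γ, hi.ne'])

@[simp]
theorem LG.projL_inL (a : Lambda k V) : LG.projL (LG.inL k V W a) = a := LG.lift_inL _ _ _ a

@[simp]
theorem LG.projL_ι (n : ℕ) (x : V n) : LG.projL (LG.ι k V W n x) = Lambda.ι k V n x :=
  LG.lift_ι _ _ _ _ _

@[simp]
theorem LG.projL_inR (a : Gamma k W) :
    LG.projL (LG.inR k V W a) = algebraMap k _ (Gamma.aug k W a) :=
  LG.lift_inR _ _ _ a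

theorem LG.projL_γ {n : ℕ} (i : ℕ) (x : W n) :
    LG.projL (LG.γ k V i x) = if i = 0 then 1 else 0 := by
  rw [← LG.inR_γ, LG.projL_inR, Gamma.aug_γ]
  split_ifs <;> simp

/-- The algebra morphism `ΛV ⊗ ΓW → ΛV' ⊗ ΓW'` induced by linear maps. -/
def LG.map {V' : ℕ → Type u'} [∀ n, AddCommGroup (V' n)] [∀ n, Module k (V' n)]
    {W' : ℕ → Type v'} [∀ n, AddCommGroup (W' n)] [∀ n, Module k (W' n)]
    (f : ∀ n, V n →ₗ[k] V' n) (g : ∀ n, W n →ₗ[k] W' n) : LG k V W →ₐ[k] LG k V' W' :=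
  LG.lift ((LG.inL k V' W').comp (Lambda.map f))
    (Gamma.lift _ (LG.isGammaSystem.precomp g)) (by
      intro m x n i y
      simp only [AlgHom.comp_apply, Lambda.map_ι, Gamma.lift_γ, LG.inL_ι]
      exact LG.ι_comm_γ _ _ _ _ _)

section

variable {V' : ℕ → Type u'} [∀ n, AddCommGroup (V' n)] [∀ n, Module k (V' n)]
    {W' : ℕ → Type v'} [∀ n, AddCommGroup (W' n)] [∀ n, Module k (W' n)]
    (f : ∀ n, V n →ₗ[k] V' n) (g : ∀ n, W n →ₗ[k] W' n)

@[simp]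
theorem LG.map_ι (n : ℕ) (x : V n) : LG.map f g (LG.ι k V W n x) = LG.ι k V' W' n (f n x) := by
  rw [LG.map, LG.lift_ι, AlgHom.comp_apply, Lambda.map_ι, LG.inL_ι]

@[simp]
theorem LG.map_γ {n : ℕ} (i : ℕ) (x : W n) :
    LG.map f g (LG.γ k V i x) = LG.γ k V' i (g n x) := by
  rw [LG.map, LG.lift_γ, Gamma.lift_γ]

theorem LG.map_grade {n : ℕ} {x : LG k V W} (hx : x ∈ LG.grade k V W n) :
    LG.map f g x ∈ LG.grade k V' W' n :=
  LG.map_mem _ (fun n x => by rw [LG.map_ι]; exact LG.ι_mem _ _)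
    (fun n i x => by rw [LG.map_γ]; exact LG.γ_mem _ _) hx

end

end LG

/-! ### Derivations in terms of the sign automorphism -/

section Derivation

variable {k : Type u} [Field k] {A : Type v} [Ring A] [Algebra k A] {𝒜 : ℕ → Submodule k A}
  [GradedAlgebra 𝒜]

/-- Writing the sign through `signHom` frees the Leibniz rule from homogeneity, so identities
between derivations can be checked by induction on generators. -/
theorem IsGradedDerivation.leibniz_sign {d : A →ₗ[k] A} (hd : IsGradedDerivation 𝒜 d) (a b : A) :
    d (a * b) = d a * b + signHom 𝒜 a * d b := by
  induction a using homogeneous_induction 𝒜 with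
  | h n a ha => rw [hd.leibniz n a ha, signHom_of_mem ha, smul_mul_assoc]
  | hadd x y hx hy => rw [add_mul, map_add, hx, hy, map_add, map_add, add_mul, add_mul]; abel

variable (𝒜) in
/-- `D` is a derivation with respect to the sign automorphism, and anticommutes with it. -/
structure IsOddDerivation (D : A →ₗ[k] A) : Prop where
  leibniz : ∀ a b, D (a * b) = D a * b + signHom 𝒜 a * D b
  sign : ∀ a, D (signHom 𝒜 a) = - signHom 𝒜 (D a)

theorem IsOddDerivation.map_one {D : A →ₗ[k] A} (hD : IsOddDerivation 𝒜 D) : D 1 = 0 := by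
  have := hD.leibniz 1 1
  simpa using this

theorem IsOddDerivation.map_algebraMap {D : A →ₗ[k] A} (hD : IsOddDerivation 𝒜 D) (c : k) :
    D (algebraMap k A c) = 0 := by
  rw [Algebra.algebraMap_eq_smul_one, map_smul, hD.map_one, smul_zero]

theorem IsOddDerivation.leibniz_of_mem {D : A →ₗ[k] A} (hD : IsOddDerivation 𝒜 D) {n : ℕ} {a : A}
    (ha : a ∈ 𝒜 n) (b : A) : D (a * b) = D a * b + (-1 : k) ^ n • (a * D b) := by
  rw [hD.leibniz, signHom_of_mem ha, smul_mul_assoc]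

theorem neg_mul_add_mul_neg (a b c d : A) : -a * b + c * -d = -(a * b + c * d) := by
  noncomm_ring

theorem neg_one_pow_succ_smul (n : ℕ) (a : A) : (-1 : k) ^ (n + 1) • a = -((-1 : k) ^ n • a) := by
  rw [pow_succ, mul_neg_one, neg_smul]

theorem IsGradedDerivation.isOddDerivation {d : A →ₗ[k] A} (hd : IsGradedDerivation 𝒜 d) :
    IsOddDerivation 𝒜 d where
  leibniz := hd.leibniz_sign
  sign a := by
    induction a using homogeneous_induction 𝒜 with
    | h n a ha =>
      rw [signHom_of_mem ha, signHom_of_mem (hd.map_mem n a ha), map_smul, neg_one_pow_succ_smul,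
        neg_neg]
    | hadd x y hx hy => rw [map_add, map_add, hx, hy, map_add, map_add, neg_add]

theorem signHom_signHom (a : A) : signHom 𝒜 (signHom 𝒜 a) = a := by
  induction a using homogeneous_induction 𝒜 with
  | h n a ha =>
    rw [signHom_of_mem ha, map_smul, signHom_of_mem ha, smul_smul, ← pow_add,
      Even.neg_one_pow ⟨_, rfl⟩, one_smul]
  | hadd x y hx hy => rw [map_add, map_add, hx, hy]

/-- The (anti)commutator of two odd derivations is a derivation. -/
theorem IsOddDerivation.anticommutator {D E : A →ₗ[k] A} (hD : IsOddDerivation 𝒜 D)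
    (hE : IsOddDerivation 𝒜 E) (a b : A) :
    D (E (a * b)) + E (D (a * b)) =
      (D (E a) + E (D a)) * b + a * (D (E b) + E (D b)) := by
  simp only [hD.leibniz, hE.leibniz, map_add, hD.sign, hE.sign, signHom_signHom]
  noncomm_ring

/-- The two cross terms cancel because `D` anticommutes with the sign automorphism. The square is
thus an ordinary derivation, and `D² = 0` need only be checked on generators. -/
theorem IsOddDerivation.sq_mul {D : A →ₗ[k] A} (hD : IsOddDerivation 𝒜 D) (a b : A) :
    D (D (a * b)) = D (D a) * b + a * D (D b) := by
  simp only [hD.leibniz, map_add, hD.sign, signHom_signHom]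
  noncomm_ring

theorem signHom_map {B : Type w} [Ring B] [Algebra k B] {ℬ : ℕ → Submodule k B}
    [GradedAlgebra ℬ] (f : A →ₐ[k] B) (hf : ∀ n, ∀ a ∈ 𝒜 n, f a ∈ ℬ n) (a : A) :
    signHom ℬ (f a) = f (signHom 𝒜 a) := by
  induction a using homogeneous_induction 𝒜 with
  | h n a ha => rw [signHom_of_mem ha, signHom_of_mem (hf n a ha), map_smul]
  | hadd x y hx hy => rw [map_add, map_add, hx, hy, map_add, map_add]

variable (𝒜) in
/-- `a` behaves like an element of a degree of the same parity as `n + 1`. -/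
structure IsShift (n : ℕ) (a : A) : Prop where
  sign : signHom 𝒜 a = (-1 : k) ^ (n + 1) • a
  comm : ∀ r, ∀ b ∈ 𝒜 r, a * b = (-1 : k) ^ ((n + 1) * r) • (b * a)

theorem neg_one_pow_mul_self (n : ℕ) : ((-1 : k) ^ n) * (-1) ^ n = 1 := by
  rw [← pow_add, Even.neg_one_pow ⟨_, rfl⟩]

theorem IsShift.comm' {n : ℕ} {a : A} (h : IsShift 𝒜 n a) {r : ℕ} {b : A} (hb : b ∈ 𝒜 r) :
    b * a = (-1 : k) ^ ((n + 1) * r) • (a * b) := by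
  rw [h.comm r b hb, smul_smul, neg_one_pow_mul_self, one_smul]

theorem IsShift.zero (n : ℕ) : IsShift 𝒜 n 0 :=
  ⟨by simp, fun _ _ _ => by rw [zero_mul, mul_zero, smul_zero]⟩

theorem IsShift.of_mem (h : IsGradedCommutative 𝒜) {n : ℕ} {a : A} (ha : a ∈ 𝒜 (n + 1)) :
    IsShift 𝒜 n a :=
  ⟨signHom_of_mem ha, fun _ b hb => h _ _ a ha b hb⟩

/-- The compatibility of an odd derivation with graded commutativity. -/
theorem IsShift.leibniz_comm {m n : ℕ} {a a' b b' : A} (ha : a ∈ 𝒜 m) (hb : b ∈ 𝒜 n)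
    (ha' : IsShift 𝒜 m a') (hb' : IsShift 𝒜 n b') :
    a' * b + signHom 𝒜 a * b' = (-1 : k) ^ (m * n) • (b' * a + signHom 𝒜 b * a') := by
  rw [signHom_of_mem ha, signHom_of_mem hb, ha'.comm n b hb, smul_mul_assoc, hb'.comm' ha,
    smul_add, smul_mul_assoc, smul_smul, smul_smul, add_comm, ← pow_add, ← pow_add]
  congr 2
  · rw [show m + (n + 1) * m = m * n + (m + m) by ring, pow_add, Even.neg_one_pow ⟨m, rfl⟩, mul_one]
  · rw [show (m + 1) * n = m * n + n by ring]

end Derivation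

/-! ### Derivations of `ΛV ⊗ ΓW` with prescribed values on generators. -/

section LG

variable {k : Type u} [Field k] {V : ℕ → Type v} [∀ n, AddCommGroup (V n)]
  [∀ n, Module k (V n)] {W : ℕ → Type w} [∀ n, AddCommGroup (W n)] [∀ n, Module k (W n)]

theorem LG.mk_inl (a : Σ n, V n) :
    RingQuot.mkAlgHom k (LGRel k V W) (FreeAlgebra.ι k (Sum.inl a)) = LG.ι k V W a.1 a.2 :=
  LG.presGen_inl a.1 a.2

theorem LG.mk_inr (a : Σ n, ℕ × W n) :
    RingQuot.mkAlgHom k (LGRel k V W) (FreeAlgebra.ι k (Sum.inr a)) = LG.γ k V a.2.1 a.2.2 :=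
  LG.presGen_inr a.1 a.2.1 a.2.2

/-- The value on `γ^i(x)` of a `Γ`-derivation with value `u` on `x`. -/
def gammaDer (u : ∀ n, W n →ₗ[k] LG k V W) (n i : ℕ) (x : W n) : LG k V W :=
  match i with
  | 0 => 0
  | 1 => u n x
  | i + 2 => if Even n then u n x * LG.γ k V (i + 1) x else 0

/-- For even degrees the three cases of the definition are one formula, because `γ^0 = 1`. -/
theorem gammaDer_even (u : ∀ n, W n →ₗ[k] LG k V W) {n : ℕ} (hn : Even n) (i : ℕ) (x : W n) :
    gammaDer u n (i + 1) x = u n x * LG.γ k V i x := by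
  cases i with
  | zero => simp [gammaDer, LG.isGammaSystem.zero]
  | succ i => simp [gammaDer, hn]

/-- The value `u x` has the parity of `n + 1` and `γ^(i-1)(x)` has degree `(i - 1) n`, so the
product has the parity of `i n + 1`. This is what compatibility with the commutation relations
requires. -/
theorem gammaDer_isShift (u : ∀ n, W n →ₗ[k] LG k V W)
    (hu : ∀ n x, IsShift (LG.grade k V W) n (u n x)) (n i : ℕ) (x : W n) :
    IsShift (LG.grade k V W) (i * n) (gammaDer u n i x) := by
  match i with
  | 0 => exact IsShift.zero _
  | 1 => rw [one_mul]; exact hu n x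
  | i + 2 =>
    by_cases hn : Even n
    · rw [gammaDer_even u hn]
      have hγ := LG.γ_mem (k := k) (V := V) (i + 1) x
      constructor
      · rw [map_mul, (hu n x).sign, signHom_of_mem hγ, smul_mul_smul_comm, ← pow_add]
        congr 2
        ring
      · intro r b hb
        rw [mul_assoc, LG.gradedCommutative _ _ _ hγ b hb, mul_smul_comm, ← mul_assoc,
          (hu n x).comm r b hb, smul_mul_assoc, smul_smul, ← pow_add, ← mul_assoc b]
        congr 2
        ring
    · simpa only [gammaDer, hn, if_false] using IsShift.zero _

/-- Derivations of `ΛV ⊗ ΓW` can be prescribed on `V` and on `W`. -/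
theorem LG.exists_derivation (δ : ∀ n, V n →ₗ[k] LG k V W)
    (hδ : ∀ n x, IsShift (LG.grade k V W) n (δ n x)) (u : ∀ n, W n →ₗ[k] LG k V W)
    (hu : ∀ n x, IsShift (LG.grade k V W) n (u n x)) :
    ∃ D : LG k V W →ₗ[k] LG k V W, IsOddDerivation (LG.grade k V W) D ∧
      (∀ n x, D (LG.ι k V W n x) = δ n x) ∧
      ∀ n i x, D (LG.γ k V i x) = gammaDer u n i x := by
  let mk := RingQuot.mkAlgHom k (LGRel k V W)
  -- An odd derivation is a derivation twisted by the sign automorphism on the left. It is built on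
  -- the free algebra with values in the quotient, and it remains to check each relation.
  obtain ⟨D', hgen, hD'⟩ := free_exists_derivation ((signHom (LG.grade k V W)).comp mk) mk
    (Sum.elim (fun a : Σ n, V n => δ a.1 a.2) (fun a : Σ n, ℕ × W n => gammaDer u a.1 a.2.1 a.2.2))
  have hD1 : D' 1 = 0 := by simpa using hD' 1 1
  have hs : ∀ {n : ℕ} (_ : Even n) (i : ℕ) (x : W n),
      signHom (LG.grade k V W) (LG.γ k V i x) = LG.γ k V i x := fun hn i x => by
    rw [signHom_of_mem (LG.γ_mem i x), Even.neg_one_pow (hn.mul_left i), one_smul]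
  have hc : ∀ {n : ℕ} (_ : Even n) (i : ℕ) (x y : W n),
      LG.γ k V i x * u n y = u n y * LG.γ k V i x := fun {n} hn i x y => by
    rw [(hu n y).comm' (LG.γ_mem i x),
      Even.neg_one_pow ((hn.mul_left i).mul_left _), one_smul]
  obtain ⟨D, hDmk, hDl⟩ := pres_exists_derivation (r := LGRel k V W)
    (signHom (LG.grade k V W)) (AlgHom.id k _) D' hD' (by
      intro x y hxy
      cases hxy with
      | lambda a b hab =>
        cases hab with
        | add n x y => simp [hgen]
        | smul n c x => simp [hgen]
        | comm m n x y =>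
          simp only [map_mul, map_smul, FreeAlgebra.lift_ι_apply, hD', hgen, Sum.elim_inl, mk,
            AlgHom.comp_apply, LG.mk_inl]
          exact IsShift.leibniz_comm (LG.ι_mem m x) (LG.ι_mem n y) (hδ m x) (hδ n y)
      | gamma a b hab =>
        cases hab with
        | zero n x => simp [hgen, gammaDer, hD1]
        | one_add n x y => simp [hgen, gammaDer]
        | one_smul n c x => simp [hgen, gammaDer]
        | comm m n i j x y =>
          simp only [map_mul, map_smul, FreeAlgebra.lift_ι_apply, hD', hgen, Sum.elim_inr, mk,
            AlgHom.comp_apply, LG.mk_inr]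
          exact IsShift.leibniz_comm (LG.γ_mem i x) (LG.γ_mem j y) (gammaDer_isShift u hu m i x)
            (gammaDer_isShift u hu n j y)
        | smul n hn i c x =>
          simp only [map_smul, FreeAlgebra.lift_ι_apply, hgen, Sum.elim_inr]
          cases i with
          | zero => simp [gammaDer]
          | succ i =>
            rw [gammaDer_even u hn, gammaDer_even u hn, map_smul, LG.isGammaSystem.smul n hn,
              smul_mul_smul_comm, pow_succ']
        | add n hn i x y =>
          simp only [map_sum, map_mul, FreeAlgebra.lift_ι_apply, hD', hgen, Sum.elim_inr, mk,
            AlgHom.comp_apply, LG.mk_inr, hs hn]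
          cases i with
          | zero => simp [gammaDer]
          | succ i =>
            -- As `γ^0` has derivative zero, the term `p = (0, i + 1)` drops out of the first sum
            -- and `p = (i + 1, 0)` out of the second. Both remaining sums are indexed by the
            -- antidiagonal of `i`.
            rw [Finset.sum_add_distrib, Finset.Nat.antidiagonal_succ, Finset.sum_cons,
              Finset.sum_map, ← Finset.Nat.antidiagonal_succ, Finset.Nat.antidiagonal_succ',
              Finset.sum_cons, Finset.sum_map, gammaDer_even u hn, LG.isGammaSystem.add n hn,
              map_add, add_mul]
            simp only [Function.Embedding.prodMap, Function.Embedding.coeFn_mk, Prod.map,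
              Nat.succ_eq_add_one, Function.Embedding.refl_apply, gammaDer_even u hn, ← mul_assoc,
              hc hn]
            simp [gammaDer, Finset.mul_sum, mul_assoc]
        | mul n hn i j x =>
          simp only [map_mul, map_smul, FreeAlgebra.lift_ι_apply, hD', hgen, Sum.elim_inr, mk,
            AlgHom.comp_apply, LG.mk_inr, hs hn]
          cases i with
          | zero => simp [gammaDer, LG.isGammaSystem.zero]
          | succ i =>
            cases j with
            | zero => simp [gammaDer, LG.isGammaSystem.zero]
            | succ j =>
              -- Both terms are multiples of `u(x) γ^(i+j+1)(x)`, and their binomial coefficients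
              -- add up by Pascal's rule.
              rw [gammaDer_even u hn, gammaDer_even u hn, ← mul_assoc, hc hn, mul_assoc, mul_assoc,
                LG.isGammaSystem.mul n hn, LG.isGammaSystem.mul n hn,
                show i + 1 + (j + 1) = (i + j + 1) + 1 by ring, gammaDer_even u hn,
                show i + (j + 1) = i + j + 1 by ring, show i + 1 + j = i + j + 1 by ring,
                mul_smul_comm, mul_smul_comm, ← add_smul, ← Nat.cast_add,
                Nat.choose_succ_succ (i + j + 1) i]
        | odd n hn i hi x =>
          obtain ⟨i, rfl⟩ : ∃ j, i = j + 2 := ⟨i - 2, by omega⟩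
          simp [hgen, gammaDer, Nat.not_even_iff_odd.mpr hn]
      | comm m x n i y =>
        simp only [map_smul, hD', hgen, Sum.elim_inr, Sum.elim_inl, mk, AlgHom.comp_apply,
          LG.mk_inl, LG.mk_inr]
        exact IsShift.leibniz_comm (LG.ι_mem m x) (LG.γ_mem i y) (hδ m x)
          (gammaDer_isShift u hu n i y))
  have hDι : ∀ n x, D (LG.ι k V W n x) = δ n x := fun n x => by
    rw [← LG.mk_inl ⟨n, x⟩, hDmk, hgen]
    rfl
  have hDγ : ∀ n i x, D (LG.γ k V i x) = gammaDer u n i x := fun n i x => by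
    rw [← LG.mk_inr ⟨n, i, x⟩, hDmk, hgen]
    rfl
  refine ⟨D, ⟨hDl, fun a => ?_⟩, hDι, hDγ⟩
  have h1 : D 1 = 0 := by simpa using hDl 1 1
  induction a using LG.induction with
  | hs c =>
    rw [AlgHom.commutes, Algebra.algebraMap_eq_smul_one, map_smul, h1]
    simp
  | hι n x =>
    rw [signHom_of_mem (LG.ι_mem n x), map_smul, hDι, (hδ n x).sign, neg_one_pow_succ_smul,
      neg_neg]
  | hγ n i x =>
    rw [signHom_of_mem (LG.γ_mem i x), map_smul, hDγ, (gammaDer_isShift u hu n i x).sign,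
      neg_one_pow_succ_smul, neg_neg]
  | hadd x y hx hy => rw [map_add, map_add, hx, hy, map_add, map_add, neg_add]
  | hmul x y hx hy =>
    rw [map_mul, hDl, hDl, hx, hy, map_add, map_mul, map_mul]
    exact neg_mul_add_mul_neg _ _ _ _

end LG

/-! ### Contracting one pair of generators -/

section Contraction

/-- Commuting `a` with itself gives `2 a² = 0`. This is where the characteristic enters. -/
theorem IsGradedCommutative.mul_self_eq_zero {k : Type u} [Field k] {A : Type v} [Ring A]
    [Algebra k A] {𝒜 : ℕ → Submodule k A} (hA : IsGradedCommutative 𝒜) (h2 : (2 : k) ≠ 0)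
    {n : ℕ} (hn : Odd n) {a : A} (ha : a ∈ 𝒜 n) : a * a = 0 := by
  have h := hA n n a ha a ha
  rw [(hn.mul hn).neg_one_pow, neg_one_smul, eq_neg_iff_add_eq_zero, ← two_smul k] at h
  exact (smul_eq_zero.mp h).resolve_left h2

variable {k : Type u} [Field k] {A : Type v} [Ring A] [Algebra k A] {𝒜 : ℕ → Submodule k A}
  [GradedAlgebra 𝒜]

theorem IsGradedCommutative.commute_of_even (hA : IsGradedCommutative 𝒜)
    {n : ℕ} (hn : Even n) {a : A} (ha : a ∈ 𝒜 n) (b : A) : a * b = b * a := by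
  induction b using homogeneous_induction 𝒜 with
  | h m b hb => rw [hA n m a ha b hb, (hn.mul_right m).neg_one_pow, one_smul]
  | hadd b b' h1 h2 => rw [mul_add, add_mul, h1, h2]

/-- Homogeneous elements of `range e` and of `s` commute up to sign, because `e` preserves degrees.
-/
theorem range_mul_le_mul_range (hA : IsGradedCommutative 𝒜) (e : A →ₐ[k] A)
    (he : ∀ n, ∀ a ∈ 𝒜 n, e a ∈ 𝒜 n) {s : Set A} (hs : ∀ x ∈ s, ∃ n, x ∈ 𝒜 n) :
    LinearMap.range e.toLinearMap * Submodule.span k s ≤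
      Submodule.span k s * LinearMap.range e.toLinearMap := by
  rw [Submodule.mul_le]
  rintro _ ⟨a, rfl⟩ x hx
  simp only [AlgHom.toLinearMap_apply]
  induction a using homogeneous_induction 𝒜 with
  | h n a ha =>
    induction hx using Submodule.span_induction with
    | mem x hx =>
      obtain ⟨m, hm⟩ := hs x hx
      rw [hA _ _ _ (he n a ha) x hm]
      exact Submodule.smul_mem _ _ (Submodule.mul_mem_mul (Submodule.subset_span hx) ⟨a, rfl⟩)
    | zero => rw [mul_zero]; exact zero_mem _
    | add x y _ _ h1 h2 => rw [mul_add]; exact add_mem h1 h2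
    | smul c x _ h => rw [mul_smul_comm]; exact Submodule.smul_mem _ _ h
  | hadd a b h1 h2 => rw [map_add, add_mul]; exact add_mem h1 h2

/-- With `C = span s` and `T = range e`: `C T C T ⊆ C C T T ⊆ C T`. Membership of all elements in `C
T` then reduces to generators. -/
theorem mul_mem_mul_range (hA : IsGradedCommutative 𝒜) (e : A →ₐ[k] A)
    (he : ∀ n, ∀ a ∈ 𝒜 n, e a ∈ 𝒜 n) {s : Set A} (hs : ∀ x ∈ s, ∃ n, x ∈ 𝒜 n)
    (hss : ∀ x ∈ s, ∀ y ∈ s, x * y ∈ Submodule.span k s) {x y : A}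
    (hx : x ∈ Submodule.span k s * LinearMap.range e.toLinearMap)
    (hy : y ∈ Submodule.span k s * LinearMap.range e.toLinearMap) :
    x * y ∈ Submodule.span k s * LinearMap.range e.toLinearMap := by
  have h := Submodule.mul_mem_mul hx hy
  have hC : Submodule.span k s * Submodule.span k s ≤ Submodule.span k s := by
    rw [Submodule.span_mul_span, Submodule.span_le]
    rintro _ ⟨x, hx, y, hy, rfl⟩
    exact hss x hx y hy
  have hT : LinearMap.range e.toLinearMap * LinearMap.range e.toLinearMap ≤
      LinearMap.range e.toLinearMap := by
    rw [Submodule.mul_le]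
    rintro _ ⟨a, rfl⟩ _ ⟨b, rfl⟩
    exact ⟨a * b, map_mul e a b⟩
  rw [mul_assoc, ← mul_assoc (LinearMap.range e.toLinearMap)] at h
  have h2 := mul_le_mul' (le_refl (Submodule.span k s)) (mul_le_mul'
    (range_mul_le_mul_range hA e he hs) (le_refl (LinearMap.range e.toLinearMap))) h
  rw [mul_assoc, ← mul_assoc] at h2
  exact mul_le_mul' hC hT h2

/-- The linear combinations of the `c n` with coefficients in the range of `e`. -/
def combination (e : A →ₐ[k] A) (c : ℕ → A) : (ℕ →₀ A) →ₗ[k] A :=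
  Finsupp.lsum k fun n => (LinearMap.mulLeft k (c n)).comp e.toLinearMap

@[simp]
theorem combination_single (e : A →ₐ[k] A) (c : ℕ → A) (n : ℕ) (a : A) :
    combination e c (Finsupp.single n a) = c n * e a := by
  simp [combination]

theorem combination_eq_sum (e : A →ₐ[k] A) (c : ℕ → A) (b : ℕ →₀ A) {N : ℕ}
    (hN : b.support ⊆ Finset.range N) :
    combination e c b = ∑ n ∈ Finset.range N, c n * e (b n) := by
  rw [combination, Finsupp.lsum_apply, Finsupp.sum_of_support_subset _ hN]
  · rfl
  · simp

theorem exists_support_subset_range (b : ℕ →₀ A) : ∃ N, b.support ⊆ Finset.range N := by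
  refine ⟨b.support.sup id + 1, fun n hn => ?_⟩
  have := Finset.le_sup (f := id) hn
  simp only [id] at this
  simp only [Finset.mem_range]
  omega

theorem exists_combination {e : A →ₐ[k] A} {c d : ℕ → A} {t : A}
    (ht : t ∈ Submodule.span k ({1} ∪ Set.range c ∪ Set.range d) *
      LinearMap.range e.toLinearMap) :
    ∃ a₀ a b, t = e a₀ + combination e c a + combination e d b := by
  let L : A × (ℕ →₀ A) × (ℕ →₀ A) →ₗ[k] A :=
    e.toLinearMap.coprod ((combination e c).coprod (combination e d))
  have hL : ∀ x, L x = e x.1 + (combination e c x.2.1 + combination e d x.2.2) := fun x => rfl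
  have h : Submodule.span k ({1} ∪ Set.range c ∪ Set.range d) * LinearMap.range e.toLinearMap ≤
      LinearMap.range L := by
    rw [Submodule.mul_le]
    rintro x hx _ ⟨a, rfl⟩
    induction hx using Submodule.span_induction with
    | mem x hx =>
      rcases hx with (rfl | ⟨n, rfl⟩) | ⟨n, rfl⟩
      · exact ⟨(a, 0, 0), by simp [hL]⟩
      · exact ⟨(0, Finsupp.single n a, 0), by simp [hL]⟩
      · exact ⟨(0, 0, Finsupp.single n a), by simp [hL]⟩
    | zero => rw [zero_mul]; exact zero_mem _
    | add x y _ _ h1 h2 => rw [add_mul]; exact add_mem h1 h2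
    | smul c x _ h => rw [smul_mul_assoc]; exact Submodule.smul_mem _ _ h
  obtain ⟨x, rfl⟩ := h ht
  exact ⟨x.1, x.2.1, x.2.2, by rw [hL, add_assoc]⟩

/-- By Leibniz, `D(d n · e a) = c n · e a ± d n · e(D a)`: a combination of the `d n` bounds the
corresponding combination of the `c n`, up to another combination of the `d n`. -/
theorem IsOddDerivation.exists_combination {D : A →ₗ[k] A} (hD : IsOddDerivation 𝒜 D)
    {e : A →ₐ[k] A} (heD : ∀ a, e (D a) = D (e a)) {c d : ℕ → A}
    (hd : ∀ n, ∃ m, d n ∈ 𝒜 m) (hcd : ∀ n, D (d n) = c n) (a : ℕ →₀ A) :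
    ∃ b, D (combination e d a) = combination e c a + combination e d b := by
  induction a using Finsupp.induction_linear with
  | zero => exact ⟨0, by simp⟩
  | add a a' h1 h2 =>
    obtain ⟨b, hb⟩ := h1
    obtain ⟨b', hb'⟩ := h2
    exact ⟨b + b', by simp only [map_add, hb, hb']; abel⟩
  | single n a =>
    obtain ⟨m, hm⟩ := hd n
    refine ⟨Finsupp.single n ((-1 : k) ^ m • D a), ?_⟩
    rw [combination_single, combination_single, combination_single, hD.leibniz_of_mem hm, hcd,
      map_smul, mul_smul_comm, heD]

/-- If `A` is spanned by the elements `e(a)`, `c n * e(a)`, `d n * e(a)`, with `D (d n) = c n` and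
with the `c n` independent, then the idempotent `e` induces the identity in cohomology. -/
theorem IsOddDerivation.exists_sub_eq {D : A →ₗ[k] A} (hD : IsOddDerivation 𝒜 D)
    {e : A →ₐ[k] A} (heD : ∀ a, e (D a) = D (e a)) (hee : ∀ a, e (e a) = e a) {c d : ℕ → A}
    (hd : ∀ n, ∃ m, d n ∈ 𝒜 m) (hcd : ∀ n, D (d n) = c n) (hed : ∀ n, e (d n) = 0)
    (hspan : ∀ t, t ∈ Submodule.span k ({1} ∪ Set.range c ∪ Set.range d) *
      LinearMap.range e.toLinearMap)
    (hind : ∀ a₀ a b, e a₀ + combination e c a + combination e d b = 0 → ∀ n, e (a n) = 0)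
    (hDD : ∀ a, D (D a) = 0) {t : A} (ht : D t = 0) : ∃ u, t - e t = D u := by
  obtain ⟨a₀, a, b, h⟩ := DGFact.exists_combination (hspan t)
  obtain ⟨b', hb'⟩ := hD.exists_combination heD hd hcd a
  -- Subtracting a boundary removes the `c`-part of `t`.
  have h1 : t - D (combination e d a) = e a₀ + combination e d (b - b') := by
    rw [h, hb', map_sub]; abel
  obtain ⟨b'', hb''⟩ := hD.exists_combination heD hd hcd (b - b')
  -- The left side of `h1` is a cycle. Its `D` has `c`-coefficients given by `b - b'`, and
  -- independence makes them vanish, so the `d`-part is zero too.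
  have h2 : combination e d (b - b') = 0 := by
    have h3 : e (D a₀) + combination e c (b - b') + combination e d b'' = 0 := by
      rw [add_assoc, ← hb'', heD, ← map_add, ← h1, map_sub, ht, hDD, sub_zero]
    have h4 := hind _ _ _ h3
    obtain ⟨N, hN⟩ := exists_support_subset_range (b - b')
    rw [combination_eq_sum e d _ hN]
    exact Finset.sum_eq_zero fun n _ => by rw [h4, mul_zero]
  rw [h2, add_zero] at h1
  have h5 : e (combination e d a) = 0 := by
    obtain ⟨N, hN⟩ := exists_support_subset_range a
    rw [combination_eq_sum e d _ hN, map_sum]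
    exact Finset.sum_eq_zero fun n _ => by rw [map_mul, hed, zero_mul]
  -- The endomorphism `e` kills every `d n`, so applying it to `h1` identifies the surviving term
  -- with `e t`.
  have h6 : e t = e a₀ := by
    rw [sub_eq_iff_eq_add.mp h1, map_add, hee, heD, h5, map_zero, add_zero]
  exact ⟨_, by rw [h6, ← h1]; abel⟩

/-- The morphism `Φ` turns the relation into a polynomial identity, and `e (a n)` is its coefficient
of degree `n + 1`. -/
theorem independent_of_polynomial {e : A →ₐ[k] A} {c d : ℕ → A} (Φ : A →ₐ[k] Polynomial A)
    (hΦ : ∀ a, Φ (e a) = Polynomial.C (e a)) (hc : ∀ n, Φ (c n) = Polynomial.X ^ (n + 1))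
    (hd : ∀ n, Φ (d n) = 0) (a₀ : A) (a b : ℕ →₀ A)
    (h : e a₀ + combination e c a + combination e d b = 0) (n : ℕ) : e (a n) = 0 := by
  obtain ⟨N, hN⟩ := exists_support_subset_range a
  obtain ⟨M, hM⟩ := exists_support_subset_range b
  rw [combination_eq_sum e c _ hN, combination_eq_sum e d _ hM] at h
  have h1 := congrArg (fun p => (Φ p).coeff (n + 1)) h
  simp only [map_add, map_sum, map_mul, hΦ, hc, hd, zero_mul, Finset.sum_const_zero, add_zero,
    Polynomial.coeff_add, Polynomial.coeff_C_succ, zero_add, map_zero, Polynomial.coeff_zero,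
    Polynomial.finsetSum_coeff, Polynomial.X_pow_mul_C, Polynomial.coeff_C_mul,
    Polynomial.coeff_X_pow, add_left_inj, mul_ite, mul_one, mul_zero, Finset.sum_ite_eq,
    Finset.mem_range] at h1
  by_cases hn : n < N
  · simpa [hn] using h1
  · have : a n = 0 := by
      by_contra h0
      exact hn (Finset.mem_range.mp (hN (Finsupp.mem_support_iff.mpr h0)))
    rw [this, map_zero]

/-- In the intended case `c n = y · g n` and `d n = g (n + 1)`, with `g n` the divided powers of one
element. The contraction `η` removes `y` and leaves `∑ g n · e (a n) = 0`. The derivation `Dη + ηD`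
is constant on `range e` and lowers `g (n + 1)` to `g n`, so it plays the role of `d/dg` and the
coefficients are extracted without dividing by factorials. -/
theorem independent_of_derivation {D η : A →ₗ[k] A} (hD : IsOddDerivation 𝒜 D)
    (hη : IsOddDerivation 𝒜 η) {e : A →ₐ[k] A} (heD : ∀ a, e (D a) = D (e a)) {c d g : ℕ → A}
    (hηe : ∀ a, η (e a) = 0) (hηc : ∀ n, η (c n) = g n) (hηd : ∀ n, η (d n) = 0)
    (hg0 : g 0 = 1) (hg : ∀ n, η (D (g (n + 1))) = g n) (hηg : ∀ n, η (g n) = 0)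
    (a₀ : A) (a b : ℕ →₀ A)
    (h : e a₀ + combination e c a + combination e d b = 0) (n : ℕ) : e (a n) = 0 := by
  have key : ∀ (N : ℕ) (f : ℕ → A), ∑ n ∈ Finset.range N, g n * e (f n) = 0 →
      ∀ n < N, e (f n) = 0 := by
    intro N
    induction N with
    | zero => intro f _ n hn; omega
    | succ N ih =>
      intro f hf
      have h0 : ∀ a, D (η (e a)) + η (D (e a)) = 0 := fun a => by
        rw [← heD, hηe, hηe, map_zero, add_zero]
      -- Applying `Dη + ηD` shifts the relation down by one index; the term with `g 0 = 1`
      -- disappears.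
      have hf' : ∑ n ∈ Finset.range N, g n * e (f (n + 1)) = 0 := by
        have h1 := congrArg (fun x => D (η x) + η (D x)) hf
        simp only [map_sum, map_zero, add_zero, ← Finset.sum_add_distrib, hD.anticommutator hη,
          h0, mul_zero] at h1
        rw [Finset.sum_range_succ'] at h1
        simpa [hg, hg0, hηg, hD.map_one, hη.map_one] using h1
      have h2 := ih (fun n => f (n + 1)) hf'
      intro n hn
      cases n with
      | zero =>
        rw [Finset.sum_range_succ', Finset.sum_eq_zero, hg0, one_mul, zero_add] at hf
        · exact hf
        · intro m hm
          rw [h2 m (Finset.mem_range.mp hm), mul_zero]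
      | succ n => exact h2 n (by omega)
  obtain ⟨N, hN⟩ := exists_support_subset_range a
  obtain ⟨M, hM⟩ := exists_support_subset_range b
  rw [combination_eq_sum e c _ hN, combination_eq_sum e d _ hM] at h
  have h1 := congrArg η h
  simp only [map_add, map_sum, hη.leibniz, hηe, hηc, hηd, mul_zero, zero_mul, add_zero,
    Finset.sum_const_zero, map_zero, zero_add] at h1
  by_cases hn : n < N
  · exact key N a h1 n hn
  · have : a n = 0 := by
      by_contra h0
      exact hn (Finset.mem_range.mp (hN (Finsupp.mem_support_iff.mpr h0)))
    rw [this, map_zero]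

end Contraction

/-! ### The Koszul extension `ΛX ⊗ ΛK ⊗ Γ sK` -/

section Koszul

variable (k : Type u) [Field k] (X : ℕ → Type v) [∀ n, AddCommGroup (X n)]
  [∀ n, Module k (X n)] (K : ℕ → Type w) [∀ n, AddCommGroup (K n)] [∀ n, Module k (K n)]

/-- The algebra `ΛX ⊗ ΛK ⊗ Γ sK`. -/
abbrev Koszul := LG k (fun n => X n × K n) (fun n => K (n + 1))

/-- The grading of `ΛX ⊗ ΛK ⊗ Γ sK`. -/
abbrev Koszul.grade := LG.grade k (fun n => X n × K n) (fun n => K (n + 1))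

/-- The inclusion of `ΛX`. -/
def Koszul.inX : Lambda k X →ₐ[k] Koszul k X K :=
  (LG.inL k _ _).comp (Lambda.map fun n => LinearMap.inl k (X n) (K n))

/-- The inclusion of `K`. -/
def Koszul.inK (n : ℕ) : K n →ₗ[k] Koszul k X K :=
  (LG.ι k _ _ n).comp (LinearMap.inr k (X n) (K n))

/-- The projection onto `ΛX`. -/
def Koszul.proj : Koszul k X K →ₐ[k] Lambda k X :=
  (Lambda.map fun n => LinearMap.fst k (X n) (K n)).comp LG.projL

variable {k X K}

/-- The endomorphism induced by an endomorphism of `K`. -/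
def Koszul.map (f : ∀ n, K n →ₗ[k] K n) : Koszul k X K →ₐ[k] Koszul k X K :=
  LG.map (fun n => LinearMap.id.prodMap (f n)) fun n => f (n + 1)

/-- The differential of `ΛX ⊗ ΛK ⊗ Γ sK`: it extends that of `ΛX`, vanishes on `K` and maps `sx`
to `x`. -/
structure IsKoszulDifferential (d : Lambda k X →ₗ[k] Lambda k X)
    (D : Koszul k X K →ₗ[k] Koszul k X K) : Prop where
  odd : IsOddDerivation (Koszul.grade k X K) D
  map_mem : ∀ n, ∀ a ∈ Koszul.grade k X K n, D a ∈ Koszul.grade k X K (n + 1)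
  sq_zero : ∀ a, D (D a) = 0
  map_inX : ∀ a, D (Koszul.inX k X K a) = Koszul.inX k X K (d a)
  map_inK : ∀ n x, D (Koszul.inK k X K n x) = 0
  map_γ : ∀ (n i : ℕ) (x : K (n + 1)),
    D (LG.γ k _ i x) = gammaDer (fun n => Koszul.inK k X K (n + 1)) n i x

theorem Koszul.inX_ι (n : ℕ) (x : X n) :
    Koszul.inX k X K (Lambda.ι k X n x) = LG.ι k _ _ n (x, 0) := by
  rw [Koszul.inX, AlgHom.comp_apply, Lambda.map_ι, LG.inL_ι]
  rfl

theorem Koszul.inK_apply (n : ℕ) (x : K n) : Koszul.inK k X K n x = LG.ι k _ _ n (0, x) := rfl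

theorem Koszul.ι_eq (n : ℕ) (x : X n × K n) : LG.ι k _ (fun n => K (n + 1)) n x =
    Koszul.inX k X K (Lambda.ι k X n x.1) + Koszul.inK k X K n x.2 := by
  rw [Koszul.inX_ι, Koszul.inK_apply, ← map_add, Prod.mk_add_mk, add_zero, zero_add]

theorem Koszul.inX_mem {n : ℕ} {a : Lambda k X} (ha : a ∈ Lambda.grade k X n) :
    Koszul.inX k X K a ∈ Koszul.grade k X K n :=
  Lambda.map_mem _ (fun n x => by rw [Koszul.inX_ι]; exact LG.ι_mem _ _) ha

theorem Koszul.inK_mem (n : ℕ) (x : K n) : Koszul.inK k X K n x ∈ Koszul.grade k X K n :=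
  LG.ι_mem _ _

@[simp]
theorem Koszul.proj_inX (a : Lambda k X) : Koszul.proj k X K (Koszul.inX k X K a) = a := by
  refine DFunLike.congr_fun (f := (Koszul.proj k X K).comp (Koszul.inX k X K))
    (g := AlgHom.id k _) (Lambda.algHom_ext fun n x => ?_) a
  simp [Koszul.proj, Koszul.inX_ι]

@[simp]
theorem Koszul.proj_inK (n : ℕ) (x : K n) : Koszul.proj k X K (Koszul.inK k X K n x) = 0 := by
  simp [Koszul.proj, Koszul.inK_apply]

theorem Koszul.proj_ι (n : ℕ) (x : X n × K n) :
    Koszul.proj k X K (LG.ι k _ _ n x) = Lambda.ι k X n x.1 := by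
  simp [Koszul.proj]

theorem Koszul.proj_inR (a : Gamma k fun n => K (n + 1)) :
    Koszul.proj k X K (LG.inR k _ _ a) = algebraMap k _ (Gamma.aug k _ a) := by
  rw [Koszul.proj, AlgHom.comp_apply, LG.projL_inR, AlgHom.commutes]

theorem Koszul.proj_γ (n i : ℕ) (x : K (n + 1)) :
    Koszul.proj k X K (LG.γ k _ i x) = if i = 0 then 1 else 0 := by
  rw [← LG.inR_γ, Koszul.proj_inR, Gamma.aug_γ]
  split_ifs <;> simp

theorem Koszul.proj_mem {n : ℕ} {a : Koszul k X K} (ha : a ∈ Koszul.grade k X K n) :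
    Koszul.proj k X K a ∈ Lambda.grade k X n := by
  refine LG.map_mem _ (fun n x => ?_) (fun n i x => ?_) ha
  · rw [Koszul.proj_ι]
    exact Lambda.ι_mem _ _
  · rw [Koszul.proj_γ]
    split_ifs with h
    · rw [h, zero_mul]
      exact SetLike.GradedOne.one_mem
    · exact zero_mem _

@[simp]
theorem Koszul.map_inX (f : ∀ n, K n →ₗ[k] K n) (a : Lambda k X) :
    Koszul.map f (Koszul.inX k X K a) = Koszul.inX k X K a := by
  refine DFunLike.congr_fun (f := (Koszul.map f).comp (Koszul.inX k X K))
    (Lambda.algHom_ext fun n x => ?_) a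
  simp [Koszul.map, Koszul.inX_ι]

@[simp]
theorem Koszul.map_inK (f : ∀ n, K n →ₗ[k] K n) (n : ℕ) (x : K n) :
    Koszul.map f (Koszul.inK k X K n x) = Koszul.inK k X K n (f n x) := by
  simp [Koszul.map, Koszul.inK_apply]

@[simp]
theorem Koszul.map_γ (f : ∀ n, K n →ₗ[k] K n) (n i : ℕ) (x : K (n + 1)) :
    Koszul.map (X := X) f (LG.γ k _ i x) = LG.γ k _ (W := fun n => K (n + 1)) i (f (n + 1) x) := by
  simp [Koszul.map]

theorem Koszul.map_mem (f : ∀ n, K n →ₗ[k] K n) (n : ℕ) (a : Koszul k X K)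
    (ha : a ∈ Koszul.grade k X K n) : Koszul.map f a ∈ Koszul.grade k X K n :=
  LG.map_grade _ _ ha

/-- Induction on the generators of `ΛX ⊗ ΛK ⊗ Γ sK`. -/
theorem Koszul.induction {p : Koszul k X K → Prop} (hX : ∀ a, p (Koszul.inX k X K a))
    (hK : ∀ n x, p (Koszul.inK k X K n x)) (hγ : ∀ (n i : ℕ) (x : K (n + 1)), p (LG.γ k _ i x))
    (hadd : ∀ x y, p x → p y → p (x + y)) (hmul : ∀ x y, p x → p y → p (x * y))
    (x : Koszul k X K) : p x := by
  refine LG.induction (fun c => ?_) (fun n x => ?_) hγ hadd hmul x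
  · rw [← AlgHom.commutes (Koszul.inX k X K)]
    exact hX _
  · rw [Koszul.ι_eq]
    exact hadd _ _ (hX _) (hK _ _)

/-- An odd derivation records only parities, so the exact degree `+1` has to be recovered from the
generators, along words. -/
theorem derivation_mem_of_generators {V : ℕ → Type u'} [∀ n, AddCommGroup (V n)]
    [∀ n, Module k (V n)] {W : ℕ → Type v'} [∀ n, AddCommGroup (W n)] [∀ n, Module k (W n)]
    {D : LG k V W →ₗ[k] LG k V W} (hD : IsOddDerivation (LG.grade k V W) D)
    (hι : ∀ n x, D (LG.ι k V W n x) ∈ LG.grade k V W (n + 1))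
    (hγ : ∀ n i (x : W n), D (LG.γ k V i x) ∈ LG.grade k V W (i * n + 1)) {n : ℕ} {a : LG k V W}
    (ha : a ∈ LG.grade k V W n) : D a ∈ LG.grade k V W (n + 1) := by
  have hgen : ∀ a, D (presGen (LGRel k V W) a) ∈ LG.grade k V W (a.deg + 1) := by
    rintro (⟨n, x⟩ | ⟨n, i, x⟩)
    · rw [LG.presGen_inl]
      exact hι n x
    · rw [LG.presGen_inr]
      exact hγ n i x
  have hgen' : ∀ a, presGen (LGRel k V W) a ∈ LG.grade k V W a.deg :=
    fun a => presGen_mem (deg := FreeGen.deg) a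
  have ha' := ha
  rw [LG.grade, presGrade_eq_span] at ha'
  induction ha' using Submodule.span_induction with
  | mem x h =>
    obtain ⟨l, rfl, rfl⟩ := h
    clear ha
    induction l with
    | nil => simp [hD.map_one]
    | cons a l ih =>
      simp only [List.map_cons, List.prod_cons, List.sum_cons]
      rw [hD.leibniz_of_mem (hgen' a)]
      refine add_mem ?_ (Submodule.smul_mem _ _ ?_)
      · have := SetLike.GradedMul.mul_mem (hgen a) (word_map_mem (deg := FreeGen.deg) hgen' l)
        rwa [add_right_comm] at this
      · rw [add_assoc]
        exact SetLike.GradedMul.mul_mem (hgen' a) ih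
  | zero => rw [map_zero]; exact zero_mem _
  | add x y hx hy h1 h2 =>
    rw [map_add]
    refine add_mem (h1 ?_) (h2 ?_) <;> rw [LG.grade, presGrade_eq_span] <;> assumption
  | smul c x hx h =>
    rw [map_smul]
    refine Submodule.smul_mem _ _ (h ?_)
    rw [LG.grade, presGrade_eq_span]
    assumption

theorem Koszul.exists_differential (h2 : (2 : k) ≠ 0) {d : Lambda k X →ₗ[k] Lambda k X}
    (hd : IsDifferential (Lambda.grade k X) d) :
    ∃ D : Koszul k X K →ₗ[k] Koszul k X K, IsKoszulDifferential d D := by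
  obtain ⟨D, hD, hDι, hDγ⟩ := LG.exists_derivation (k := k) (V := fun n => X n × K n)
    (W := fun n => K (n + 1))
    (fun n => (Koszul.inX k X K).toLinearMap.comp (d.comp ((Lambda.ι k X n).comp
      (LinearMap.fst k (X n) (K n)))))
    (fun n x => IsShift.of_mem LG.gradedCommutative
      (Koszul.inX_mem (hd.map_mem n _ (Lambda.ι_mem n _))))
    (fun n => Koszul.inK k X K (n + 1))
    (fun n x => IsShift.of_mem LG.gradedCommutative (Koszul.inK_mem (n + 1) x))
  -- On a generator `γ^i(sx)` with `x` of degree `n + 1`, the value `x γ^(i-1)(sx)` has degree `(n +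
  -- 1) + (i - 1) n = i n + 1`.
  have hmem : ∀ n, ∀ a ∈ Koszul.grade k X K n, D a ∈ Koszul.grade k X K (n + 1) := by
    refine fun n a ha => derivation_mem_of_generators hD (fun n x => ?_) (fun n i x => ?_) ha
    · rw [hDι]
      exact Koszul.inX_mem (hd.map_mem n _ (Lambda.ι_mem n _))
    · rw [hDγ]
      match i with
      | 0 => exact zero_mem _
      | 1 =>
        rw [one_mul]
        exact Koszul.inK_mem (n + 1) x
      | i + 2 =>
        by_cases hn : Even n
        · rw [gammaDer_even _ hn, show (i + 2) * n + 1 = (n + 1) + (i + 1) * n by ring]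
          exact SetLike.GradedMul.mul_mem (Koszul.inK_mem (n + 1) x) (LG.γ_mem _ _)
        · simpa only [gammaDer, hn, if_false] using zero_mem _
  have hX : ∀ a, D (Koszul.inX k X K a) = Koszul.inX k X K (d a) := by
    have hd' := hd.toIsGradedDerivation.isOddDerivation
    intro a
    induction a using pres_induction with
    | hs c =>
      rw [AlgHom.commutes, hD.map_algebraMap]
      exact ((congrArg _ (hd'.map_algebraMap c)).trans (map_zero _)).symm
    | hg a =>
      refine (congrArg D (Koszul.inX_ι a.1 a.2)).trans ?_
      rw [hDι]
      rfl
    | hadd x y hx hy => rw [map_add, map_add, hx, hy, map_add, map_add]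
    | hmul x y hx hy =>
      rw [map_mul, hD.leibniz, hx, hy, hd'.leibniz, map_add, map_mul, map_mul,
        signHom_map (𝒜 := Lambda.grade k X) _ fun n a ha => Koszul.inX_mem ha]
  have hK : ∀ n x, D (Koszul.inK k X K n x) = 0 := fun n x => by
    rw [Koszul.inK_apply, hDι]
    simp
  refine ⟨D, hD, hmem, fun a => ?_, hX, hK, hDγ⟩
  induction a using Koszul.induction with
  | hX a => rw [hX, hX, hd.sq_zero, map_zero]
  | hK n x => rw [hK, map_zero]
  | hγ n i x =>
    rw [hDγ]
    match i with
    | 0 => exact map_zero _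
    | 1 => exact hK _ _
    | i + 2 =>
      by_cases hn : Even n
      -- Here `D² γ^(i+2)(sx)` equals `x · x · γ^i(sx)` up to sign, and `x` has the odd degree `n +
      -- 1`, so its square is zero.
      · rw [gammaDer_even _ hn, hD.leibniz, hK, zero_mul, zero_add,
          signHom_of_mem (Koszul.inK_mem _ _), hDγ, gammaDer_even _ hn,
          ← mul_assoc, smul_mul_assoc, LG.gradedCommutative.mul_self_eq_zero h2 hn.add_one
            (Koszul.inK_mem (n + 1) x), smul_zero, zero_mul]
      · simp [gammaDer, hn]
  | hadd x y hx hy => rw [map_add, map_add, hx, hy, add_zero]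
  | hmul x y hx hy => rw [hD.sq_mul, hx, hy, zero_mul, mul_zero, add_zero]

end Koszul

/-! ### Splitting off one pair `u`, `su` of the Koszul extension. -/

section Koszul

variable {k : Type u} [Field k] {X : ℕ → Type v} [∀ n, AddCommGroup (X n)]
  [∀ n, Module k (X n)] {K : ℕ → Type w} [∀ n, AddCommGroup (K n)] [∀ n, Module k (K n)]

/-- The differential is natural in `K`: both sides agree on generators, and the Leibniz rule
propagates this because the induced map preserves degrees. -/
theorem IsKoszulDifferential.map_comm {d : Lambda k X →ₗ[k] Lambda k X}
    {D : Koszul k X K →ₗ[k] Koszul k X K} (hD : IsKoszulDifferential d D)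
    (f : ∀ n, K n →ₗ[k] K n) (a : Koszul k X K) : Koszul.map f (D a) = D (Koszul.map f a) := by
  induction a using Koszul.induction with
  | hX a => rw [hD.map_inX, Koszul.map_inX, Koszul.map_inX, hD.map_inX]
  | hK n x => rw [hD.map_inK, Koszul.map_inK, hD.map_inK, map_zero]
  | hγ n i x =>
    rw [Koszul.map_γ, hD.map_γ, hD.map_γ]
    match i with
    | 0 => exact map_zero _
    | 1 => exact Koszul.map_inK f (n + 1) x
    | i + 2 =>
      by_cases hn : Even n
      · rw [gammaDer_even _ hn, gammaDer_even _ hn, map_mul, Koszul.map_γ, Koszul.map_inK]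
      · simp [gammaDer, hn]
  | hadd x y hx hy => rw [map_add, map_add, hx, hy, map_add, map_add]
  | hmul x y hx hy =>
    rw [map_mul (Koszul.map f), hD.odd.leibniz, hD.odd.leibniz, map_add, map_mul, map_mul, hx, hy,
      signHom_map _ (Koszul.map_mem f)]

theorem IsGammaSystem.apply_zero {W : ℕ → Type v'} [∀ n, AddCommGroup (W n)]
    [∀ n, Module k (W n)] {B : Type u'} [Ring B] [Algebra k B] {c : ∀ n, ℕ → W n → B}
    (hc : IsGammaSystem (k := k) c) (n : ℕ) {i : ℕ} (hi : i ≠ 0) : c n i 0 = 0 := by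
  rcases Nat.even_or_odd n with hn | hn
  · have := hc.smul n hn i 0 0
    rwa [zero_smul, zero_pow hi, zero_smul] at this
  · by_cases h1 : i = 1
    · subst h1
      have := hc.one_smul n 0 0
      rwa [zero_smul, zero_smul] at this
    · exact hc.odd n hn i (by omega) 0

theorem Koszul.isGammaSystem : IsGammaSystem (k := k) (W := fun n => K (n + 1))
    fun _ i x => LG.γ k (fun n => X n × K n) (W := fun n => K (n + 1)) i x :=
  LG.isGammaSystem

/-- A vector `u` of degree `m + 1` in the graded vector space `K`, with a linear form `ℓ` such
that `ℓ u = 1`. -/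
structure IsDualPair (m : ℕ) (ℓ : ∀ n, K n →ₗ[k] k) (u : ∀ n, K n) : Prop where
  form_eq_zero : ∀ n, n ≠ m + 1 → ℓ n = 0
  vec_eq_zero : ∀ n, n ≠ m + 1 → u n = 0
  form_vec : ℓ (m + 1) (u (m + 1)) = 1

/-- The endomorphism `x ↦ x - ℓ(x) u`. -/
def killVec (ℓ : ∀ n, K n →ₗ[k] k) (u : ∀ n, K n) (n : ℕ) : K n →ₗ[k] K n :=
  LinearMap.id - (ℓ n).smulRight (u n)

theorem killVec_apply (ℓ : ∀ n, K n →ₗ[k] k) (u : ∀ n, K n) (n : ℕ) (x : K n) :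
    killVec ℓ u n x = x - ℓ n x • u n := rfl

theorem Koszul.inK_eq_map_killVec (ℓ : ∀ n, K n →ₗ[k] k) (u : ∀ n, K n) (n : ℕ) (x : K n) : Koszul.inK k X K n x =
    Koszul.map (killVec ℓ u) (Koszul.inK k X K n x) + ℓ n x • Koszul.inK k X K n (u n) := by
  rw [Koszul.map_inK, ← map_smul, ← map_add, killVec_apply, sub_add_cancel]

section

variable {m : ℕ} {ℓ : ∀ n, K n →ₗ[k] k} {u : ∀ n, K n} (h : IsDualPair m ℓ u)
include h

theorem IsDualPair.killVec_vec : killVec ℓ u (m + 1) (u (m + 1)) = 0 := by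
  rw [killVec_apply, h.form_vec, one_smul, sub_self]

theorem IsDualPair.form_killVec (n : ℕ) (x : K n) : ℓ n (killVec ℓ u n x) = 0 := by
  by_cases hn : n = m + 1
  · subst hn
    rw [killVec_apply, map_sub, map_smul, h.form_vec, smul_eq_mul, mul_one, sub_self]
  · rw [h.form_eq_zero n hn, LinearMap.zero_apply]

theorem IsDualPair.killVec_killVec (n : ℕ) (x : K n) :
    killVec ℓ u n (killVec ℓ u n x) = killVec ℓ u n x := by
  rw [killVec_apply _ _ _ (killVec ℓ u n x), h.form_killVec, zero_smul, sub_zero]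

theorem IsDualPair.killVec_of_ne {n : ℕ} (hn : n ≠ m + 1) (x : K n) : killVec ℓ u n x = x := by
  rw [killVec_apply, h.form_eq_zero n hn, LinearMap.zero_apply, zero_smul, sub_zero]

theorem IsDualPair.map_map (a : Koszul k X K) :
    Koszul.map (killVec ℓ u) (Koszul.map (killVec ℓ u) a) = Koszul.map (killVec ℓ u) a := by
  refine DFunLike.congr_fun (f := (Koszul.map (killVec ℓ u)).comp (Koszul.map (killVec ℓ u)))
    (LG.algHom_ext (fun n x => ?_) fun n i x => ?_) a
  · simp [Koszul.ι_eq, h.killVec_killVec]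
  · simp [h.killVec_killVec]

/-- Write `x = (x - ℓ(x) u) + ℓ(x) u`. The first summand is in the range of the endomorphism and the
second is a multiple of `u`. For divided powers of even elements the addition law separates the two
summands. Since `span s · range` is closed under products, generators suffice. -/
theorem IsDualPair.mem_span_mul_range {s : Set (Koszul k X K)} (h1 : 1 ∈ s)
    (hs : ∀ x ∈ s, ∃ n, x ∈ Koszul.grade k X K n)
    (hss : ∀ x ∈ s, ∀ y ∈ s, x * y ∈ Submodule.span k s)
    (hK : Koszul.inK k X K (m + 1) (u (m + 1)) ∈ Submodule.span k s)
    (hγ : ∀ i, LG.γ k (fun n => X n × K n) (W := fun n => K (n + 1)) (n := m) i (u (m + 1)) ∈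
      Submodule.span k s) (t : Koszul k X K) :
    t ∈ Submodule.span k s * LinearMap.range (Koszul.map (X := X) (killVec ℓ u)).toLinearMap := by
  set e := Koszul.map (X := X) (killVec ℓ u) with he
  have hC : ∀ x ∈ Submodule.span k s, x ∈ Submodule.span k s * LinearMap.range e.toLinearMap := by
    intro x hx
    have := Submodule.mul_mem_mul hx (LinearMap.mem_range.mpr ⟨1, map_one e⟩ :
      (1 : Koszul k X K) ∈ LinearMap.range e.toLinearMap)
    rwa [mul_one] at this
  have hT : ∀ x, e x ∈ Submodule.span k s * LinearMap.range e.toLinearMap := by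
    intro x
    have := Submodule.mul_mem_mul (Submodule.subset_span (R := k) h1) (LinearMap.mem_range.mpr
      ⟨x, rfl⟩ : e x ∈ LinearMap.range e.toLinearMap)
    rwa [one_mul] at this
  have hmul : ∀ x y, x ∈ Submodule.span k s * LinearMap.range e.toLinearMap →
      y ∈ Submodule.span k s * LinearMap.range e.toLinearMap →
      x * y ∈ Submodule.span k s * LinearMap.range e.toLinearMap := fun x y hx hy =>
    mul_mem_mul_range (𝒜 := Koszul.grade k X K) LG.gradedCommutative e
      (Koszul.map_mem _) hs hss hx hy
  induction t using Koszul.induction with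
  | hX a => rw [← Koszul.map_inX (killVec ℓ u)]; exact hT _
  | hK n x =>
    rw [Koszul.inK_eq_map_killVec ℓ u]
    refine add_mem (hT _) (Submodule.smul_mem _ _ ?_)
    by_cases hn : n = m + 1
    · subst hn
      exact hC _ hK
    · rw [h.vec_eq_zero n hn, map_zero]
      exact zero_mem _
  | hγ n i x =>
    by_cases hn : n = m
    · subst hn
      have hx : x = killVec ℓ u (n + 1) x + ℓ (n + 1) x • u (n + 1) := by
        rw [killVec_apply, sub_add_cancel]
      have hi : ∀ i, LG.γ k (fun n => X n × K n) (W := fun n => K (n + 1)) (n := n) i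
          (killVec ℓ u (n + 1) x) ∈ Submodule.span k s * LinearMap.range e.toLinearMap := by
        intro i
        have := hT (LG.γ k _ i x)
        rwa [he, Koszul.map_γ] at this
      rcases Nat.even_or_odd n with hn | hn
      · rw [hx, Koszul.isGammaSystem.add n hn]
        refine Submodule.sum_mem _ fun p _ => hmul _ _ (hi _) ?_
        rw [Koszul.isGammaSystem.smul n hn]
        exact Submodule.smul_mem _ _ (hC _ (hγ _))
      · match i with
        | 0 =>
          rw [Koszul.isGammaSystem.zero n x]
          exact hC _ (Submodule.subset_span h1)
        | 1 =>
          rw [hx, Koszul.isGammaSystem.one_add, Koszul.isGammaSystem.one_smul]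
          exact add_mem (hi 1) (Submodule.smul_mem _ _ (hC _ (hγ 1)))
        | i + 2 =>
          rw [Koszul.isGammaSystem.odd n hn (i + 2) (by omega) x]
          exact zero_mem _
    · have := hT (LG.γ k _ i x)
      rwa [he, Koszul.map_γ, h.killVec_of_ne (by omega)] at this
  | hadd x y hx hy => exact add_mem hx hy
  | hmul x y hx hy => exact hmul x y hx hy

end

/-- The variable is central, so it may occur only where the commutation sign is `1`. -/
theorem polynomial_comm {B : Type v} [Ring B] [Algebra k B] {a b : B} {s t ε : k}
    (hab : a * b = ε • (b * a)) (hs : s = 0 ∨ ε = 1) (ht : t = 0 ∨ ε = 1) :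
    (Polynomial.C a + s • Polynomial.X) * (Polynomial.C b + t • Polynomial.X) =
      ε • ((Polynomial.C b + t • Polynomial.X) * (Polynomial.C a + s • Polynomial.X)) := by
  have hC : Polynomial.C a * Polynomial.C b = ε • (Polynomial.C b * Polynomial.C a) := by
    rw [← Polynomial.C_mul, hab, ← Polynomial.smul_C, Polynomial.C_mul]
  have hst : (s = 0 ∧ t = 0) ∨ ε = 1 := by tauto
  rcases hst with ⟨rfl, rfl⟩ | rfl
  · simpa using hC
  · rw [one_smul] at hC
    simp only [mul_add, add_mul, one_smul, hC, smul_mul_assoc, mul_smul_comm, Polynomial.X_mul_C,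
      smul_add, smul_comm s t]
    abel

/-- For odd `m` the vector `u` has even degree `m + 1` and behaves like a polynomial variable. The
morphism is `x ↦ e(x) + ℓ(x) X` on generators of `ΛX ⊗ ΛK`; it respects the commutation relations
because `ℓ` vanishes in all odd degrees. -/
theorem IsDualPair.exists_polynomial_hom {m : ℕ} {ℓ : ∀ n, K n →ₗ[k] k} {u : ∀ n, K n}
    (h : IsDualPair m ℓ u) (hm : Odd m) : ∃ Φ : Koszul k X K →ₐ[k] Polynomial (Koszul k X K),
      (∀ a, Φ (Koszul.map (killVec ℓ u) a) = Polynomial.C (Koszul.map (killVec ℓ u) a)) ∧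
      Φ (Koszul.inK k X K (m + 1) (u (m + 1))) = Polynomial.X ∧
      Φ (LG.γ k (fun n => X n × K n) (W := fun n => K (n + 1)) (n := m) 1 (u (m + 1))) = 0 := by
  have hℓ : ∀ n (x : K n), ℓ n x = 0 ∨ Even n := fun n x => by
    by_cases hn : n = m + 1
    · exact Or.inr (hn ▸ hm.add_one)
    · left
      rw [h.form_eq_zero n hn, LinearMap.zero_apply]
  let e := Koszul.map (X := X) (killVec ℓ u)
  let f : ∀ n, X n × K n →ₗ[k] Polynomial (Koszul k X K) := fun n =>
    (Polynomial.CAlgHom (R := k)).toLinearMap.comp (e.toLinearMap.comp (LG.ι k _ _ n)) +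
      ((ℓ n).comp (LinearMap.snd k (X n) (K n))).smulRight Polynomial.X
  have hf : ∀ n x, f n x = Polynomial.C (e (LG.ι k _ _ n x)) + ℓ n x.2 • Polynomial.X :=
    fun n x => rfl
  have hff : ∀ n n' x y, f n x * f n' y = (-1 : k) ^ (n * n') • (f n' y * f n x) := by
    intro n n' x y
    rw [hf, hf]
    refine polynomial_comm (LG.gradedCommutative _ _ _ (Koszul.map_mem _ _ _ (LG.ι_mem _ _)) _
      (Koszul.map_mem _ _ _ (LG.ι_mem _ _))) ?_ ?_
    · exact (hℓ n x.2).imp_right fun hn => (hn.mul_right _).neg_one_pow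
    · exact (hℓ n' y.2).imp_right fun hn => (hn.mul_left _).neg_one_pow
  let F := Lambda.lift (V := fun n => X n × K n) (B := Polynomial (Koszul k X K)) f hff
  let G := ((Polynomial.CAlgHom (R := k)).comp e).comp
    (LG.inR k (fun n => X n × K n) (fun n => K (n + 1)))
  have hFG : ∀ n (x : X n × K n) (n' i : ℕ) (y : K (n' + 1)),
      F (Lambda.ι k _ n x) * G (Gamma.γ k (fun n => K (n + 1)) i y) = (-1 : k) ^ (n * (i * n')) •
        (G (Gamma.γ k (fun n => K (n + 1)) i y) * F (Lambda.ι k _ n x)) := by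
    intro n x n' i y
    have hy : G (Gamma.γ k (fun n => K (n + 1)) i y) =
        Polynomial.C (e (LG.γ k _ i y)) + (0 : k) • Polynomial.X := by
      rw [zero_smul, add_zero]
      rfl
    rw [hy, Lambda.lift_ι, hf]
    refine polynomial_comm (LG.gradedCommutative _ _ _ (Koszul.map_mem _ _ _ (LG.ι_mem _ _)) _
      (Koszul.map_mem _ _ _ (LG.γ_mem _ _))) ?_ (Or.inl rfl)
    exact (hℓ n x.2).imp_right fun hn => (hn.mul_right _).neg_one_pow
  let Φ : Koszul k X K →ₐ[k] Polynomial (Koszul k X K) :=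
    LG.lift (B := Polynomial (Koszul k X K)) F G hFG
  have hΦι : ∀ n x, Φ (LG.ι k _ _ n x) = f n x := fun n x => by
    rw [LG.lift_ι, Lambda.lift_ι]
  have hΦγ : ∀ (n i : ℕ) (x : K (n + 1)), Φ (LG.γ k _ i x) = Polynomial.C (e (LG.γ k _ i x)) :=
    fun n i x => LG.lift_γ _ _ _ _ _
  refine ⟨Φ, fun a => ?_, ?_, ?_⟩
  · refine DFunLike.congr_fun (f := Φ.comp e) (g := (Polynomial.CAlgHom (R := k)).comp e)
      (LG.algHom_ext (fun n x => ?_) fun n i x => ?_) a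
    · simp only [AlgHom.comp_apply]
      have : e (LG.ι k _ _ n x) = LG.ι k _ _ n (x.1, killVec ℓ u n x.2) := LG.map_ι _ _ _ _
      rw [this, hΦι, hf]
      have h3 : e (LG.ι k _ _ n (x.1, killVec ℓ u n x.2)) =
          LG.ι k _ _ n (x.1, killVec ℓ u n x.2) := by
        rw [← this]
        exact h.map_map _
      rw [h3, h.form_killVec, zero_smul, add_zero]
      rfl
    · simp only [AlgHom.comp_apply]
      have : e (LG.γ k _ i x) = LG.γ k _ (W := fun n => K (n + 1)) i (killVec ℓ u (n + 1) x) :=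
        Koszul.map_γ _ _ _ _
      rw [this, hΦγ, ← this]
      exact congrArg _ (h.map_map _)
  · rw [Koszul.inK_apply, hΦι, hf, h.form_vec, one_smul, ← Koszul.inK_apply]
    simp only [e, Koszul.map_inK, h.killVec_vec, map_zero, zero_add]
  · rw [hΦγ]
    simp only [e, Koszul.map_γ, h.killVec_vec]
    rw [Koszul.isGammaSystem.apply_zero m one_ne_zero, map_zero]

/-- The contraction takes the value `ℓ` on `K` and is zero on `X` and on the divided powers. Its
degree is `-(m + 1)` and not `+1`, which is why derivations are constrained by parity only. -/
theorem IsDualPair.exists_contraction {m : ℕ} {ℓ : ∀ n, K n →ₗ[k] k} {u : ∀ n, K n}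
    (h : IsDualPair m ℓ u) (hm : Even m) : ∃ η : Koszul k X K →ₗ[k] Koszul k X K,
      IsOddDerivation (Koszul.grade k X K) η ∧
      (∀ a, η (Koszul.map (killVec ℓ u) a) = 0) ∧
      η (Koszul.inK k X K (m + 1) (u (m + 1))) = 1 ∧
      ∀ (n i : ℕ) (x : K (n + 1)), η (LG.γ k _ i x) = 0 := by
  obtain ⟨η, hη, hι, hγ⟩ := LG.exists_derivation (k := k) (V := fun n => X n × K n)
    (W := fun n => K (n + 1))
    (fun n => ((ℓ n).comp (LinearMap.snd k (X n) (K n))).smulRight 1) (by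
      intro n x
      by_cases hn : n = m + 1
      -- The value is a scalar, of degree `0`; it counts as a shift because `n + 1 = m + 2` is even.
      · have hn' : Even (n + 1) := hn ▸ hm.add_one.add_one
        constructor
        · simp [hn'.neg_one_pow]
        · intro r b _
          simp [(hn'.mul_right r).neg_one_pow]
      · simpa [h.form_eq_zero n hn] using IsShift.zero _) 0 (fun n x => IsShift.zero _)
  have hγ0 : ∀ (n i : ℕ) (x : K (n + 1)), η (LG.γ k _ i x) = 0 := by
    intro n i x
    rw [hγ]
    match i with
    | 0 => rfl
    | 1 => rfl
    | i + 2 => simp [gammaDer]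
  have hK : ∀ n x, η (Koszul.inK k X K n x) = ℓ n x • 1 := fun n x => hι n _
  refine ⟨η, hη, fun a => ?_, ?_, hγ0⟩
  · induction a using Koszul.induction with
    | hX a =>
      rw [Koszul.map_inX]
      induction a using pres_induction with
      | hs c => rw [AlgHom.commutes, hη.map_algebraMap]
      | hg a =>
        refine (congrArg η (Koszul.inX_ι a.1 a.2)).trans ?_
        rw [hι]
        simp
      | hadd x y hx hy => rw [map_add, map_add, hx, hy, add_zero]
      | hmul x y hx hy => rw [map_mul, hη.leibniz, hx, hy, zero_mul, mul_zero, add_zero]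
    | hK n x => rw [Koszul.map_inK, hK, h.form_killVec, zero_smul]
    | hγ n i x => rw [Koszul.map_γ, hγ0]
    | hadd x y hx hy => rw [map_add, map_add, hx, hy, add_zero]
    | hmul x y hx hy => rw [map_mul, hη.leibniz, hx, hy, zero_mul, mul_zero, add_zero]
  · rw [hK, h.form_vec, one_smul]

end Koszul

/-! ### Cycles of the Koszul extension modulo boundaries. -/

section Koszul

variable {k : Type u} [Field k] {X : ℕ → Type v} [∀ n, AddCommGroup (X n)]
  [∀ n, Module k (X n)] {K : ℕ → Type w} [∀ n, AddCommGroup (K n)] [∀ n, Module k (K n)]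
  {d : Lambda k X →ₗ[k] Lambda k X} {D : Koszul k X K →ₗ[k] Koszul k X K}

/-- The pair generates `k[y] ⊗ Λ(g)` with `D g = y`. Its basis consists of `1`, the `y^(n+1)`, and
the `g y^n` with `D(g y^n) = y^(n+1)`. -/
theorem IsKoszulDifferential.exists_sub_map_eq_of_odd (hD : IsKoszulDifferential d D)
    (h2 : (2 : k) ≠ 0) {m : ℕ} {ℓ : ∀ n, K n →ₗ[k] k} {u : ∀ n, K n} (h : IsDualPair m ℓ u)
    (hm : Odd m) {t : Koszul k X K} (ht : D t = 0) :
    ∃ v, t - Koszul.map (killVec ℓ u) t = D v := by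
  set y := Koszul.inK k X K (m + 1) (u (m + 1)) with hy
  set g : Koszul k X K := LG.γ k (fun n => X n × K n) (W := fun n => K (n + 1)) (n := m) 1
    (u (m + 1)) with hg
  have hym : y ∈ Koszul.grade k X K (m + 1) := Koszul.inK_mem _ _
  have hgm : g ∈ Koszul.grade k X K m := by
    have := LG.γ_mem (k := k) (V := fun n => X n × K n) (W := fun n => K (n + 1)) (n := m) 1
      (u (m + 1))
    rwa [one_mul] at this
  have hpow : ∀ n, y ^ n ∈ Koszul.grade k X K (n * (m + 1)) := fun n => by
    simpa using SetLike.pow_mem_graded n hym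
  have hcomm : ∀ n a, y ^ n * a = a * y ^ n := fun n a =>
    LG.gradedCommutative.commute_of_even (hm.add_one.mul_left n) (hpow n) a
  have hgg : g * g = 0 := LG.gradedCommutative.mul_self_eq_zero h2 hm hgm
  have hDy : ∀ n, D (y ^ n) = 0 := by
    intro n
    induction n with
    | zero => rw [pow_zero, hD.odd.map_one]
    | succ n ih => rw [pow_succ, hD.odd.leibniz, ih, hD.map_inK, zero_mul, mul_zero, add_zero]
  have hDg : D g = y := hD.map_γ m 1 (u (m + 1))
  have hey : Koszul.map (killVec ℓ u) y = 0 := by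
    rw [hy, Koszul.map_inK, h.killVec_vec, map_zero]
  have heg : Koszul.map (killVec ℓ u) g = 0 := by
    -- The induced endomorphism sends `γ^1(su)` to `γ^1(0)`, which vanishes.
    rw [hg, Koszul.map_γ, h.killVec_vec]
    exact Koszul.isGammaSystem.apply_zero m one_ne_zero
  let c : ℕ → Koszul k X K := fun n => y ^ (n + 1)
  let b : ℕ → Koszul k X K := fun n => g * y ^ n
  let s : Set (Koszul k X K) := {1} ∪ Set.range c ∪ Set.range b
  have hys : ∀ n, y ^ n ∈ s := by
    rintro (_ | n)
    · exact Or.inl (Or.inl (pow_zero y))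
    · exact Or.inl (Or.inr ⟨n, rfl⟩)
  have hgs : ∀ n, g * y ^ n ∈ s := fun n => Or.inr ⟨n, rfl⟩
  have hs : ∀ x ∈ s, (∃ n, x = y ^ n) ∨ ∃ n, x = g * y ^ n := by
    rintro x ((rfl | ⟨n, rfl⟩) | ⟨n, rfl⟩)
    · exact Or.inl ⟨0, (pow_zero y).symm⟩
    · exact Or.inl ⟨n + 1, rfl⟩
    · exact Or.inr ⟨n, rfl⟩
  obtain ⟨Φ, hΦe, hΦy, hΦg⟩ := h.exists_polynomial_hom (X := X) hm
  refine hD.odd.exists_sub_eq (hD.map_comm _) h.map_map (c := c) (d := b) ?_ ?_ ?_ ?_ ?_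
    hD.sq_zero ht
  · exact fun n => ⟨_, SetLike.GradedMul.mul_mem hgm (hpow n)⟩
  · intro n
    simp only [b, c]
    rw [hD.odd.leibniz, hDy, mul_zero, add_zero, hDg, pow_succ']
  · intro n
    simp only [b]
    rw [map_mul, heg, zero_mul]
  · refine fun t => h.mem_span_mul_range (s := s) (Or.inl (Or.inl rfl)) ?_ ?_ ?_ ?_ t
    · intro x hx
      rcases hs x hx with ⟨n, rfl⟩ | ⟨n, rfl⟩
      · exact ⟨_, hpow n⟩
      · exact ⟨_, SetLike.GradedMul.mul_mem hgm (hpow n)⟩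
    · intro x hx z hz
      rcases hs x hx with ⟨n, rfl⟩ | ⟨n, rfl⟩ <;> rcases hs z hz with ⟨n', rfl⟩ | ⟨n', rfl⟩
      · rw [← pow_add]
        exact Submodule.subset_span (hys _)
      · rw [← mul_assoc, hcomm, mul_assoc, ← pow_add]
        exact Submodule.subset_span (hgs _)
      · rw [mul_assoc, ← pow_add]
        exact Submodule.subset_span (hgs _)
      · rw [mul_assoc, ← mul_assoc (y ^ n), hcomm, ← mul_assoc, ← mul_assoc, hgg, zero_mul,
          zero_mul]
        exact zero_mem _
    · have := hys 1
      rw [pow_one] at this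
      exact Submodule.subset_span this
    · intro i
      match i with
      | 0 =>
        rw [Koszul.isGammaSystem.zero m]
        exact Submodule.subset_span (Or.inl (Or.inl rfl))
      | 1 =>
        have := hgs 0
        rw [pow_zero, mul_one] at this
        exact Submodule.subset_span this
      | i + 2 =>
        rw [Koszul.isGammaSystem.odd m hm (i + 2) (by omega)]
        exact zero_mem _
  · refine independent_of_polynomial Φ hΦe (fun n => ?_) fun n => ?_
    · rw [map_pow, hΦy]
    · rw [map_mul, hΦg, zero_mul]

/-- Now `y` is odd with square zero, and the divided powers `g n` of `su` are all present. The basis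
is `1`, the `y · g n`, and the `g (n + 1)` with `D(g (n + 1)) = y · g n`. -/
theorem IsKoszulDifferential.exists_sub_map_eq_of_even (hD : IsKoszulDifferential d D)
    (h2 : (2 : k) ≠ 0) {m : ℕ} {ℓ : ∀ n, K n →ₗ[k] k} {u : ∀ n, K n} (h : IsDualPair m ℓ u)
    (hm : Even m) {t : Koszul k X K} (ht : D t = 0) :
    ∃ v, t - Koszul.map (killVec ℓ u) t = D v := by
  set y := Koszul.inK k X K (m + 1) (u (m + 1)) with hy
  let g : ℕ → Koszul k X K := fun i => LG.γ k (fun n => X n × K n) (W := fun n => K (n + 1))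
    (n := m) i (u (m + 1))
  have hym : y ∈ Koszul.grade k X K (m + 1) := Koszul.inK_mem _ _
  have hgm : ∀ i, g i ∈ Koszul.grade k X K (i * m) := fun i => LG.γ_mem i _
  have hcomm : ∀ n a, g n * a = a * g n := fun n a =>
    LG.gradedCommutative.commute_of_even (hm.mul_left n) (hgm n) a
  have hyy : y * y = 0 := LG.gradedCommutative.mul_self_eq_zero h2 hm.add_one hym
  have hg0 : g 0 = 1 := Koszul.isGammaSystem.zero m _
  have hgg : ∀ i j, g i * g j = ((i + j).choose i : k) • g (i + j) := fun i j =>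
    Koszul.isGammaSystem.mul m hm i j _
  have hDg : ∀ i, D (g (i + 1)) = y * g i := fun i => by
    simp only [g]
    rw [hD.map_γ, gammaDer_even _ hm]
  have hey : Koszul.map (killVec ℓ u) y = 0 := by
    rw [hy, Koszul.map_inK, h.killVec_vec, map_zero]
  have heg : ∀ i, Koszul.map (killVec ℓ u) (g (i + 1)) = 0 := fun i => by
    simp only [g]
    rw [Koszul.map_γ, h.killVec_vec]
    exact Koszul.isGammaSystem.apply_zero m (Nat.succ_ne_zero i)
  let c : ℕ → Koszul k X K := fun n => y * g n
  let b : ℕ → Koszul k X K := fun n => g (n + 1)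
  let s : Set (Koszul k X K) := {1} ∪ Set.range c ∪ Set.range b
  have hys : ∀ n, y * g n ∈ s := fun n => Or.inl (Or.inr ⟨n, rfl⟩)
  have hgs : ∀ n, g n ∈ s := by
    rintro (_ | n)
    · exact Or.inl (Or.inl hg0)
    · exact Or.inr ⟨n, rfl⟩
  have hs : ∀ x ∈ s, (∃ n, x = g n) ∨ ∃ n, x = y * g n := by
    rintro x ((rfl | ⟨n, rfl⟩) | ⟨n, rfl⟩)
    · exact Or.inl ⟨0, hg0.symm⟩
    · exact Or.inr ⟨n, rfl⟩
    · exact Or.inl ⟨n + 1, rfl⟩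
  obtain ⟨η, hη, hηe, hηy, hηg⟩ := h.exists_contraction (X := X) hm
  refine hD.odd.exists_sub_eq (hD.map_comm _) h.map_map (c := c) (d := b) ?_ hDg heg ?_ ?_
    hD.sq_zero ht
  · exact fun n => ⟨_, hgm (n + 1)⟩
  · refine fun t => h.mem_span_mul_range (s := s) (Or.inl (Or.inl rfl)) ?_ ?_ ?_ ?_ t
    · intro x hx
      rcases hs x hx with ⟨n, rfl⟩ | ⟨n, rfl⟩
      · exact ⟨_, hgm n⟩
      · exact ⟨_, SetLike.GradedMul.mul_mem hym (hgm n)⟩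
    · intro x hx z hz
      rcases hs x hx with ⟨n, rfl⟩ | ⟨n, rfl⟩ <;> rcases hs z hz with ⟨n', rfl⟩ | ⟨n', rfl⟩
      · rw [hgg]
        exact Submodule.smul_mem _ _ (Submodule.subset_span (hgs _))
      · rw [← mul_assoc, hcomm, mul_assoc, hgg, mul_smul_comm]
        exact Submodule.smul_mem _ _ (Submodule.subset_span (hys _))
      · rw [mul_assoc, hgg, mul_smul_comm]
        exact Submodule.smul_mem _ _ (Submodule.subset_span (hys _))
      · rw [mul_assoc, ← mul_assoc (g n), hcomm, mul_assoc, ← mul_assoc, hyy, zero_mul]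
        exact zero_mem _
    · have := hys 0
      rw [hg0, mul_one] at this
      exact Submodule.subset_span this
    · exact fun i => Submodule.subset_span (hgs i)
  · refine independent_of_derivation hD.odd hη (hD.map_comm _) (g := g) hηe (fun n => ?_)
      (fun n => hηg _ _ _) hg0 (fun n => ?_) (fun n => hηg _ _ _)
    · simp only [c]
      rw [hη.leibniz, hηy, one_mul, hηg, mul_zero, add_zero]
    · rw [hDg, hη.leibniz, hηy, one_mul, hηg, mul_zero, add_zero]

theorem IsKoszulDifferential.exists_sub_map_eq (hD : IsKoszulDifferential d D)
    (h2 : (2 : k) ≠ 0) {m : ℕ} {ℓ : ∀ n, K n →ₗ[k] k} {u : ∀ n, K n} (h : IsDualPair m ℓ u)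
    {t : Koszul k X K} (ht : D t = 0) : ∃ v, t - Koszul.map (killVec ℓ u) t = D v :=
  (Nat.even_or_odd m).elim (fun hm => hD.exists_sub_map_eq_of_even h2 h hm ht)
    fun hm => hD.exists_sub_map_eq_of_odd h2 h hm ht

/-- A cycle of the Koszul extension is homologous to its projection to `ΛX`. -/
theorem IsKoszulDifferential.exists_sub_proj_eq (hD : IsKoszulDifferential d D)
    (h2 : (2 : k) ≠ 0) (h0 : Subsingleton (K 0)) {t : Koszul k X K} (ht : D t = 0) :
    ∃ v, t - Koszul.inX k X K (Koszul.proj k X K t) = D v := by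
  classical
  let B := fun m => Module.Basis.ofVectorSpace k (K (m + 1))
  let ι := Σ m, Module.Basis.ofVectorSpaceIndex k (K (m + 1))
  -- Coordinate forms and basis vectors of the spaces `K (m + 1)`, extended by zero to the other
  -- degrees. Degree `0` needs none, as `K 0` is zero.
  let ℓ : ι → ∀ n, K n →ₗ[k] k := fun i =>
    Pi.single (M := fun n => K n →ₗ[k] k) (i.1 + 1) ((B i.1).coord i.2)
  let u : ι → ∀ n, K n := fun i => Pi.single (i.1 + 1) (B i.1 i.2)
  have hpair : ∀ i, IsDualPair i.1 (ℓ i) (u i) := fun i =>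
    ⟨fun n hn => Pi.single_eq_of_ne hn _, fun n hn => Pi.single_eq_of_ne hn _, by simp [ℓ, u]⟩
  have horth : ∀ i j, i ≠ j → ∀ n, ℓ i n (u j n) = 0 := by
    intro i j hij n
    by_cases hi : n = i.1 + 1
    · by_cases hj : n = j.1 + 1
      · obtain ⟨m, i⟩ := i
        obtain ⟨m', j⟩ := j
        obtain rfl : m = m' := by simp only at hi hj; omega
        simp only at hi
        subst hi
        have : j ≠ i := fun hh => hij (by rw [hh])
        simp [ℓ, u, this]
      · rw [(hpair j).vec_eq_zero n hj, map_zero]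
    · rw [(hpair i).form_eq_zero n hi, LinearMap.zero_apply]
  -- The projection killing the basis vectors in `S`. By orthogonality, enlarging `S` by one index
  -- composes it with one `killVec`, so each step changes a cycle by a boundary.
  let f : Finset ι → ∀ n, K n →ₗ[k] K n := fun S n =>
    LinearMap.id - ∑ i ∈ S, (ℓ i n).smulRight (u i n)
  have hf : ∀ S n x, f S n x = x - ∑ i ∈ S, ℓ i n x • u i n := fun S n x => by
    simp [f, LinearMap.sum_apply]
  have hfi : ∀ S i, i ∉ S → ∀ n x, f (insert i S) n x = killVec (ℓ i) (u i) n (f S n x) := by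
    intro S i hi n x
    have : ℓ i n (f S n x) = ℓ i n x := by
      rw [hf, map_sub, map_sum, Finset.sum_eq_zero, sub_zero]
      intro j hj
      rw [map_smul, horth i j (fun h => hi (h ▸ hj)), smul_zero]
    rw [killVec_apply, this, hf, hf, Finset.sum_insert hi]
    abel
  have hS : ∀ S : Finset ι, ∃ v, t - Koszul.map (f S) t = D v := by
    intro S
    induction S using Finset.induction_on with
    | empty =>
      refine ⟨0, ?_⟩
      have : Koszul.map (f ∅) t = t := by
        refine DFunLike.congr_fun (f := Koszul.map (f ∅)) (g := AlgHom.id k _)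
          (LG.algHom_ext (fun n x => ?_) fun n i x => ?_) t
        · simp [Koszul.ι_eq, hf]
        · simp [hf]
      rw [this, sub_self, map_zero]
    | insert i S hi ih =>
      obtain ⟨v, hv⟩ := ih
      have hc : D (Koszul.map (f S) t) = 0 := by rw [← hD.map_comm, ht, map_zero]
      obtain ⟨v', hv'⟩ := hD.exists_sub_map_eq h2 (hpair i) hc
      have : Koszul.map (f (insert i S)) t =
          Koszul.map (killVec (ℓ i) (u i)) (Koszul.map (f S) t) := by
        refine DFunLike.congr_fun (f := Koszul.map (f (insert i S)))
          (g := (Koszul.map (killVec (ℓ i) (u i))).comp (Koszul.map (f S)))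
          (LG.algHom_ext (fun n x => ?_) fun n j x => ?_) t
        · simp [Koszul.ι_eq, hfi S i hi]
        · simp [hfi S i hi]
      refine ⟨v + v', ?_⟩
      rw [map_add, ← hv, ← hv', this]
      abel
  have hvec : ∀ n (x : K n), ∃ S, ∀ S', S ⊆ S' → f S' n x = 0 := by
    intro n x
    match n with
    | 0 => exact ⟨∅, fun S' _ => Subsingleton.elim _ _⟩
    | m + 1 =>
      refine ⟨((B m).repr x).support.map ⟨Sigma.mk m, sigma_mk_injective⟩, fun S' hS' => ?_⟩
      rw [hf, sub_eq_zero, ← Finset.sum_subset hS', Finset.sum_map]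
      · conv_lhs => rw [← (B m).linearCombination_repr x, Finsupp.linearCombination_apply,
          Finsupp.sum]
        refine Finset.sum_congr rfl fun i _ => ?_
        simp [ℓ, u]
      · rintro ⟨m', i⟩ _ hi
        by_cases hm : m = m'
        · subst hm
          have : (B m).repr x i = 0 := by
            by_contra h
            exact hi (Finset.mem_map.mpr ⟨i, Finsupp.mem_support_iff.mpr h, rfl⟩)
          simp [ℓ, this]
        · rw [(hpair ⟨m', i⟩).vec_eq_zero _ (by simpa using hm), smul_zero]
  have hlim : ∃ S, ∀ S', S ⊆ S' →
      Koszul.map (f S') t = Koszul.inX k X K (Koszul.proj k X K t) := by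
    -- The stabilisation holds for every element, cycle or not; the induction on generators needs
    -- this generality.
    clear ht hS
    induction t using Koszul.induction with
    | hX a => exact ⟨∅, fun S' _ => by rw [Koszul.map_inX, Koszul.proj_inX]⟩
    | hK n x =>
      obtain ⟨S, hS⟩ := hvec n x
      exact ⟨S, fun S' h => by rw [Koszul.map_inK, hS S' h, Koszul.proj_inK, map_zero, map_zero]⟩
    | hγ n i x =>
      obtain ⟨S, hS⟩ := hvec (n + 1) x
      refine ⟨S, fun S' h => ?_⟩
      rw [Koszul.map_γ, hS S' h, Koszul.proj_γ]
      split_ifs with hi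
      · subst hi
        rw [map_one]
        exact Koszul.isGammaSystem.zero n _
      · rw [map_zero]
        exact Koszul.isGammaSystem.apply_zero n hi
    | hadd x y hx hy =>
      obtain ⟨S, hS⟩ := hx
      obtain ⟨T, hT⟩ := hy
      refine ⟨S ∪ T, fun S' h => ?_⟩
      rw [map_add, map_add, map_add, hS S' (Finset.union_subset_left h),
        hT S' (Finset.union_subset_right h)]
    | hmul x y hx hy =>
      obtain ⟨S, hS⟩ := hx
      obtain ⟨T, hT⟩ := hy
      refine ⟨S ∪ T, fun S' h => ?_⟩
      rw [map_mul, map_mul, map_mul, hS S' (Finset.union_subset_left h),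
        hT S' (Finset.union_subset_right h)]
  obtain ⟨S, hS'⟩ := hlim
  obtain ⟨v, hv⟩ := hS S
  exact ⟨v, by rw [← hv, hS' S subset_rfl]⟩

end Koszul

theorem smul_sub_smul_mem {k : Type u} [Field k] {M : Type v} [AddCommGroup M] [Module k M]
    (S : Submodule k M) (c : k) {x y : M} (h : x - y ∈ S) : c • x - c • y ∈ S := by
  rw [← smul_sub]
  exact S.smul_mem c h

/-! ### Linear parts -/

section LinearPart

variable {k : Type u} [Field k] {V : ℕ → Type v} [∀ n, AddCommGroup (V n)] [∀ n, Module k (V n)]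

theorem Lambda.linearPart_ι (m n : ℕ) (x : V m) :
    Lambda.linearPart k V n (Lambda.ι k V m x) = Pi.single (M := V) m x n := by
  let _ : Module kᵐᵒᵖ (V n) := Module.compHom _ ((RingHom.id k).fromOpposite mul_comm)
  have : IsCentralScalar k (V n) := ⟨fun _ _ => rfl⟩
  refine (congrArg TrivSqZeroExt.snd (RingQuot.liftAlgHom_mkAlgHom_apply k _ _ _)).trans ?_
  rw [FreeAlgebra.lift_ι_apply, TrivSqZeroExt.snd_inr]

/-- This is the product rule in `k ⊕ V n` with `V n` of square zero: the linear part is a derivation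
relative to the augmentation. -/
theorem Lambda.linearPart_mul (n : ℕ) (a b : Lambda k V) :
    Lambda.linearPart k V n (a * b) =
      Lambda.aug k V a • Lambda.linearPart k V n b +
        Lambda.aug k V b • Lambda.linearPart k V n a := by
  let _ : Module kᵐᵒᵖ (V n) := Module.compHom _ ((RingHom.id k).fromOpposite mul_comm)
  have : IsCentralScalar k (V n) := ⟨fun _ _ => rfl⟩
  obtain ⟨F, hF, hι⟩ : ∃ F : Lambda k V →ₐ[k] TrivSqZeroExt k (V n),
      (∀ x, Lambda.linearPart k V n x = (F x).snd) ∧ ∀ m x, (F (Lambda.ι k V m x)).fst = 0 := by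
    refine ⟨_, fun x => rfl, fun m x => ?_⟩
    refine (congrArg TrivSqZeroExt.fst (RingQuot.liftAlgHom_mkAlgHom_apply k _ _ _)).trans ?_
    rw [FreeAlgebra.lift_ι_apply, TrivSqZeroExt.fst_inr]
  have hfst : ∀ x, (F x).fst = Lambda.aug k V x := fun x => by
    refine DFunLike.congr_fun (f := (TrivSqZeroExt.fstHom k k (V n)).comp F)
      (Lambda.algHom_ext fun m x => ?_) x
    rw [Lambda.aug_ι]
    exact hι m x
  rw [hF, hF, hF, map_mul, TrivSqZeroExt.snd_mul, hfst, hfst, op_smul_eq_smul]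

theorem Lambda.linearPart_one (n : ℕ) : Lambda.linearPart k V n 1 = 0 := by
  have := Lambda.linearPart_mul (k := k) (V := V) n 1 1
  simpa using this

theorem Lambda.linearPart_of_mem_sq {a : Lambda k V}
    (ha : a ∈ (LinearMap.ker (Lambda.aug k V).toLinearMap) ^ 2) (n : ℕ) :
    Lambda.linearPart k V n a = 0 := by
  rw [pow_two] at ha
  induction ha using Submodule.mul_induction_on' with
  | mem_mul_mem a ha b hb =>
    rw [LinearMap.mem_ker, AlgHom.toLinearMap_apply] at ha hb
    rw [Lambda.linearPart_mul, ha, hb, zero_smul, zero_smul, add_zero]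
  | add a _ b _ h1 h2 => rw [map_add, h1, h2, add_zero]

theorem Lambda.linearPart_map {V' : ℕ → Type v'} [∀ n, AddCommGroup (V' n)]
    [∀ n, Module k (V' n)] (f : ∀ n, V n →ₗ[k] V' n) (n : ℕ) (a : Lambda k V) :
    Lambda.linearPart k V' n (Lambda.map f a) = f n (Lambda.linearPart k V n a) := by
  have haug : ∀ a, Lambda.aug k V' (Lambda.map f a) = Lambda.aug k V a := fun a => by
    refine DFunLike.congr_fun (f := (Lambda.aug k V').comp (Lambda.map f))
      (Lambda.algHom_ext fun m x => ?_) a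
    simp
  induction a using pres_induction with
  | hs c =>
    rw [AlgHom.commutes, Algebra.algebraMap_eq_smul_one, Algebra.algebraMap_eq_smul_one, map_smul,
      map_smul, Lambda.linearPart_one, Lambda.linearPart_one, smul_zero, smul_zero, map_zero]
  | hg a =>
    change Lambda.linearPart k V' n (Lambda.map f (Lambda.ι k V a.1 a.2)) =
      f n (Lambda.linearPart k V n (Lambda.ι k V a.1 a.2))
    rw [Lambda.map_ι, Lambda.linearPart_ι, Lambda.linearPart_ι]
    by_cases h : n = a.1
    · subst h
      simp
    · rw [Pi.single_eq_of_ne h, Pi.single_eq_of_ne h, map_zero]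
  | hadd a b ha hb => rw [map_add, map_add, map_add, map_add, ha, hb]
  | hmul a b ha hb =>
    rw [map_mul, Lambda.linearPart_mul, Lambda.linearPart_mul, ha, hb, haug, haug, map_add,
      map_smul, map_smul]

end LinearPart

/-! ### Linear parts and weights in `ΛV ⊗ ΓW`. -/

section LG

variable {k : Type u} [Field k] {V : ℕ → Type v} [∀ n, AddCommGroup (V n)] [∀ n, Module k (V n)]
  {W : ℕ → Type w} [∀ n, AddCommGroup (W n)] [∀ n, Module k (W n)]

/-- The linear part in `V` of an element of `ΛV ⊗ ΓW`. -/
def LG.linearPart (n : ℕ) : LG k V W →ₗ[k] V n :=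
  (Lambda.linearPart k V n).comp LG.projL.toLinearMap

theorem LG.linearPart_apply (n : ℕ) (a : LG k V W) :
    LG.linearPart n a = Lambda.linearPart k V n (LG.projL a) := rfl

theorem LG.linearPart_ι (n : ℕ) (x : V n) : LG.linearPart n (LG.ι k V W n x) = x := by
  rw [LG.linearPart_apply, LG.projL_ι, Lambda.linearPart_ι, Pi.single_eq_same]

/-! ### The weight filtration -/

/-- The weight of a generator: `n - 1` for an element of `V n`, and `0` for an element of `ΓW`. -/
def FreeGen.wt : FreeGen V W → ℕ := Sum.elim (fun a => a.1 - 1) fun _ => 0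

variable (k V W) in
/-- The span of the words of weight less than `j`. -/
def LG.filt (j : ℕ) : Submodule k (LG k V W) :=
  Submodule.span k {x | ∃ l : List (FreeGen V W), (l.map FreeGen.wt).sum < j ∧
    x = (l.map (presGen (LGRel k V W))).prod}

theorem LG.filt_zero : LG.filt k V W 0 = ⊥ := by
  rw [LG.filt, Submodule.span_eq_bot]
  rintro x ⟨l, hl, -⟩
  omega

theorem LG.filt_mono {i j : ℕ} (h : i ≤ j) : LG.filt k V W i ≤ LG.filt k V W j := by
  refine Submodule.span_mono ?_
  rintro x ⟨l, hl, rfl⟩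
  exact ⟨l, hl.trans_le h, rfl⟩

theorem LG.one_mem_filt : 1 ∈ LG.filt k V W 1 := Submodule.subset_span ⟨[], by simp, by simp⟩

/-- Weights are additive on words, and level `j` means weight at most `j - 1`; hence the shift by
one. -/
theorem LG.mul_mem_filt {i j n : ℕ} {x y : LG k V W} (hx : x ∈ LG.filt k V W i)
    (hy : y ∈ LG.filt k V W j) (hn : i + j ≤ n + 1) : x * y ∈ LG.filt k V W n := by
  have h := Submodule.mul_mem_mul hx hy
  rw [LG.filt, LG.filt, Submodule.span_mul_span] at h
  refine Submodule.span_mono ?_ h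
  rintro _ ⟨_, ⟨l, hl, rfl⟩, _, ⟨l', hl', rfl⟩, rfl⟩
  exact ⟨l ++ l', by rw [List.map_append, List.sum_append]; omega, by simp⟩

theorem LG.presGen_mem_filt (a : FreeGen V W) :
    presGen (LGRel k V W) a ∈ LG.filt k V W (a.wt + 1) :=
  Submodule.subset_span ⟨[a], by simp, by simp⟩

theorem LG.word_mem_filt (l : List (FreeGen V W)) :
    (l.map (presGen (LGRel k V W))).prod ∈ LG.filt k V W ((l.map FreeGen.wt).sum + 1) :=
  Submodule.subset_span ⟨l, by simp, rfl⟩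

theorem LG.ι_mem_filt (n : ℕ) (x : V n) : LG.ι k V W n x ∈ LG.filt k V W (n - 1 + 1) := by
  rw [← LG.presGen_inl]
  exact LG.presGen_mem_filt (Sum.inl ⟨n, x⟩)

theorem LG.γ_mem_filt (n i : ℕ) (x : W n) : LG.γ k V i x ∈ LG.filt k V W 1 := by
  rw [← LG.presGen_inr]
  exact LG.presGen_mem_filt (Sum.inr ⟨n, i, x⟩)

theorem LG.exists_mem_filt (x : LG k V W) : ∃ j, x ∈ LG.filt k V W j := by
  induction x using LG.induction with
  | hs c =>
    rw [Algebra.algebraMap_eq_smul_one]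
    exact ⟨1, Submodule.smul_mem _ _ LG.one_mem_filt⟩
  | hι n x => exact ⟨_, LG.ι_mem_filt n x⟩
  | hγ n i x => exact ⟨_, LG.γ_mem_filt n i x⟩
  | hadd x y hx hy =>
    obtain ⟨i, hi⟩ := hx
    obtain ⟨j, hj⟩ := hy
    exact ⟨max i j, add_mem (LG.filt_mono (le_max_left i j) hi)
      (LG.filt_mono (le_max_right i j) hj)⟩
  | hmul x y hx hy =>
    obtain ⟨i, hi⟩ := hx
    obtain ⟨j, hj⟩ := hy
    exact ⟨i + j, LG.mul_mem_filt hi hj (by omega)⟩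

/-- An endomorphism that is the identity modulo terms of smaller weight is bijective. -/
theorem LG.bijective_of_filt (θ : LG k V W →ₐ[k] LG k V W)
    (hγ : ∀ n i (x : W n), θ (LG.γ k V i x) = LG.γ k V i x)
    (hι : ∀ n x, θ (LG.ι k V W n x) - LG.ι k V W n x ∈ LG.filt k V W (n - 1)) :
    Function.Bijective θ := by
  have hgen : ∀ a, θ (presGen (LGRel k V W) a) - presGen (LGRel k V W) a ∈
      LG.filt k V W a.wt := by
    rintro (⟨n, x⟩ | ⟨n, i, x⟩)
    · rw [LG.presGen_inl]
      exact hι n x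
    · rw [LG.presGen_inr, hγ, sub_self]
      exact zero_mem _
  have hword : ∀ l : List (FreeGen V W), θ (l.map (presGen (LGRel k V W))).prod -
      (l.map (presGen (LGRel k V W))).prod ∈ LG.filt k V W (l.map FreeGen.wt).sum := by
    intro l
    induction l with
    | nil =>
      simp only [List.map_nil, List.prod_nil, map_one, sub_self]
      exact zero_mem _
    | cons a l ih =>
      have h1 : θ (l.map (presGen (LGRel k V W))).prod ∈
          LG.filt k V W ((l.map FreeGen.wt).sum + 1) := by
        rw [← sub_add_cancel (θ _) (l.map (presGen (LGRel k V W))).prod]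
        exact add_mem (LG.filt_mono (Nat.le_succ _) ih) (LG.word_mem_filt l)
      simp only [List.map_cons, List.prod_cons, List.sum_cons]
      -- In `θ(a)θ(w) - a w = (θ(a) - a) θ(w) + a (θ(w) - w)` each term has one factor of smaller
      -- weight.
      have h2 : θ (presGen (LGRel k V W) a * (l.map (presGen (LGRel k V W))).prod) -
          presGen (LGRel k V W) a * (l.map (presGen (LGRel k V W))).prod =
          (θ (presGen (LGRel k V W) a) - presGen (LGRel k V W) a) *
            θ (l.map (presGen (LGRel k V W))).prod +
          presGen (LGRel k V W) a * (θ (l.map (presGen (LGRel k V W))).prod -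
            (l.map (presGen (LGRel k V W))).prod) := by
        rw [map_mul, sub_mul, mul_sub]
        abel
      rw [h2]
      exact add_mem (LG.mul_mem_filt (hgen a) h1 (by omega))
        (LG.mul_mem_filt (LG.presGen_mem_filt a) ih (by omega))
  have hfilt : ∀ j, ∀ x ∈ LG.filt k V W (j + 1), θ x - x ∈ LG.filt k V W j := by
    intro j x hx
    induction hx using Submodule.span_induction with
    | mem x h =>
      obtain ⟨l, hl, rfl⟩ := h
      exact LG.filt_mono (by omega) (hword l)
    | zero => rw [map_zero, sub_self]; exact zero_mem _
    | add x y _ _ h1 h2 => rw [map_add, add_sub_add_comm]; exact add_mem h1 h2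
    | smul c x _ h => rw [map_smul]; exact smul_sub_smul_mem _ c h
  constructor
  · rw [injective_iff_map_eq_zero]
    intro x hx
    -- An element of the kernel drops one level of the filtration, hence all of them.
    obtain ⟨j, hj⟩ := LG.exists_mem_filt x
    induction j with
    | zero => rwa [LG.filt_zero, Submodule.mem_bot] at hj
    | succ j ih =>
      refine ih ?_
      have := hfilt j x hj
      rw [hx, zero_sub] at this
      exact (Submodule.neg_mem_iff _).mp this
  · intro x
    obtain ⟨j, hj⟩ := LG.exists_mem_filt x
    change x ∈ AlgHom.range θ
    induction j generalizing x with
    | zero =>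
      rw [LG.filt_zero, Submodule.mem_bot] at hj
      rw [hj]
      exact zero_mem _
    | succ j ih =>
      -- Surjectivity goes by the same descent: `x = θ x - (θ x - x)`, and the difference lies one
      -- level lower.
      have h1 := ih _ (hfilt j x hj)
      have h2 : θ x ∈ AlgHom.range θ := ⟨x, rfl⟩
      have := sub_mem h2 h1
      rwa [sub_sub_cancel] at this

/-- A generator in `V n` already has weight `n - 1`, so no word of smaller weight can contribute to
the linear part in degree `n`. -/
theorem LG.linearPart_of_mem_filt {n : ℕ} {a : LG k V W} (ha : a ∈ LG.filt k V W (n - 1)) :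
    LG.linearPart n a = 0 := by
  induction ha using Submodule.span_induction with
  | mem x h =>
    obtain ⟨l, hl, rfl⟩ := h
    induction l with
    | nil =>
      rw [List.map_nil, List.prod_nil, LG.linearPart_apply, map_one, Lambda.linearPart_one]
    | cons a l ih =>
      simp only [List.map_cons, List.sum_cons] at hl
      have h1 := ih (by omega)
      simp only [List.map_cons, List.prod_cons]
      rw [LG.linearPart_apply] at h1 ⊢
      rw [map_mul, Lambda.linearPart_mul, h1, smul_zero, zero_add]
      rcases a with ⟨m, x⟩ | ⟨m, i, x⟩
      · simp only [FreeGen.wt, Sum.elim_inl] at hl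
        rw [LG.presGen_inl, LG.projL_ι, Lambda.linearPart_ι, Pi.single_eq_of_ne (by omega),
          smul_zero]
      · rw [LG.presGen_inr, LG.projL_γ]
        split_ifs
        · rw [Lambda.linearPart_one, smul_zero]
        · rw [map_zero, smul_zero]
  | zero => exact map_zero _
  | add x y _ _ h1 h2 => rw [map_add, h1, h2, add_zero]
  | smul c x _ h => rw [map_smul, h, smul_zero]

section Connected

variable (hV0 : Subsingleton (V 0)) (hV1 : Subsingleton (V 1)) (hW0 : Subsingleton (W 0))
include hW0

theorem LG.γ_of_degree_zero {n i : ℕ} (h : i * n = 0) (x : W n) :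
    ∃ c : k, LG.γ k V i x = algebraMap k _ c := by
  by_cases hi : i = 0
  · subst hi
    exact ⟨1, by rw [map_one]; exact LG.isGammaSystem.zero n x⟩
  · obtain rfl : n = 0 := (Nat.mul_eq_zero.mp h).resolve_left hi
    rw [Subsingleton.elim x 0]
    exact ⟨0, by rw [map_zero]; exact LG.isGammaSystem.apply_zero 0 hi⟩

include hV0

theorem LG.word_of_degree_zero (l : List (FreeGen V W)) (hl : (l.map FreeGen.deg).sum = 0) :
    ∃ c : k, (l.map (presGen (LGRel k V W))).prod = algebraMap k _ c := by
  induction l with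
  | nil => exact ⟨1, by simp⟩
  | cons a l ih =>
    simp only [List.map_cons, List.sum_cons] at hl
    obtain ⟨c, hc⟩ := ih (by omega)
    simp only [List.map_cons, List.prod_cons]
    rw [hc]
    rcases a with ⟨n, x⟩ | ⟨n, i, x⟩
    · obtain rfl : n = 0 := by simp only [FreeGen.deg, Sum.elim_inl] at hl; omega
      rw [LG.presGen_inl, Subsingleton.elim x 0, map_zero, zero_mul]
      exact ⟨0, by rw [map_zero]⟩
    · have h0 : i * n = 0 := by simp only [FreeGen.deg, Sum.elim_inr] at hl; omega
      obtain ⟨c', hc'⟩ := LG.γ_of_degree_zero (k := k) (V := V) hW0 h0 x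
      rw [LG.presGen_inr, hc']
      exact ⟨c' * c, by rw [map_mul]⟩

include hV1

/-- Splitting a word of degree `n` into two factors of positive degree costs one unit of weight per
factor from `V`, and a divided power of positive degree has weight `0`; the weight is then at most
`n - 2`. Words that are not so decomposable are, up to scalars, linear or constant. Truncated
subtraction makes the level `n - 2 + 1` equal to `1` when `n < 2`, which leaves room for the
scalars. -/
theorem LG.word_sub_mem_filt (l : List (FreeGen V W)) (n : ℕ)
    (hl : (l.map FreeGen.deg).sum = n) : ∃ v : V n,
      (l.map (presGen (LGRel k V W))).prod - LG.ι k V W n v ∈ LG.filt k V W (n - 2 + 1) := by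
  induction l generalizing n with
  | nil =>
    refine ⟨0, ?_⟩
    rw [map_zero, sub_zero, List.map_nil, List.prod_nil]
    exact LG.filt_mono (by omega) LG.one_mem_filt
  | cons a l ih =>
    obtain ⟨n', hn'⟩ : ∃ n', (l.map FreeGen.deg).sum = n' := ⟨_, rfl⟩
    obtain ⟨v', hv'⟩ := ih n' hn'
    simp only [List.map_cons, List.sum_cons, hn'] at hl
    simp only [List.map_cons, List.prod_cons]
    obtain ⟨w, hw⟩ : ∃ w, (l.map (presGen (LGRel k V W))).prod = w := ⟨_, rfl⟩
    rw [hw] at hv' ⊢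
    have hfilt : w ∈ LG.filt k V W (n' - 1 + 1) := by
      rw [← sub_add_cancel w (LG.ι k V W n' v')]
      exact add_mem (LG.filt_mono (show n' - 2 + 1 ≤ n' - 1 + 1 by omega) hv')
        (LG.ι_mem_filt n' v')
    rcases a with ⟨m, x⟩ | ⟨m, i, x⟩
    · rw [LG.presGen_inl]
      simp only [FreeGen.deg, Sum.elim_inl] at hl
      rcases Nat.eq_zero_or_pos n' with h0 | h0
      -- The rest of the word is a scalar, so the word is linear and equals its linear part.
      · obtain ⟨c, hc⟩ := LG.word_of_degree_zero (k := k) hV0 hW0 l (hn'.trans h0)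
        obtain rfl : m = n := by omega
        refine ⟨c • x, ?_⟩
        rw [← hw, hc, Algebra.algebraMap_eq_smul_one, mul_smul_comm, mul_one, map_smul, sub_self]
        exact zero_mem _
      · refine ⟨0, ?_⟩
        rw [map_zero, sub_zero]
        by_cases hm : m < 2
        · have : x = 0 := by
            interval_cases m <;> exact Subsingleton.elim _ _
          rw [this, map_zero, zero_mul]
          exact zero_mem _
        · exact LG.mul_mem_filt (LG.ι_mem_filt m x) hfilt (by omega)
    · rw [LG.presGen_inr]
      simp only [FreeGen.deg, Sum.elim_inr] at hl
      rcases Nat.eq_zero_or_pos (i * m) with h0 | h0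
      · obtain ⟨c, hc⟩ := LG.γ_of_degree_zero (k := k) (V := V) hW0 h0 x
        obtain rfl : n' = n := by omega
        refine ⟨c • v', ?_⟩
        rw [hc, Algebra.algebraMap_eq_smul_one, smul_mul_assoc, one_mul, map_smul]
        exact smul_sub_smul_mem _ c hv'
      · refine ⟨0, ?_⟩
        rw [map_zero, sub_zero]
        exact LG.mul_mem_filt (LG.γ_mem_filt m i x) hfilt (by omega)

/-- A homogeneous element is its linear part modulo terms of smaller weight. -/
theorem LG.sub_linearPart_mem_filt {n : ℕ} {a : LG k V W} (ha : a ∈ LG.grade k V W n) :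
    a - LG.ι k V W n (LG.linearPart n a) ∈ LG.filt k V W (n - 2 + 1) := by
  obtain ⟨v, hv⟩ : ∃ v : V n, a - LG.ι k V W n v ∈ LG.filt k V W (n - 2 + 1) := by
    rw [LG.grade, presGrade_eq_span] at ha
    induction ha using Submodule.span_induction with
    | mem x h =>
      obtain ⟨l, hl, rfl⟩ := h
      exact LG.word_sub_mem_filt hV0 hV1 hW0 l n hl
    | zero => exact ⟨0, by rw [map_zero, sub_zero]; exact zero_mem _⟩
    | add x y _ _ h1 h2 =>
      obtain ⟨v, hv⟩ := h1
      obtain ⟨v', hv'⟩ := h2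
      exact ⟨v + v', by rw [map_add, add_sub_add_comm]; exact add_mem hv hv'⟩
    | smul c x _ h =>
      obtain ⟨v, hv⟩ := h
      exact ⟨c • v, by rw [map_smul]; exact smul_sub_smul_mem _ c hv⟩
  have h : LG.linearPart n a = v := by
    by_cases hn : n < 2
    · interval_cases n <;> exact Subsingleton.elim _ _
    · rw [show n - 2 + 1 = n - 1 by omega] at hv
      have := LG.linearPart_of_mem_filt hv
      rwa [map_sub, LG.linearPart_ι, sub_eq_zero] at this
  rwa [h]

end Connected

end LG

/-! ### The lift to the Koszul extension -/

/-- Replacing the values in degrees `≥ n` by zero lets the step use a whole family, so that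
morphisms can be formed from it before all its values are known. -/
theorem exists_strong_recursion {E : ℕ → Type v} [∀ n, Zero (E n)] (G : ∀ n, (∀ m, E m) → E n) :
    ∃ f : ∀ n, E n, ∀ n, f n = G n fun m => if m < n then f m else 0 := by
  let F : ∀ n, (∀ m, m < n → E m) → E n := fun n f => G n fun m => if h : m < n then f m h else 0
  refine ⟨fun n => Nat.lt_wfRel.wf.fix F n, fun n => ?_⟩
  change Nat.lt_wfRel.wf.fix F n = _
  rw [WellFounded.fix_eq]
  simp only [F, dite_eq_ite]

/-- Over a field the surjection onto `range g` has a section, which extends to all of `N`. This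
allows primitives to be chosen linearly. -/
theorem exists_quasi_inverse {k : Type u} [Field k] {M : Type v} {N : Type w} [AddCommGroup M]
    [Module k M] [AddCommGroup N] [Module k N] (g : M →ₗ[k] N) :
    ∃ h : N →ₗ[k] M, ∀ x, g (h (g x)) = g x := by
  obtain ⟨s, hs⟩ := g.rangeRestrict.exists_rightInverse_of_surjective g.range_rangeRestrict
  obtain ⟨h, hh⟩ := s.exists_extend
  refine ⟨h, fun x => ?_⟩
  have h1 : h (g x) = s (g.rangeRestrict x) := LinearMap.congr_fun hh (g.rangeRestrict x)
  rw [h1]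
  exact congrArg Subtype.val (LinearMap.congr_fun hs (g.rangeRestrict x))

theorem exists_quasi_inverse_on {k : Type u} [Field k] {A : Type v} [Ring A] [Algebra k A]
    (D : A →ₗ[k] A) (S : Submodule k A) : ∃ h : A →ₗ[k] S, ∀ v ∈ S, D (h (D v)) = D v := by
  obtain ⟨h, hh⟩ := exists_quasi_inverse (D.comp S.subtype)
  exact ⟨h, fun v hv => hh ⟨v, hv⟩⟩

/-- A primitive of a homogeneous element may thus be replaced by one of its homogeneous components.
-/
theorem map_decompose {k : Type u} [Field k] {A : Type v} [Ring A] [Algebra k A]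
    {𝒜 : ℕ → Submodule k A} [GradedAlgebra 𝒜] {D : A →ₗ[k] A}
    (hD : ∀ n, ∀ a ∈ 𝒜 n, D a ∈ 𝒜 (n + 1)) (n : ℕ) (a : A) :
    D (DirectSum.decompose 𝒜 a n) = DirectSum.decompose 𝒜 (D a) (n + 1) := by
  induction a using homogeneous_induction 𝒜 with
  | h m a ha =>
    by_cases h : m = n
    · subst h
      rw [DirectSum.decompose_of_mem_same 𝒜 ha, DirectSum.decompose_of_mem_same 𝒜 (hD _ a ha)]
    · rw [DirectSum.decompose_of_mem_ne 𝒜 ha h,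
        DirectSum.decompose_of_mem_ne 𝒜 (hD _ a ha) (by omega), map_zero]
  | hadd x y hx hy =>
    rw [DirectSum.decompose_add, map_add, DirectSum.decompose_add, DirectSum.add_apply,
      DirectSum.add_apply, Submodule.coe_add, Submodule.coe_add, map_add, hx, hy]

/-! ### Minimality and the subalgebras generated by low degrees. -/

section Below

variable (k : Type u) [Field k] (V : ℕ → Type v) [∀ n, AddCommGroup (V n)]
  [∀ n, Module k (V n)]

/-- The subalgebra of `ΛV` generated by the elements of `V` of degree less than `n`. -/
def Lambda.below (n : ℕ) : Subalgebra k (Lambda k V) :=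
  Algebra.adjoin k {a | ∃ m < n, ∃ x : V m, a = Lambda.ι k V m x}

variable {k V}

/-- All letters have degree at least `2`, unless the word is zero. In a word of length at least two
and degree `n + 1` every letter therefore has degree at most `n - 1`. -/
theorem Lambda.word_sub_mem_below (hV : ∀ n < 2, Subsingleton (V n)) (l : List (Σ n, V n)) (n : ℕ)
    (hl : (l.map Sigma.fst).sum = n + 1) : ∃ v : V (n + 1),
      (l.map (presGen (LambdaRel k V))).prod - Lambda.ι k V (n + 1) v ∈ Lambda.below k V n := by
  by_cases h : ∃ a ∈ l, a.1 < 2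
  · obtain ⟨⟨m, x⟩, ha, hm⟩ := h
    have := hV m hm
    refine ⟨0, ?_⟩
    rw [map_zero, sub_zero, List.prod_eq_zero]
    · exact zero_mem _
    · refine List.mem_map.mpr ⟨_, ha, ?_⟩
      change Lambda.ι k V m x = 0
      rw [Subsingleton.elim x 0, map_zero]
  · push Not at h
    match l with
    | [] => simp at hl
    | [⟨m, x⟩] =>
      obtain rfl : m = n + 1 := by simpa using hl
      refine ⟨x, ?_⟩
      rw [List.map_singleton, List.prod_singleton]
      change Lambda.ι k V (n + 1) x - Lambda.ι k V (n + 1) x ∈ _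
      rw [sub_self]
      exact zero_mem _
    | a :: b :: t =>
      refine ⟨0, ?_⟩
      rw [map_zero, sub_zero]
      refine Subalgebra.list_prod_mem _ fun y hy => ?_
      obtain ⟨c, hc, rfl⟩ := List.mem_map.mp hy
      refine Algebra.subset_adjoin ⟨c.1, ?_, c.2, rfl⟩
      have ha := h a (by simp)
      have hb := h b (by simp)
      simp only [List.map_cons, List.sum_cons] at hl
      rcases List.mem_cons.mp hc with rfl | hc
      · omega
      · have := List.le_sum_of_mem (List.mem_map_of_mem (f := Sigma.fst) hc)
        simp only [List.map_cons, List.sum_cons] at this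
        omega

theorem Lambda.linearPart_of_mem_below {n : ℕ} {a : Lambda k V} (ha : a ∈ Lambda.below k V n) :
    Lambda.linearPart k V (n + 1) a = 0 := by
  induction ha using Algebra.adjoin_induction with
  | mem a ha =>
    obtain ⟨m, hm, x, rfl⟩ := ha
    rw [Lambda.linearPart_ι, Pi.single_eq_of_ne (by omega)]
  | algebraMap c =>
    rw [Algebra.algebraMap_eq_smul_one, map_smul, Lambda.linearPart_one, smul_zero]
  | add a b _ _ ha hb => rw [map_add, ha, hb, add_zero]
  | mul a b _ _ ha hb => rw [Lambda.linearPart_mul, ha, hb, smul_zero, smul_zero, add_zero]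

/-- Applied to the differential of a generator of degree `n`, this is the nilpotence property of a
minimal model: it involves only generators of degree less than `n`. -/
theorem Lambda.mem_below_of_linearPart (hV : ∀ n < 2, Subsingleton (V n)) {n : ℕ}
    {a : Lambda k V} (ha : a ∈ Lambda.grade k V (n + 1))
    (h0 : Lambda.linearPart k V (n + 1) a = 0) : a ∈ Lambda.below k V n := by
  obtain ⟨v, hv⟩ : ∃ v, a - Lambda.ι k V (n + 1) v ∈ Lambda.below k V n := by
    rw [Lambda.grade, presGrade_eq_span] at ha
    clear h0
    induction ha using Submodule.span_induction with
    | mem x h =>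
      obtain ⟨l, hl, rfl⟩ := h
      exact Lambda.word_sub_mem_below hV l n hl
    | zero => exact ⟨0, by rw [map_zero, sub_zero]; exact zero_mem _⟩
    | add x y _ _ h1 h2 =>
      obtain ⟨v, hv⟩ := h1
      obtain ⟨v', hv'⟩ := h2
      exact ⟨v + v', by rw [map_add, add_sub_add_comm]; exact add_mem hv hv'⟩
    | smul c x _ h =>
      obtain ⟨v, hv⟩ := h
      refine ⟨c • v, ?_⟩
      rw [map_smul]
      exact smul_sub_smul_mem (Subalgebra.toSubmodule (Lambda.below k V n)) c hv
  have h := Lambda.linearPart_of_mem_below hv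
  rw [map_sub, h0, Lambda.linearPart_ι, Pi.single_eq_same, zero_sub, neg_eq_zero] at h
  rwa [h, map_zero, sub_zero] at hv

end Below

/-! ### Lifting a morphism through the Koszul extension. -/

section Lift

variable {k : Type u} [Field k] {X : ℕ → Type v} [∀ n, AddCommGroup (X n)]
  [∀ n, Module k (X n)] {K : ℕ → Type w} [∀ n, AddCommGroup (K n)] [∀ n, Module k (K n)]
  {d : Lambda k X →ₗ[k] Lambda k X} {D : Koszul k X K →ₗ[k] Koszul k X K}

theorem IsKoszulDifferential.proj_comm (hD : IsKoszulDifferential d D)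
    (hd : IsGradedDerivation (Lambda.grade k X) d) (a : Koszul k X K) :
    Koszul.proj k X K (D a) = d (Koszul.proj k X K a) := by
  induction a using Koszul.induction with
  | hX a => rw [hD.map_inX, Koszul.proj_inX, Koszul.proj_inX]
  | hK n x => rw [hD.map_inK, Koszul.proj_inK, map_zero, map_zero]
  | hγ n i x =>
    rw [Koszul.proj_γ, hD.map_γ]
    have h1 : d (if i = 0 then 1 else 0) = 0 := by
      split_ifs
      · exact hd.isOddDerivation.map_one
      · exact map_zero _
    rw [h1]
    match i with
    | 0 => exact map_zero _
    | 1 => exact Koszul.proj_inK (n + 1) x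
    | i + 2 =>
      by_cases hn : Even n
      · rw [gammaDer_even _ hn, map_mul, Koszul.proj_inK, zero_mul]
      · simp [gammaDer, hn]
  | hadd x y hx hy => rw [map_add, map_add, hx, hy, map_add, map_add]
  | hmul x y hx hy =>
    rw [map_mul (Koszul.proj k X K), hD.odd.leibniz, hd.leibniz_sign, map_add, map_mul, map_mul,
      hx, hy, signHom_map (𝒜 := Koszul.grade k X K) _ fun n a ha => Koszul.proj_mem ha]

theorem Koszul.linearPart_inX (n : ℕ) (a : Lambda k X) :
    LG.linearPart n (Koszul.inX k X K a) = (Lambda.linearPart k X n a, 0) := by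
  rw [LG.linearPart_apply, Koszul.inX, AlgHom.comp_apply, LG.projL_inL, Lambda.linearPart_map]
  rfl

theorem Koszul.linearPart_inK (n : ℕ) (x : K n) :
    LG.linearPart n (Koszul.inK k X K n x) = (0, x) := by
  rw [Koszul.inK_apply, LG.linearPart_ι]

theorem Koszul.linearPart_proj (n : ℕ) (a : Koszul k X K) :
    Lambda.linearPart k X n (Koszul.proj k X K a) = (LG.linearPart n a).1 := by
  rw [Koszul.proj, AlgHom.comp_apply, Lambda.linearPart_map]
  rfl

variable (k X K) in
/-- The homogeneous elements of degree `n` that vanish in `ΛX` and have no linear part. -/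
def Koszul.decomposable (n : ℕ) : Submodule k (Koszul k X K) :=
  Koszul.grade k X K n ⊓ LinearMap.ker (Koszul.proj k X K).toLinearMap ⊓
    LinearMap.ker (LG.linearPart n)

/-- Any primitive can be corrected: its component of degree `n` is again a primitive, its image in
`ΛX` is a cycle and can be subtracted, and so can its linear part in `K`, which consists of cycles.
-/
theorem IsKoszulDifferential.exists_decomposable (hD : IsKoszulDifferential d D)
    (hd : IsGradedDerivation (Lambda.grade k X) d) (h2 : (2 : k) ≠ 0) (h0 : Subsingleton (K 0))
    {n : ℕ} {c : Koszul k X K} (hc : c ∈ Koszul.grade k X K (n + 1)) (hDc : D c = 0)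
    (hpc : Koszul.proj k X K c = 0) : ∃ v ∈ Koszul.decomposable k X K n, D v = c := by
  obtain ⟨v, hv⟩ := hD.exists_sub_proj_eq h2 h0 hDc
  rw [hpc, map_zero, sub_zero] at hv
  obtain ⟨v₁, hv₁, hDv₁⟩ : ∃ v₁ ∈ Koszul.grade k X K n, D v₁ = c := by
    refine ⟨_, SetLike.coe_mem (DirectSum.decompose (Koszul.grade k X K) v n), ?_⟩
    rw [map_decompose hD.map_mem, ← hv, DirectSum.decompose_of_mem_same _ hc]
  let v₂ := v₁ - Koszul.inX k X K (Koszul.proj k X K v₁)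
  have hv₂ : v₂ ∈ Koszul.grade k X K n := sub_mem hv₁ (Koszul.inX_mem (Koszul.proj_mem hv₁))
  have hp₂ : Koszul.proj k X K v₂ = 0 := by
    simp only [v₂]
    rw [map_sub, Koszul.proj_inX, sub_self]
  have hD₂ : D v₂ = c := by
    simp only [v₂]
    rw [map_sub, hDv₁, hD.map_inX, ← hD.proj_comm hd, hDv₁, hpc, map_zero, sub_zero]
  refine ⟨v₂ - Koszul.inK k X K n (LG.linearPart n v₂).2,
    ⟨⟨sub_mem hv₂ (Koszul.inK_mem _ _), ?_⟩, ?_⟩, ?_⟩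
  · change Koszul.proj k X K _ = 0
    rw [map_sub, hp₂, Koszul.proj_inK, sub_zero]
  · change LG.linearPart n _ = 0
    have h1 := Koszul.linearPart_proj n v₂
    rw [hp₂, map_zero] at h1
    rw [map_sub, Koszul.linearPart_inK]
    exact Prod.ext (by rw [Prod.fst_sub, ← h1, sub_zero]; rfl) (by rw [Prod.snd_sub, sub_self]; rfl)
  · rw [map_sub, hD₂, hD.map_inK, sub_zero]

variable {Y : ℕ → Type u'} [∀ n, AddCommGroup (Y n)] [∀ n, Module k (Y n)]

/-- The morphism from `ΛY` with prescribed homogeneous values on `Y`. -/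
def Koszul.liftGraded (f : ∀ n, Y n →ₗ[k] Koszul.grade k X K n) : Lambda k Y →ₐ[k] Koszul k X K :=
  Lambda.lift (fun n => (Koszul.grade k X K n).subtype.comp (f n)) fun m n x y =>
    LG.gradedCommutative m n _ (f m x).2 _ (f n y).2

theorem Koszul.liftGraded_ι (f : ∀ n, Y n →ₗ[k] Koszul.grade k X K n) (n : ℕ) (y : Y n) :
    Koszul.liftGraded f (Lambda.ι k Y n y) = f n y :=
  Lambda.lift_ι _ _ _ _

theorem Koszul.liftGraded_mem (f : ∀ n, Y n →ₗ[k] Koszul.grade k X K n) (n : ℕ) (a : Lambda k Y)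
    (ha : a ∈ Lambda.grade k Y n) : Koszul.liftGraded f a ∈ Koszul.grade k X K n :=
  Lambda.map_mem _ (fun n y => by rw [Koszul.liftGraded_ι]; exact (f n y).2) ha

/-- In the recursion, the value on a differential thus depends only on generators already treated.
-/
theorem Koszul.liftGraded_congr {f g : ∀ n, Y n →ₗ[k] Koszul.grade k X K n} {n : ℕ}
    (h : ∀ m < n, f m = g m) {a : Lambda k Y} (ha : a ∈ Lambda.below k Y n) :
    Koszul.liftGraded f a = Koszul.liftGraded g a := by
  induction ha using Algebra.adjoin_induction with
  | mem a ha =>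
    obtain ⟨m, hm, x, rfl⟩ := ha
    rw [Koszul.liftGraded_ι, Koszul.liftGraded_ι, h m hm]
  | algebraMap c => rw [AlgHom.commutes, AlgHom.commutes]
  | add a b _ _ ha hb => rw [map_add, map_add, ha, hb]
  | mul a b _ _ ha hb => rw [map_mul, map_mul, ha, hb]

/-- A morphism to `ΛX` lifts to the Koszul extension, with prescribed linear part. -/
theorem IsKoszulDifferential.exists_lift (hD : IsKoszulDifferential d D)
    (hd : IsDifferential (Lambda.grade k X) d) (h2 : (2 : k) ≠ 0) (h0 : Subsingleton (K 0))
    {e : Lambda k Y →ₗ[k] Lambda k Y} (he : IsMinimalSullivan k Y e)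
    {Ψ : Lambda k Y →ₐ[k] Lambda k X}
    (hΨ : IsDGMorphism (Lambda.grade k Y) e (Lambda.grade k X) d Ψ)
    (κ : ∀ n, Y n →ₗ[k] K n) :
    ∃ i : Lambda k Y →ₐ[k] Koszul k X K,
      IsDGMorphism (Lambda.grade k Y) e (Koszul.grade k X K) D i ∧
      (Koszul.proj k X K).comp i = Ψ ∧
      ∀ n y, LG.linearPart n (i (Lambda.ι k Y n y)) = (phi Ψ n y, κ n y) := by
  -- Primitives without linear part are chosen linearly, so that the recursion defines linear maps
  -- on each `Y n`.
  have hh : ∀ n, ∃ h : Koszul k X K →ₗ[k] Koszul.decomposable k X K n,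
      ∀ c ∈ Koszul.grade k X K (n + 1), D c = 0 → Koszul.proj k X K c = 0 → D (h c) = c := by
    intro n
    obtain ⟨h, hh⟩ := exists_quasi_inverse_on D (Koszul.decomposable k X K n)
    refine ⟨h, fun c hc hDc hpc => ?_⟩
    obtain ⟨v, hv, rfl⟩ := hD.exists_decomposable hd.toIsGradedDerivation h2 h0 hc hDc hpc
    exact hh v hv
  choose h hh using hh
  -- The obstruction: the failure of the naive value `Ψ y + κ y` to commute with the differentials.
  let z : (∀ n, Y n →ₗ[k] Koszul.grade k X K n) → ∀ n, Y n →ₗ[k] Koszul k X K := fun f n =>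
    ((Koszul.liftGraded f).toLinearMap.comp e - (Koszul.inX k X K).toLinearMap.comp
      (d.comp Ψ.toLinearMap)).comp (Lambda.ι k Y n)
  obtain ⟨f, hf⟩ := exists_strong_recursion (E := fun n => Y n →ₗ[k] Koszul.grade k X K n)
    fun n f => LinearMap.codRestrict (Koszul.grade k X K n)
      ((Koszul.inX k X K).toLinearMap.comp (Ψ.toLinearMap.comp (Lambda.ι k Y n)) +
        (Koszul.inK k X K n).comp (κ n) +
        (Koszul.decomposable k X K n).subtype.comp ((h n).comp (z f n)))
      fun y => add_mem (add_mem (Koszul.inX_mem (hΨ.map_mem n _ (Lambda.ι_mem n y)))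
        (Koszul.inK_mem n _)) (h n (z f n y)).2.1.1
  let i := Koszul.liftGraded f
  have hmem : ∀ n y, e (Lambda.ι k Y n y) ∈ Lambda.below k Y n := fun n y =>
    Lambda.mem_below_of_linearPart he.degree_ge_two (he.map_mem n _ (Lambda.ι_mem n y))
      (Lambda.linearPart_of_mem_sq (he.minimal n y) _)
  have hval : ∀ n y, i (Lambda.ι k Y n y) = Koszul.inX k X K (Ψ (Lambda.ι k Y n y)) +
      Koszul.inK k X K n (κ n y) + h n (i (e (Lambda.ι k Y n y)) -
        Koszul.inX k X K (d (Ψ (Lambda.ι k Y n y)))) := by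
    intro n y
    have h1 : i (e (Lambda.ι k Y n y)) =
        Koszul.liftGraded (fun m => if m < n then f m else 0) (e (Lambda.ι k Y n y)) :=
      Koszul.liftGraded_congr (fun m hm => by rw [if_pos hm]) (hmem n y)
    rw [h1]
    refine (Koszul.liftGraded_ι f n y).trans ?_
    rw [hf n]
    rfl
  have hproj : (Koszul.proj k X K).comp i = Ψ := by
    refine Lambda.algHom_ext fun n y => ?_
    rw [AlgHom.comp_apply, hval, map_add, map_add, Koszul.proj_inX, Koszul.proj_inK, add_zero]
    exact (add_eq_left).mpr (h n _).2.1.2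
  have hproj' : ∀ a, Koszul.proj k X K (i a) = Ψ a := DFunLike.congr_fun hproj
  have hcomm : ∀ n, ∀ a ∈ Lambda.below k Y n, i (e a) = D (i a) := by
    intro n
    induction n using Nat.strong_induction_on with
    | _ n ih =>
    intro a ha
    induction ha using Algebra.adjoin_induction with
    | mem a ha =>
      obtain ⟨m, hm, y, rfl⟩ := ha
      -- The obstruction is a cycle because `e y` involves only generators of degree less than `m`,
      -- where commutation is already known, and `e² = 0`.
      have h1 : D (i (e (Lambda.ι k Y m y)) - Koszul.inX k X K (d (Ψ (Lambda.ι k Y m y)))) = 0 := by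
        rw [map_sub, ← ih m hm _ (hmem m y), he.sq_zero, map_zero, hD.map_inX, hd.sq_zero,
          map_zero, sub_zero]
      have h2 : Koszul.proj k X K (i (e (Lambda.ι k Y m y)) -
          Koszul.inX k X K (d (Ψ (Lambda.ι k Y m y)))) = 0 := by
        rw [map_sub, hproj', Koszul.proj_inX, hΨ.comm, sub_self]
      have h3 := hh m _ (sub_mem (Koszul.liftGraded_mem f _ _ (he.map_mem m _ (Lambda.ι_mem m y)))
        (Koszul.inX_mem (hd.map_mem m _ (hΨ.map_mem m _ (Lambda.ι_mem m y))))) h1 h2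
      rw [hval m y, map_add, map_add, hD.map_inX, hD.map_inK, add_zero, h3, add_sub_cancel]
    | algebraMap c =>
      rw [he.toIsGradedDerivation.isOddDerivation.map_algebraMap, map_zero, AlgHom.commutes,
        hD.odd.map_algebraMap]
    | add a b _ _ ha hb => rw [map_add, map_add, ha, hb, map_add, map_add]
    | mul a b _ _ ha hb =>
      rw [he.toIsGradedDerivation.leibniz_sign, map_add, map_mul, map_mul, ha, hb, map_mul,
        hD.odd.leibniz, signHom_map i (Koszul.liftGraded_mem f)]
  refine ⟨i, ⟨Koszul.liftGraded_mem f, fun a => ?_⟩, hproj, fun n y => ?_⟩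
  · induction a using pres_induction with
    | hs c =>
      rw [he.toIsGradedDerivation.isOddDerivation.map_algebraMap, map_zero, AlgHom.commutes,
        hD.odd.map_algebraMap]
    | hg a => exact hcomm (a.1 + 1) _ (Algebra.subset_adjoin ⟨a.1, Nat.lt_succ_self _, a.2, rfl⟩)
    | hadd a b ha hb => rw [map_add, map_add, ha, hb, map_add, map_add]
    | hmul a b ha hb =>
      rw [he.toIsGradedDerivation.leibniz_sign, map_add, map_mul, map_mul, ha, hb, map_mul,
        hD.odd.leibniz, signHom_map i (Koszul.liftGraded_mem f)]
  · rw [hval, map_add, map_add, Koszul.linearPart_inX, Koszul.linearPart_inK,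
      show LG.linearPart n (h n _ : Koszul k X K) = 0 from (h n _).2.2, add_zero, Prod.mk_add_mk,
      add_zero, zero_add]
    rfl

end Lift

/-! ### Graded tensor products of graded commutative algebras -/

section Tensor

open GradedTensorProduct

/-- The graded tensor product takes its signs in the units of the integers, while graded
commutativity takes them in `k`. -/
theorem neg_one_units_smul {k : Type u} [Field k] {M : Type v} [AddCommGroup M] [Module k M]
    (n : ℕ) (x : M) : ((-1 : ℤˣ) ^ n) • x = (-1 : k) ^ n • x := by
  rcases Nat.even_or_odd n with h | h
  · rw [h.neg_one_pow, h.neg_one_pow, one_smul, one_smul]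
  · rw [h.neg_one_pow, h.neg_one_pow, neg_smul, one_smul, Units.neg_smul, one_smul]

theorem neg_one_pow_congr {k : Type u} [Field k] {m n l : ℕ} (h : m = n + 2 * l) :
    (-1 : k) ^ m = (-1 : k) ^ n := by
  rw [h, pow_add, pow_mul, neg_one_sq, one_pow, mul_one]

variable {k : Type u} [Field k] {A : Type v} {B : Type w} [Ring A] [Ring B] [Algebra k A]
  [Algebra k B] {𝒜 : ℕ → Submodule k A} {ℬ : ℕ → Submodule k B} [GradedAlgebra 𝒜]
  [GradedAlgebra ℬ]

theorem tmul_mul_tmul_of_mem {i j : ℕ} (a : A) {b : B} (hb : b ∈ ℬ j) {a' : A} (ha : a' ∈ 𝒜 i)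
    (b' : B) : (a ᵍ⊗ₜ[k] b : 𝒜 ᵍ⊗[k] ℬ) * (a' ᵍ⊗ₜ[k] b') =
      (-1 : k) ^ (j * i) • ((a * a') ᵍ⊗ₜ[k] (b * b') : 𝒜 ᵍ⊗[k] ℬ) :=
  (tmul_coe_mul_coe_tmul 𝒜 ℬ a (⟨b, hb⟩ : ℬ j) (⟨a', ha⟩ : 𝒜 i) b').trans
    (neg_one_units_smul _ _)

theorem smul_tmul_smul (c c' : k) (a : A) (b : B) :
    ((c • a) ᵍ⊗ₜ[k] (c' • b) : 𝒜 ᵍ⊗[k] ℬ) = (c * c') • (a ᵍ⊗ₜ[k] b : 𝒜 ᵍ⊗[k] ℬ) :=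
  TensorProduct.smul_tmul_smul c c' a b

theorem tensor_gradedCommutative (h𝒜 : IsGradedCommutative 𝒜) (hℬ : IsGradedCommutative ℬ) :
    IsGradedCommutative (tensorGrade 𝒜 ℬ) := by
  intro m n x hx y hy
  induction hx using Submodule.span_induction with
  | mem x h =>
    obtain ⟨i, j, rfl, a, ha, b, hb, rfl⟩ := h
    induction hy using Submodule.span_induction with
    | mem y h =>
      obtain ⟨i', j', rfl, a', ha', b', hb', rfl⟩ := h
      rw [tmul_mul_tmul_of_mem a hb ha' b', tmul_mul_tmul_of_mem a' hb' ha b, h𝒜 i i' a ha a' ha',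
        hℬ j j' b hb b' hb', smul_tmul_smul, smul_smul, smul_smul, ← pow_add, ← pow_add, ← pow_add]
      congr 1
      exact (neg_one_pow_congr (l := i * j') (by ring)).symm
    | zero => rw [mul_zero, zero_mul, smul_zero]
    | add y y' _ _ h h' => rw [mul_add, add_mul y, smul_add, h, h']
    | smul c y _ h => rw [mul_smul_comm, smul_mul_assoc, h, smul_comm]
  | zero => rw [mul_zero, zero_mul, smul_zero]
  | add x x' _ _ h h' => rw [mul_add, add_mul x, smul_add, h, h']
  | smul c x _ h => rw [mul_smul_comm, smul_mul_assoc, h, smul_comm]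

variable {C : Type u'} [Ring C] [Algebra k C] {𝒞 : ℕ → Submodule k C}

/-- The morphism from a graded tensor product to a graded commutative algebra. -/
def tensorLift (hC : IsGradedCommutative 𝒞) (f : A →ₐ[k] C) (hf : ∀ n, ∀ a ∈ 𝒜 n, f a ∈ 𝒞 n)
    (g : B →ₐ[k] C) (hg : ∀ n, ∀ b ∈ ℬ n, g b ∈ 𝒞 n) : (𝒜 ᵍ⊗[k] ℬ) →ₐ[k] C :=
  GradedTensorProduct.lift 𝒜 ℬ f g fun i j a b => by
    refine (hC i j _ (hf i a a.2) _ (hg j b b.2)).trans ?_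
    rw [mul_comm i j]
    exact (neg_one_units_smul _ _).symm

section

variable (hC : IsGradedCommutative 𝒞) (f : A →ₐ[k] C) (hf : ∀ n, ∀ a ∈ 𝒜 n, f a ∈ 𝒞 n)
  (g : B →ₐ[k] C) (hg : ∀ n, ∀ b ∈ ℬ n, g b ∈ 𝒞 n)

theorem tensorLift_tmul (a : A) (b : B) :
    tensorLift hC f hf g hg (a ᵍ⊗ₜ[k] b) = f a * g b := rfl

theorem tensorLift_includeLeft (a : A) :
    tensorLift hC f hf g hg (includeLeft 𝒜 ℬ a) = f a := by
  refine (tensorLift_tmul hC f hf g hg a 1).trans ?_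
  rw [map_one, mul_one]

theorem tensorLift_includeRight (b : B) :
    tensorLift hC f hf g hg (includeRight 𝒜 ℬ b) = g b := by
  refine (tensorLift_tmul hC f hf g hg 1 b).trans ?_
  rw [map_one, one_mul]

theorem tensorLift_mem [SetLike.GradedMonoid 𝒞] (n : ℕ) (x : 𝒜 ᵍ⊗[k] ℬ)
    (hx : x ∈ tensorGrade 𝒜 ℬ n) : tensorLift hC f hf g hg x ∈ 𝒞 n := by
  induction hx using Submodule.span_induction with
  | mem x h =>
    obtain ⟨i, j, rfl, a, ha, b, hb, rfl⟩ := h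
    exact SetLike.GradedMul.mul_mem (hf i a ha) (hg j b hb)
  | zero => rw [map_zero]; exact zero_mem _
  | add x y _ _ h h' => rw [map_add]; exact add_mem h h'
  | smul c x _ h => rw [map_smul]; exact Submodule.smul_mem _ _ h

end

theorem includeLeft_mem (n : ℕ) (a : A) (ha : a ∈ 𝒜 n) :
    includeLeft 𝒜 ℬ a ∈ tensorGrade 𝒜 ℬ n := by
  have := tmul_mem_tensorGrade (k := k) (ℬ := ℬ) ha (SetLike.GradedOne.one_mem (A := ℬ))
  rwa [add_zero] at this

theorem includeRight_mem (n : ℕ) (b : B) (hb : b ∈ ℬ n) :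
    includeRight 𝒜 ℬ b ∈ tensorGrade 𝒜 ℬ n := by
  have := tmul_mem_tensorGrade (k := k) (𝒜 := 𝒜) (SetLike.GradedOne.one_mem (A := 𝒜)) hb
  rwa [zero_add] at this

theorem includeLeft_mul_includeRight (a : A) (b : B) :
    includeLeft 𝒜 ℬ a * includeRight 𝒜 ℬ b = a ᵍ⊗ₜ[k] b :=
  tmul_one_mul_one_tmul 𝒜 ℬ a b

/-- A subalgebra containing both factors of a graded tensor product is everything. -/
theorem tensor_subalgebra_eq_top (S : Subalgebra k (𝒜 ᵍ⊗[k] ℬ))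
    (h : ∀ a, includeLeft 𝒜 ℬ a ∈ S) (h' : ∀ b, includeRight 𝒜 ℬ b ∈ S) (x : 𝒜 ᵍ⊗[k] ℬ) :
    x ∈ S := by
  induction x using TensorProduct.induction_on with
  | zero => exact zero_mem S
  | tmul a b =>
    have := mul_mem (h a) (h' b)
    rwa [includeLeft_mul_includeRight] at this
  | add x y hx hy => exact add_mem hx hy

end Tensor

/-! ### Maps that preserve degrees. -/

section Graded

variable {k : Type u} [Field k] {A : Type v} {B : Type w} [Ring A] [Ring B] [Algebra k A]
  [Algebra k B] {𝒜 : ℕ → Submodule k A} {ℬ : ℕ → Submodule k B} [GradedAlgebra 𝒜]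
  [GradedAlgebra ℬ]

theorem map_decompose_of_mem {f : A →ₗ[k] B} (hf : ∀ n, ∀ a ∈ 𝒜 n, f a ∈ ℬ n) (n : ℕ) (a : A) :
    f (DirectSum.decompose 𝒜 a n) = DirectSum.decompose ℬ (f a) n := by
  induction a using homogeneous_induction 𝒜 with
  | h m a ha =>
    by_cases h : m = n
    · subst h
      rw [DirectSum.decompose_of_mem_same 𝒜 ha, DirectSum.decompose_of_mem_same ℬ (hf _ a ha)]
    · rw [DirectSum.decompose_of_mem_ne 𝒜 ha h, DirectSum.decompose_of_mem_ne ℬ (hf _ a ha) h,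
        map_zero]
  | hadd x y hx hy =>
    rw [DirectSum.decompose_add, map_add, DirectSum.decompose_add, DirectSum.add_apply,
      DirectSum.add_apply, Submodule.coe_add, Submodule.coe_add, map_add, hx, hy]

/-- An injective map compatible with homogeneous components reflects homogeneity. -/
theorem mem_of_map_mem {f : A →ₗ[k] B} (hf : ∀ n, ∀ a ∈ 𝒜 n, f a ∈ ℬ n)
    (hinj : Function.Injective f) {n : ℕ} {a : A} (ha : f a ∈ ℬ n) : a ∈ 𝒜 n := by
  have h := map_decompose_of_mem hf n a
  rw [DirectSum.decompose_of_mem_same ℬ ha] at h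
  rw [← hinj h]
  exact SetLike.coe_mem _

end Graded

/-! ### Splitting a linear map -/

/-- This encodes the isomorphism `(y, z) ↦ (φ y + s z, κ y)` from `Y ⊕ coker φ` to `X ⊕ ker φ`; its
inverse is `x ↦ (μ x, [x.1])`. -/
theorem exists_splitting {k : Type u} [Field k] {Y : Type v} {X : Type w} [AddCommGroup Y]
    [Module k Y] [AddCommGroup X] [Module k X] (φ : Y →ₗ[k] X) :
    ∃ (s : (X ⧸ LinearMap.range φ) →ₗ[k] X) (κ : Y →ₗ[k] LinearMap.ker φ)
      (μ : X × LinearMap.ker φ →ₗ[k] Y),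
      (∀ z, (LinearMap.range φ).mkQ (s z) = z) ∧
      (∀ x, φ (μ x) + s ((LinearMap.range φ).mkQ x.1) = x.1) ∧ (∀ x, κ (μ x) = x.2) ∧
      (∀ y, μ (φ y, κ y) = y) ∧ ∀ z, μ (s z, 0) = 0 := by
  obtain ⟨s, hs⟩ := (LinearMap.range φ).mkQ.exists_rightInverse_of_surjective
    (LinearMap.range_eq_top.mpr (Submodule.mkQ_surjective _))
  obtain ⟨κ, hκ⟩ := (LinearMap.ker φ).subtype.exists_leftInverse_of_injective
    (Submodule.ker_subtype _)
  obtain ⟨ρ, hρ⟩ := exists_quasi_inverse φ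
  have hs' : ∀ z, (LinearMap.range φ).mkQ (s z) = z := LinearMap.congr_fun hs
  have hκ' : ∀ y : LinearMap.ker φ, κ y = y := LinearMap.congr_fun hκ
  -- The element `x - s [x]` lies in the range of `φ`, where the quasi-inverse `ρ` yields a
  -- preimage. Removing its component in `ker φ` and adding the second coordinate gives `μ`.
  let r : X →ₗ[k] Y := ρ.comp (LinearMap.id - s.comp (LinearMap.range φ).mkQ)
  have hφr : ∀ x, φ (r x) = x - s ((LinearMap.range φ).mkQ x) := by
    intro x
    have hx : x - s ((LinearMap.range φ).mkQ x) ∈ LinearMap.range φ := by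
      rw [← Submodule.Quotient.mk_eq_zero]
      change (LinearMap.range φ).mkQ _ = 0
      rw [map_sub, hs', sub_self]
    obtain ⟨y, hy⟩ := hx
    change φ (ρ (x - s ((LinearMap.range φ).mkQ x))) = _
    rw [← hy, hρ]
  have hmk : ∀ y, (LinearMap.range φ).mkQ (φ y) = 0 := fun y => by
    rw [← LinearMap.mem_ker, Submodule.ker_mkQ]
    exact ⟨y, rfl⟩
  refine ⟨s, κ, (r - (LinearMap.ker φ).subtype.comp (κ.comp r)).comp (LinearMap.fst k _ _) +
    (LinearMap.ker φ).subtype.comp (LinearMap.snd k _ _), hs', fun x => ?_, fun x => ?_,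
    fun y => ?_, fun z => ?_⟩
  · change φ (r x.1 - κ (r x.1) + x.2) + _ = _
    rw [map_add, map_sub, LinearMap.mem_ker.mp (κ (r x.1)).2, LinearMap.mem_ker.mp x.2.2, hφr]
    abel
  · change κ (r x.1 - κ (r x.1) + x.2) = _
    rw [map_add, map_sub, hκ', hκ', sub_self, zero_add]
  · change r (φ y) - κ (r (φ y)) + κ y = y
    have h1 : r (φ y) - y ∈ LinearMap.ker φ := by
      rw [LinearMap.mem_ker, map_sub, hφr, hmk, map_zero, sub_zero, sub_self]
    have h2 := congrArg Subtype.val (hκ' ⟨_, h1⟩)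
    rw [map_sub, Submodule.coe_sub] at h2
    rw [sub_add, h2, sub_sub_cancel]
  · change r (s z) - κ (r (s z)) + ((0 : LinearMap.ker φ) : Y) = 0
    have : r (s z) = 0 := by
      change ρ (s z - s ((LinearMap.range φ).mkQ (s z))) = 0
      rw [hs', sub_self, map_zero]
    rw [this, map_zero, Submodule.coe_zero, sub_zero, add_zero]

/-! ### The factorisation algebra as a Koszul extension -/

section Factor

open GradedTensorProduct

variable {k : Type u} [Field k] {Y : ℕ → Type v} [∀ n, AddCommGroup (Y n)] [∀ n, Module k (Y n)]
  {X : ℕ → Type w} [∀ n, AddCommGroup (X n)] [∀ n, Module k (X n)]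
  {Ψ : Lambda k Y →ₐ[k] Lambda k X}

variable (Ψ) in
theorem Factor.gradedCommutative : IsGradedCommutative (Factor.grade Ψ) :=
  tensor_gradedCommutative (tensor_gradedCommutative Lambda.gradedCommutative
    Lambda.gradedCommutative) Gamma.gradedCommutative

variable (Ψ) in
/-- The inclusion of `Λ coker φ`. -/
def Factor.inclCoker : Lambda k (Coker Ψ) →ₐ[k] Factor Ψ :=
  (includeLeft (baseGrade Ψ) (Gamma.grade k (SKer Ψ))).comp
    (includeRight (Lambda.grade k Y) (Lambda.grade k (Coker Ψ)))

theorem Factor.incl_mem (n : ℕ) (a : Lambda k Y) (ha : a ∈ Lambda.grade k Y n) :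
    Factor.incl Ψ a ∈ Factor.grade Ψ n :=
  includeLeft_mem n _ (includeLeft_mem n a ha)

theorem Factor.inclCoker_mem (n : ℕ) (a : Lambda k (Coker Ψ))
    (ha : a ∈ Lambda.grade k (Coker Ψ) n) : Factor.inclCoker Ψ a ∈ Factor.grade Ψ n :=
  includeLeft_mem n _ (includeRight_mem n a ha)

theorem Factor.inclGamma_mem (n : ℕ) (a : Gamma k (SKer Ψ)) (ha : a ∈ Gamma.grade k (SKer Ψ) n) :
    Factor.inclGamma Ψ a ∈ Factor.grade Ψ n :=
  includeRight_mem n a ha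

theorem Factor.subalgebra_eq_top (S : Subalgebra k (Factor Ψ))
    (hY : ∀ n y, Factor.incl Ψ (Lambda.ι k Y n y) ∈ S)
    (hZ : ∀ n z, Factor.inclCoker Ψ (Lambda.ι k (Coker Ψ) n z) ∈ S)
    (hγ : ∀ n i (x : SKer Ψ n), Factor.inclGamma Ψ (Gamma.γ k (SKer Ψ) i x) ∈ S)
    (x : Factor Ψ) : x ∈ S := by
  refine tensor_subalgebra_eq_top S (fun a => ?_) (fun c => ?_) x
  · refine tensor_subalgebra_eq_top (S.comap (includeLeft (baseGrade Ψ) (Gamma.grade k (SKer Ψ))))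
      (fun a => ?_) (fun c => ?_) a
    · change Factor.incl Ψ a ∈ S
      induction a using pres_induction with
      | hs c => rw [AlgHom.commutes]; exact S.algebraMap_mem c
      | hg a => exact hY a.1 a.2
      | hadd a b ha hb => rw [map_add]; exact add_mem ha hb
      | hmul a b ha hb => rw [map_mul]; exact mul_mem ha hb
    · change Factor.inclCoker Ψ c ∈ S
      induction c using pres_induction with
      | hs c => rw [AlgHom.commutes]; exact S.algebraMap_mem c
      | hg a => exact hZ a.1 a.2
      | hadd a b ha hb => rw [map_add]; exact add_mem ha hb
      | hmul a b ha hb => rw [map_mul]; exact mul_mem ha hb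
  · change Factor.inclGamma Ψ c ∈ S
    induction c using pres_induction with
    | hs c => rw [AlgHom.commutes]; exact S.algebraMap_mem c
    | hg a => exact hγ a.1 a.2.1 a.2.2
    | hadd a b ha hb => rw [map_add]; exact add_mem ha hb
    | hmul a b ha hb => rw [map_mul]; exact mul_mem ha hb

variable (Ψ) in
/-- The graded vector space `ker φ`. -/
abbrev Ker (n : ℕ) : Type v := LinearMap.ker (phi Ψ n)

variable (Ψ) in
/-- The Koszul extension of `ΛX` by `ker φ`. -/
abbrev KoszulKer : Type (max u v w) := Koszul k X (Ker Ψ)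

/-- The morphism from the factorisation algebra to the Koszul extension. -/
def Factor.toKoszul (i : Lambda k Y →ₐ[k] KoszulKer Ψ)
    (hi : ∀ n, ∀ a ∈ Lambda.grade k Y n, i a ∈ Koszul.grade k X (Ker Ψ) n)
    (s : ∀ n, Coker Ψ n →ₗ[k] X n) : Factor Ψ →ₐ[k] KoszulKer Ψ :=
  tensorLift (𝒞 := Koszul.grade k X (Ker Ψ)) LG.gradedCommutative
    (tensorLift (𝒞 := Koszul.grade k X (Ker Ψ)) LG.gradedCommutative i hi
      ((Koszul.inX k X (Ker Ψ)).comp (Lambda.map s))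
      fun n a ha => Koszul.inX_mem (Lambda.map_mem (Lambda.map s)
        (fun n x => by rw [Lambda.map_ι]; exact Lambda.ι_mem _ _) ha))
    (tensorLift_mem _ _ _ _ _) (LG.inR k _ _) fun n a ha => LG.inR_mem ha

section

variable (i : Lambda k Y →ₐ[k] KoszulKer Ψ)
  (hi : ∀ n, ∀ a ∈ Lambda.grade k Y n, i a ∈ Koszul.grade k X (Ker Ψ) n)
  (s : ∀ n, Coker Ψ n →ₗ[k] X n)

theorem Factor.toKoszul_incl (a : Lambda k Y) :
    Factor.toKoszul i hi s (Factor.incl Ψ a) = i a :=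
  (tensorLift_includeLeft _ _ _ _ _ _).trans (tensorLift_includeLeft _ _ _ _ _ _)

theorem Factor.toKoszul_inclCoker (a : Lambda k (Coker Ψ)) :
    Factor.toKoszul i hi s (Factor.inclCoker Ψ a) = Koszul.inX k X (Ker Ψ) (Lambda.map s a) :=
  (tensorLift_includeLeft _ _ _ _ _ _).trans (tensorLift_includeRight _ _ _ _ _ _)

theorem Factor.toKoszul_inclGamma (a : Gamma k (SKer Ψ)) :
    Factor.toKoszul i hi s (Factor.inclGamma Ψ a) = LG.inR k _ _ a :=
  tensorLift_includeRight _ _ _ _ _ _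

theorem Factor.toKoszul_mem (n : ℕ) (x : Factor Ψ) (hx : x ∈ Factor.grade Ψ n) :
    Factor.toKoszul i hi s x ∈ Koszul.grade k X (Ker Ψ) n :=
  tensorLift_mem _ _ _ _ _ n x hx

end

/-- The morphism from the Koszul extension to the factorisation algebra that is prescribed on
`X × ker φ` and is the identity on `s ker φ`. -/
theorem Factor.exists_ofKoszul (μ : ∀ n, X n × Ker Ψ n →ₗ[k] Y n) :
    ∃ β : KoszulKer Ψ →ₐ[k] Factor Ψ, (∀ n x, β (LG.ι k _ _ n x) =
        Factor.incl Ψ (Lambda.ι k Y n (μ n x)) +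
          Factor.inclCoker Ψ (Lambda.ι k _ n ((LinearMap.range (phi Ψ n)).mkQ x.1))) ∧
      ∀ n i (x : SKer Ψ n), β (LG.γ k _ i x) = Factor.inclGamma Ψ (Gamma.γ k _ i x) := by
  let f : ∀ n, X n × Ker Ψ n →ₗ[k] Factor Ψ := fun n =>
    (Factor.incl Ψ).toLinearMap.comp ((Lambda.ι k Y n).comp (μ n)) +
      (Factor.inclCoker Ψ).toLinearMap.comp ((Lambda.ι k _ n).comp
        ((LinearMap.range (phi Ψ n)).mkQ.comp (LinearMap.fst k _ _)))
  have hf : ∀ n x, f n x ∈ Factor.grade Ψ n := fun n x =>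
    add_mem (Factor.incl_mem _ _ (Lambda.ι_mem _ _)) (Factor.inclCoker_mem _ _ (Lambda.ι_mem _ _))
  let F : Lambda k (fun n => X n × Ker Ψ n) →ₐ[k] Factor Ψ :=
    Lambda.lift f fun m n x y => Factor.gradedCommutative Ψ m n _ (hf m x) _ (hf n y)
  have hF : ∀ n x, F (Lambda.ι k _ n x) = f n x := fun n x => Lambda.lift_ι _ _ _ _
  refine ⟨LG.lift F (Factor.inclGamma Ψ) fun m x n i y => ?_, fun n x => ?_, fun n i x => ?_⟩
  · refine Factor.gradedCommutative Ψ m (i * n) _ ?_ _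
      (Factor.inclGamma_mem _ _ (Gamma.γ_mem (W := SKer Ψ) i y))
    rw [hF]
    exact hf m x
  · rw [LG.lift_ι, hF]
    rfl
  · rw [LG.lift_γ]

/-- Let `β` go back by the linear isomorphism on generators. The composite `θ β` with `θ` the given
morphism is the identity modulo smaller weight, as the linear part of `i` is `(φ, κ)`; hence it is
bijective. Since `β` reaches all generators it is surjective, and then `θ` is bijective. -/
theorem Factor.toKoszul_bijective (hY : ∀ n < 2, Subsingleton (Y n))
    (hX : ∀ n < 2, Subsingleton (X n)) (i : Lambda k Y →ₐ[k] KoszulKer Ψ)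
    (hi : ∀ n, ∀ a ∈ Lambda.grade k Y n, i a ∈ Koszul.grade k X (Ker Ψ) n)
    (s : ∀ n, Coker Ψ n →ₗ[k] X n) (κ : ∀ n, Y n →ₗ[k] Ker Ψ n)
    (hlin : ∀ n y, LG.linearPart n (i (Lambda.ι k Y n y)) = (phi Ψ n y, κ n y))
    (μ : ∀ n, X n × Ker Ψ n →ₗ[k] Y n)
    (hs : ∀ n z, (LinearMap.range (phi Ψ n)).mkQ (s n z) = z)
    (h1 : ∀ n x, phi Ψ n (μ n x) + s n ((LinearMap.range (phi Ψ n)).mkQ x.1) = x.1)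
    (h2 : ∀ n x, κ n (μ n x) = x.2) (h3 : ∀ n y, μ n (phi Ψ n y, κ n y) = y)
    (h4 : ∀ n z, μ n (s n z, 0) = 0) : Function.Bijective (Factor.toKoszul i hi s) := by
  have hV : ∀ n < 2, Subsingleton (X n × Ker Ψ n) := fun n hn => by
    have := hX n hn
    have := hY n hn
    infer_instance
  have hW0 : Subsingleton (SKer Ψ 0) := by
    have := hY 1 one_lt_two
    infer_instance
  obtain ⟨β, hβι, hβγ⟩ := Factor.exists_ofKoszul (Ψ := Ψ) μ
  have hcomp : Function.Bijective ((Factor.toKoszul i hi s).comp β) := by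
    refine LG.bijective_of_filt _ (fun n j x => ?_) fun n x => ?_
    · rw [AlgHom.comp_apply, hβγ, Factor.toKoszul_inclGamma, LG.inR_γ]
    · by_cases hn : n < 2
      · have := hV n hn
        rw [Subsingleton.elim x 0, map_zero, map_zero, sub_zero]
        exact zero_mem _
      -- For `n ≥ 2` the levels `n - 2 + 1` and `n - 1` agree, so the error made by replacing `i (μ
      -- x)` by its linear part is exactly of the allowed weight.
      · have h5 := LG.sub_linearPart_mem_filt (hV 0 two_pos) (hV 1 one_lt_two) hW0
          (hi n _ (Lambda.ι_mem n (μ n x)))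
        rw [show n - 2 + 1 = n - 1 by omega, hlin, h2] at h5
        rw [AlgHom.comp_apply, hβι, map_add, Factor.toKoszul_incl, Factor.toKoszul_inclCoker,
          Lambda.map_ι, Koszul.inX_ι]
        have h6 : LG.ι k (fun n => X n × Ker Ψ n) (fun n => Ker Ψ (n + 1)) n x =
            LG.ι k _ _ n (phi Ψ n (μ n x), x.2) +
              LG.ι k _ _ n (s n ((LinearMap.range (phi Ψ n)).mkQ x.1), 0) := by
          rw [← map_add, Prod.mk_add_mk, add_zero, h1]
        rw [h6, add_sub_add_right_eq_sub]
        exact h5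
  have hsurj : Function.Surjective β := by
    intro x
    refine Factor.subalgebra_eq_top β.range (fun n y => ?_) (fun n z => ?_) (fun n j x => ?_) x
    · refine ⟨LG.ι k _ _ n (phi Ψ n y, κ n y), (hβι _ _).trans ?_⟩
      have : (LinearMap.range (phi Ψ n)).mkQ (phi Ψ n y) = 0 := by
        rw [Submodule.mkQ_apply, Submodule.Quotient.mk_eq_zero]
        exact ⟨y, rfl⟩
      rw [h3, this, map_zero, map_zero, add_zero]
    · refine ⟨LG.ι k _ _ n (s n z, 0), (hβι _ _).trans ?_⟩
      rw [h4, hs, map_zero, map_zero, zero_add]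
    · exact ⟨_, hβγ n j x⟩
  exact ⟨fun x y hxy => by
    obtain ⟨a, rfl⟩ := hsurj x
    obtain ⟨b, rfl⟩ := hsurj y
    rw [hcomp.1 hxy], fun x => by
    obtain ⟨a, ha⟩ := hcomp.2 x
    exact ⟨β a, ha⟩⟩

end Factor

/-! ### Triangular changes of basis -/

section Triangular

variable {A : Type v} [Ring A] {M : Type w} [AddCommGroup M] [Module A M] {ι : Type u}

variable (A) in
/-- The span of the vectors of degree less than `n`. -/
def degSpan (b : ι → M) (deg : ι → ℕ) (n : ℕ) : Submodule A M :=
  Submodule.span A (b '' {j | deg j < n})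

theorem degSpan_mono (b : ι → M) (deg : ι → ℕ) {m n : ℕ} (h : m ≤ n) :
    degSpan A b deg m ≤ degSpan A b deg n :=
  Submodule.span_mono (Set.image_mono fun _ hj => lt_of_lt_of_le hj h)

theorem mem_degSpan (b : ι → M) (deg : ι → ℕ) {n : ℕ} {j : ι} (h : deg j < n) :
    b j ∈ degSpan A b deg n :=
  Submodule.subset_span ⟨j, h, rfl⟩

theorem degSpan_le {b : ι → M} {deg : ι → ℕ} {n : ℕ} {S : Submodule A M}
    (h : ∀ j, deg j < n → b j ∈ S) : degSpan A b deg n ≤ S := by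
  refine Submodule.span_le.mpr ?_
  rintro _ ⟨j, hj, rfl⟩
  exact h j hj

theorem degSpan_zero (b : ι → M) (deg : ι → ℕ) : degSpan A b deg 0 = ⊥ :=
  le_bot_iff.mp (degSpan_le fun _ hj => absurd hj (Nat.not_lt_zero _))

theorem exists_mem_degSpan (b : Module.Basis ι A M) (deg : ι → ℕ) (x : M) :
    ∃ n, x ∈ degSpan A b deg n := by
  have hx : x ∈ Submodule.span A (Set.range b) := by rw [b.span_eq]; trivial
  induction hx using Submodule.span_induction with
  | mem x h =>
    obtain ⟨j, rfl⟩ := h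
    exact ⟨_, mem_degSpan b deg (Nat.lt_succ_self (deg j))⟩
  | zero => exact ⟨0, zero_mem _⟩
  | add x y _ _ hx hy =>
    obtain ⟨m, hm⟩ := hx
    obtain ⟨n, hn⟩ := hy
    exact ⟨max m n, add_mem (degSpan_mono _ _ (le_max_left _ _) hm)
      (degSpan_mono _ _ (le_max_right _ _) hn)⟩
  | smul a x _ hx =>
    obtain ⟨n, hn⟩ := hx
    exact ⟨n, Submodule.smul_mem _ _ hn⟩

/-- Induction on the degree: `b j = e j - (e j - b j)`, and the bracket is in the span of lower
`b`'s. -/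
theorem degSpan_le_of_triangular {b e : ι → M} {deg : ι → ℕ}
    (h : ∀ j, e j - b j ∈ degSpan A b deg (deg j)) (n : ℕ) :
    degSpan A b deg n ≤ degSpan A e deg n := by
  induction n with
  | zero => rw [degSpan_zero]; exact bot_le
  | succ n ih =>
    refine degSpan_le fun j hj => ?_
    rw [← sub_sub_cancel (e j) (b j)]
    exact sub_mem (mem_degSpan e deg hj)
      (degSpan_mono _ _ n.le_succ (ih (degSpan_mono _ _ (Nat.lt_succ_iff.mp hj) (h j))))

/-- The endomorphism `b j ↦ e j` is the identity modulo lower degrees, so an element of its kernel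
descends through the filtration to zero. -/
theorem exists_basis_of_triangular (b : Module.Basis ι A M) {e : ι → M} {deg : ι → ℕ}
    (h : ∀ j, e j - b j ∈ degSpan A b deg (deg j)) : ∃ e' : Module.Basis ι A M, ⇑e' = e := by
  let Φ : M →ₗ[A] M := b.constr ℕ e
  have hΦ : ∀ j, Φ (b j) = e j := fun j => b.constr_basis ℕ e j
  have hsub : ∀ n, ∀ x ∈ degSpan A b deg (n + 1), Φ x - x ∈ degSpan A b deg n := by
    intro n x hx
    refine degSpan_le (S := (degSpan A b deg n).comap (Φ - LinearMap.id)) (fun j hj => ?_) hx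
    change Φ (b j) - b j ∈ degSpan A b deg n
    rw [hΦ]
    exact degSpan_mono _ _ (Nat.lt_succ_iff.mp hj) (h j)
  have hinj : LinearMap.ker Φ = ⊥ := by
    refine LinearMap.ker_eq_bot'.mpr fun x hx => ?_
    obtain ⟨n, hn⟩ := exists_mem_degSpan b deg x
    induction n with
    | zero => rwa [degSpan_zero, Submodule.mem_bot] at hn
    | succ n ih =>
      have := hsub n x hn
      rw [hx, zero_sub] at this
      exact ih ((Submodule.neg_mem_iff _).mp this)
  have hli : LinearIndependent A e := by
    have := b.linearIndependent.map' Φ hinj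
    rwa [show Φ ∘ b = e from funext hΦ] at this
  refine ⟨Module.Basis.mk hli fun x _ => ?_, Module.Basis.coe_mk _ _⟩
  obtain ⟨n, hn⟩ := exists_mem_degSpan b deg x
  exact Submodule.span_mono (Set.image_subset_range _ _) (degSpan_le_of_triangular h n hn)

end Triangular

/-! ### A criterion for semifreeness -/

section Semifree

variable {k : Type u} [Field k] {A : Type v} [Ring A] [Algebra k A] {P : Type w} [Ring P]
  [Algebra k P] {𝒢 : ℕ → Submodule k P} {D : P →ₗ[k] P} {i : A →ₐ[k] P} [inst : Module A P]
  {ι : Type u'}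

/-- The filtration has as its `n`-th term the span of the basis elements of stage at most `n`. The
condition `hst` makes each of them a cycle modulo earlier stages. -/
theorem isSemifree_of_basis (hinst : inst = Module.compHom P i.toRingHom)
    (e : Module.Basis ι A P) (st : ι → ℕ) (hdeg : ∀ j, ∃ m, e j ∈ 𝒢 m)
    (hD : ∀ (a : A) (x : P), ∃ a₁ a₂ : A, D (a • x) = a₁ • x + a₂ • D x)
    (hst : ∀ j, D (e j) ∈ degSpan A e st (st j)) : IsSemifree 𝒢 D i := by
  subst hinst
  let _ := Module.compHom P i.toRingHom
  have hF' : ∀ n, (if n = 0 then ⊥ else degSpan A e st (n - 1 + 1)) = degSpan A e st n := by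
    intro n
    split_ifs with hn
    · rw [hn, degSpan_zero]
    · rw [Nat.sub_add_cancel (Nat.one_le_iff_ne_zero.mpr hn)]
  refine ⟨fun n => degSpan A e st (n + 1), fun m n h => degSpan_mono _ _ (by omega), fun z => ?_,
    fun n z hz => ?_, fun n => e '' {j | st j = n}, fun n => ?_⟩
  · obtain ⟨n, hn⟩ := exists_mem_degSpan e st z
    exact ⟨n, degSpan_mono _ _ n.le_succ hn⟩
  · induction hz using Submodule.span_induction with
    | mem x h =>
      obtain ⟨j, hj, rfl⟩ := h
      exact degSpan_mono _ _ hj.le (hst j)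
    | zero => rw [map_zero]; exact zero_mem _
    | add x y _ _ hx hy => rw [map_add]; exact add_mem hx hy
    | smul a x hx h =>
      obtain ⟨a₁, a₂, h₁⟩ := hD a x
      rw [h₁]
      exact add_mem (Submodule.smul_mem _ _ hx) (Submodule.smul_mem _ _ h)
  · intro F'
    have hF : F' = degSpan A e st n := hF' n
    clear_value F'
    subst hF
    refine ⟨?_, ?_, ?_⟩
    · rintro _ ⟨j, rfl, rfl⟩
      exact ⟨hdeg j, hst j⟩
    · classical
      -- Independence modulo earlier stages is tested by the projection onto stage `n`, which
      -- factors through the quotient.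
      let g : P →ₗ[A] P := e.constr ℕ fun j => if st j = n then e j else 0
      have hg : degSpan A e st n ≤ LinearMap.ker g := degSpan_le fun j hj => by
        rw [LinearMap.mem_ker, e.constr_basis, if_neg hj.ne]
      refine LinearIndependent.of_comp ((degSpan A e st n).liftQ g hg) ?_
      have h1 : LinearIndependent A fun x : e '' {j | st j = n} => (x : P) :=
        e.linearIndependent.linearIndepOn_id.mono (Set.image_subset_range _ _)
      convert h1 using 1
      · funext ⟨_, j, hj, rfl⟩
        refine (Submodule.liftQ_apply _ _ _).trans ?_
        exact (e.constr_basis ℕ _ j).trans (if_pos hj)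
      · rfl
    · change degSpan A e st (n + 1) = degSpan A e st n ⊔ Submodule.span A (e '' {j | st j = n})
      rw [degSpan, degSpan, ← Submodule.span_union, ← Set.image_union]
      congr 2
      ext j
      simp only [Set.mem_ofPred_eq, Set.mem_union]
      omega

end Semifree

/-! ### Semifreeness of a tensor product with a connected algebra -/

section Semifree

variable {k : Type u} [Field k]

/-- In each degree a basis of the boundaries is extended to a basis of the whole piece; `T` marks
the boundaries and `u` gives homogeneous primitives. -/
theorem exists_graded_basis {B : Type v} [Ring B] [Algebra k B] {ℬ : ℕ → Submodule k B}
    [GradedAlgebra ℬ] {δ : B →ₗ[k] B} (hδ : ∀ n, ∀ x ∈ ℬ n, δ x ∈ ℬ (n + 1)) :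
    ∃ (ι : Type v) (b : Module.Basis ι k B) (deg : ι → ℕ) (T : Set ι) (u : ι → B),
      (∀ t, b t ∈ ℬ (deg t)) ∧ (∀ n, ℬ n ≤ Submodule.span k (b '' {t | deg t = n})) ∧
      (∀ t ∈ T, ∃ m, deg t = m + 1 ∧ u t ∈ ℬ m ∧ δ (u t) = b t) ∧
      ∀ n, ∀ x ∈ ℬ n, δ x ∈ Submodule.span k (b '' {t | t ∈ T ∧ deg t = n + 1}) := by
  obtain ⟨σ, hσ⟩ := exists_quasi_inverse δ
  let R : ∀ m, Submodule k (ℬ m) := fun m => (LinearMap.range δ).comap (ℬ m).subtype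
  have hE : ∀ m, ∃ E, IsCompl (R m) E := fun m => Submodule.exists_isCompl (R m)
  choose E hE using hE
  let bR := fun m => Module.Basis.ofVectorSpace k (R m)
  let bE := fun m => Module.Basis.ofVectorSpace k (E m)
  let v := fun m => ((bR m).prod (bE m)).map (Submodule.prodEquivOfIsCompl (R m) (E m) (hE m))
  have hv : ∀ m r, (v m (Sum.inl r) : B) = bR m r := fun m r => by
    simp only [v, Module.Basis.map_apply, Module.Basis.prod_apply, Sum.elim_inl,
      Function.comp_apply, LinearMap.inl_apply, Submodule.coe_prodEquivOfIsCompl',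
      Submodule.coe_zero, add_zero]
  let b := (DirectSum.Decomposition.isInternal ℬ).collectedBasis v
  have hb : ∀ m x, b ⟨m, x⟩ = v m x := fun m x => by
    simp only [b, DirectSum.IsInternal.collectedBasis_coe]
  have hσ' : ∀ m (x : R m), δ (σ x) = x := fun m x => by
    obtain ⟨y, hy⟩ := x.2
    have hy' : δ y = x := hy
    rw [← hy', hσ]
  -- The primitive is the component of `σ(b)` in degree one less. Truncation at degree `0` is
  -- harmless, since there are no nonzero boundaries there.
  refine ⟨_, b, Sigma.fst, {t | t.2.isLeft}, fun t =>
    Sum.elim (fun r => (DirectSum.decompose ℬ (σ (bR t.1 r)) (t.1 - 1) : B)) (fun _ => 0) t.2,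
    fun t => ?_, fun n x hx => ?_, ?_, fun n x hx => ?_⟩
  · rw [hb]
    exact SetLike.coe_mem _
  · suffices h : ∀ y : ℬ n, (y : B) ∈ Submodule.span k (b '' {t | t.1 = n}) from h ⟨x, hx⟩
    intro y
    induction (v n).mem_span y using Submodule.span_induction with
    | mem y h =>
      obtain ⟨t, rfl⟩ := h
      exact Submodule.subset_span ⟨⟨n, t⟩, rfl, hb n t⟩
    | zero => exact zero_mem _
    | add y z _ _ hy hz => exact add_mem hy hz
    | smul c y _ hy => exact Submodule.smul_mem _ c hy
  · rintro ⟨m, r | s⟩ ht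
    · have hmem : ((bR m r : ℬ m) : B) ∈ ℬ m := SetLike.coe_mem _
      rcases m with _ | m
      · exfalso
        refine (bR 0).ne_zero r (Subtype.ext (Subtype.ext ?_))
        have h1 : ∀ y, (DirectSum.decompose ℬ (δ y) 0 : B) = 0 := fun y => by
          induction y using homogeneous_induction ℬ with
          | h n y hy => exact DirectSum.decompose_of_mem_ne ℬ (hδ n y hy) (by omega)
          | hadd y z hy hz =>
            rw [map_add, DirectSum.decompose_add, DirectSum.add_apply, Submodule.coe_add, hy, hz,
              add_zero]
        have h2 := h1 (σ (bR 0 r))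
        rw [hσ', DirectSum.decompose_of_mem_same ℬ hmem] at h2
        exact h2
      · refine ⟨m, rfl, SetLike.coe_mem _, ?_⟩
        change δ (DirectSum.decompose ℬ (σ (bR (m + 1) r)) m) = _
        rw [map_decompose hδ, hσ', DirectSum.decompose_of_mem_same ℬ hmem, hb, hv]
    · exact absurd ht (by simp)
  · suffices h : ∀ y : R (n + 1),
        (y : B) ∈ Submodule.span k (b '' {t | t ∈ {t | t.2.isLeft = true} ∧ t.1 = n + 1}) from
      h ⟨⟨δ x, hδ n x hx⟩, x, rfl⟩
    intro y
    induction (bR (n + 1)).mem_span y using Submodule.span_induction with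
    | mem y h =>
      obtain ⟨t, rfl⟩ := h
      exact Submodule.subset_span ⟨⟨n + 1, Sum.inl t⟩, ⟨rfl, rfl⟩, (hb _ _).trans (hv _ _)⟩
    | zero => exact zero_mem _
    | add y z _ _ hy hz => exact add_mem hy hz
    | smul c y _ hy => exact Submodule.smul_mem _ c hy

/-- A cochain algebra that is free, as a module over a simply connected cochain algebra, on a
non-negatively graded vector space is semifree. -/
theorem isSemifree_of_tensor {A : Type v} [Ring A] [Algebra k A] {B : Type w} [Ring B]
    [Algebra k B] {P : Type u'} [Ring P] [Algebra k P] {𝒜 : ℕ → Submodule k A}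
    {ℬ : ℕ → Submodule k B} [GradedAlgebra ℬ] {𝒢 : ℕ → Submodule k P} {D : P →ₗ[k] P}
    {i : A →ₐ[k] P} (m : A ⊗[k] B ≃ₗ[k] P)
    (hm : ∀ a b, m (a ⊗ₜ b) = i a * m (1 ⊗ₜ b))
    (hgen : ∀ n, 𝒢 n ≤ Submodule.span k
      {x | ∃ p q, p + q = n ∧ ∃ a ∈ 𝒜 p, ∃ b ∈ ℬ q, x = m (a ⊗ₜ b)})
    (hmem : ∀ n, ∀ b ∈ ℬ n, m (1 ⊗ₜ b) ∈ 𝒢 n)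
    (h0 : ∀ a ∈ 𝒜 0, ∃ c, a = algebraMap k A c) (h1 : ∀ a ∈ 𝒜 1, a = 0)
    (ε : A →ₐ[k] k) (hε : ∀ n, 0 < n → ∀ a ∈ 𝒜 n, ε a = 0)
    (hD : ∀ n, ∀ x ∈ 𝒢 n, D x ∈ 𝒢 (n + 1)) (hsq : ∀ x, D (D x) = 0)
    (hleib : ∀ a x, ∃ a₁ a₂, D (i a * x) = i a₁ * x + i a₂ * D x) : IsSemifree 𝒢 D i := by
  classical
  let _ : Module A P := Module.compHom P i.toRingHom
  have hsmul : ∀ (a : A) (x : P), a • x = i a * x := fun _ _ => rfl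
  have _ : IsScalarTower k A P := IsScalarTower.of_algebraMap_smul fun c x => by
    rw [hsmul, AlgHom.commutes, Algebra.smul_def]
  let j : B →ₗ[k] P := m.toLinearMap.comp (TensorProduct.mk k A B 1)
  have hj : ∀ n, ∀ b ∈ ℬ n, j b ∈ 𝒢 n := hmem
  have hmj : ∀ a b, m (a ⊗ₜ b) = a • j b := hm
  -- Reduction along the augmentation of `A`. The composite of `j`, `D` and `π` is the differential
  -- induced on `B`, to which the basis is adapted.
  let π : P →ₗ[k] B := (TensorProduct.lid k B).toLinearMap.comp
    ((TensorProduct.map ε.toLinearMap LinearMap.id).comp m.symm.toLinearMap)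
  have hπ : ∀ a b, π (m (a ⊗ₜ b)) = ε a • b := fun a b => by
    simp [π]
  have hπ_mem : ∀ n, ∀ x ∈ 𝒢 n, π x ∈ ℬ n := by
    intro n x hx
    refine (Submodule.span_le (p := (ℬ n).comap π)).mpr ?_ (hgen n hx)
    rintro _ ⟨p, q, rfl, a, ha, b, hb, rfl⟩
    change π (m (a ⊗ₜ b)) ∈ ℬ (p + q)
    rw [hπ]
    rcases Nat.eq_zero_or_pos p with rfl | hp
    · rw [zero_add]
      exact Submodule.smul_mem _ _ hb
    · rw [hε p hp a ha, zero_smul]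
      exact zero_mem _
  obtain ⟨ι, b, deg, T, u, hbdeg, hbspan, hT, hδ⟩ :=
    exists_graded_basis (ℬ := ℬ) (δ := π.comp (D.comp j)) fun n x hx =>
      hπ_mem _ _ (hD _ _ (hj _ _ hx))
  let mA : A ⊗[k] B ≃ₗ[A] P :=
    { m with
      map_smul' := fun a x => by
        change m (a • x) = i a * m x
        induction x using TensorProduct.induction_on with
        | zero => rw [smul_zero, map_zero, mul_zero]
        | tmul a' b' =>
          rw [TensorProduct.smul_tmul', smul_eq_mul, hm, hm a', map_mul, mul_assoc]
        | add x y hx hy => rw [smul_add, map_add, hx, hy, map_add, mul_add] }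
  let b₀ : Module.Basis ι A P := (Algebra.TensorProduct.basis A b).map mA
  have hb₀ : ∀ t, b₀ t = j (b t) := fun t => by
    simp only [b₀, Module.Basis.map_apply, Algebra.TensorProduct.basis_apply]
    rfl
  have hlow : ∀ q n, q < n → ∀ x ∈ ℬ q, j x ∈ degSpan A b₀ deg n := by
    intro q n hqn x hx
    refine (Submodule.span_le (p := ((degSpan A b₀ deg n).restrictScalars k).comap j)).mpr ?_
      (hbspan q hx)
    rintro _ ⟨t, rfl, rfl⟩
    change j (b t) ∈ degSpan A b₀ deg n
    rw [← hb₀]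
    exact mem_degSpan _ _ hqn
  have hkey : ∀ n, ∀ x ∈ 𝒢 (n + 1), x - j (π x) ∈ degSpan A b₀ deg n := by
    intro n x hx
    refine (Submodule.span_le (p := ((degSpan A b₀ deg n).restrictScalars k).comap
      (LinearMap.id - j.comp π))).mpr ?_ (hgen _ hx)
    rintro _ ⟨p, q, hpq, a, ha, b', hb', rfl⟩
    change m (a ⊗ₜ b') - j (π (m (a ⊗ₜ b'))) ∈ degSpan A b₀ deg n
    rw [hπ, hmj]
    -- Modulo `j π`, only coefficients of degree at least `2` remain: those of degree `0` are
    -- scalars and those of degree `1` vanish. The factor in `B` then has degree less than `n`.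
    rcases p with _ | _ | p
    · obtain ⟨c, rfl⟩ := h0 a ha
      rw [AlgHom.commutes, algebraMap_smul, map_smul, Algebra.algebraMap_self, RingHom.id_apply,
        sub_self]
      exact zero_mem _
    · rw [h1 a ha, map_zero, zero_smul, zero_smul, map_zero, sub_zero]
      exact zero_mem _
    · rw [hε _ (Nat.succ_pos _) a ha, zero_smul, map_zero, sub_zero]
      exact Submodule.smul_mem _ _ (hlow q n (by omega) b' hb')
  let e : ι → P := fun t => if t ∈ T then D (j (u t)) else j (b t)
  -- A boundary of degree `n + 1` gets stage `2 n`, just below the stage `2 n + 1` of the other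
  -- basis elements of degree `n`, whose differentials may involve it.
  let st : ι → ℕ := fun t => if t ∈ T then 2 * deg t - 2 else 2 * deg t + 1
  have htri : ∀ t, e t - b₀ t ∈ degSpan A b₀ deg (deg t) := by
    intro t
    rw [hb₀]
    simp only [e]
    split_ifs with ht
    · obtain ⟨n, hn, hu, hδu⟩ := hT t ht
      have := hkey n _ (hD _ _ (hj _ _ hu))
      rw [← hδu, hn]
      exact degSpan_mono _ _ n.le_succ this
    · rw [sub_self]
      exact zero_mem _
  obtain ⟨e', he'⟩ := exists_basis_of_triangular b₀ htri
  -- Basis elements of degree less than `n` have stage at most `2 n - 1`.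
  have hlow' : ∀ n, degSpan A b₀ deg n ≤ degSpan A e st (2 * n + 1) := fun n =>
    (degSpan_le_of_triangular htri n).trans (degSpan_le fun t ht => mem_degSpan _ _ (by
      simp only [st]
      split_ifs <;> omega))
  have hlift : ∀ n, ∀ y ∈ Submodule.span k (b '' {t | t ∈ T ∧ deg t = n + 1}),
      ∃ x ∈ ℬ n, π (D (j x)) = y ∧ D (j x) ∈ degSpan A e st (2 * n + 1) := by
    intro n y hy
    induction hy using Submodule.span_induction with
    | mem y h =>
      obtain ⟨t, ⟨ht, hn⟩, rfl⟩ := h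
      obtain ⟨n', hn', hu, hδu⟩ := hT t ht
      obtain rfl : n' = n := by omega
      refine ⟨u t, hu, hδu, ?_⟩
      have h2 : e t = D (j (u t)) := if_pos ht
      have h3 : st t = 2 * deg t - 2 := if_pos ht
      rw [← h2]
      exact mem_degSpan _ _ (by omega)
    | zero => exact ⟨0, zero_mem _, by simp only [map_zero], by
        rw [map_zero, map_zero]; exact zero_mem _⟩
    | add y y' _ _ h h' =>
      obtain ⟨x, hx, hxy, hxs⟩ := h
      obtain ⟨x', hx', hxy', hxs'⟩ := h'
      exact ⟨x + x', add_mem hx hx', by simp only [map_add, hxy, hxy'], by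
        rw [map_add, map_add]; exact add_mem hxs hxs'⟩
    | smul c y _ h =>
      obtain ⟨x, hx, hxy, hxs⟩ := h
      exact ⟨c • x, Submodule.smul_mem _ c hx, by simp only [map_smul, hxy], by
        rw [map_smul, map_smul]; exact Submodule.smul_of_tower_mem _ c hxs⟩
  refine isSemifree_of_basis rfl e' st (fun t => ?_) hleib fun t => ?_
  · rw [he']
    by_cases ht : t ∈ T
    · obtain ⟨n, hn, hu, -⟩ := hT t ht
      exact ⟨n + 1, by simp only [e, if_pos ht]; exact hD _ _ (hj _ _ hu)⟩
    · exact ⟨deg t, by simp only [e, if_neg ht]; exact hj _ _ (hbdeg t)⟩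
  · rw [he']
    by_cases ht : t ∈ T
    · simp only [e, if_pos ht, hsq]
      exact zero_mem _
    · have h2 : e t = j (b t) := if_neg ht
      have h3 : st t = 2 * deg t + 1 := if_neg ht
      rw [h2, h3]
      -- Subtract `x`, which has the same induced boundary as `b t` and whose `D` is a combination
      -- of the new cycles. The differential of the difference then reduces to zero under `π`, so
      -- `hkey` puts it in lower degrees.
      obtain ⟨x, hx, hxδ, hxs⟩ := hlift (deg t) _ (hδ _ _ (hbdeg t))
      have h4 := hkey _ _ (hD _ _ (hj _ _ (sub_mem (hbdeg t) hx)))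
      have h5 : π (D (j (b t - x))) = 0 := by
        rw [map_sub, map_sub, map_sub, hxδ]
        exact sub_self _
      rw [h5, map_zero, sub_zero] at h4
      have h6 := add_mem (hlow' _ h4) hxs
      rwa [← map_add, ← map_add, sub_add_cancel] at h6

end Semifree

/-! ### Elements of low degree -/

section LowDegree

variable {k : Type u} [Field k] {V : ℕ → Type v} [∀ n, AddCommGroup (V n)] [∀ n, Module k (V n)]

theorem Lambda.word_of_degree_lt_two (hV : ∀ n < 2, Subsingleton (V n)) (l : List (Σ n, V n))
    (hl : (l.map Sigma.fst).sum < 2) (hl' : l ≠ []) :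
    (l.map (presGen (LambdaRel k V))).prod = 0 := by
  obtain ⟨a, ha⟩ := List.exists_mem_of_ne_nil l hl'
  refine List.prod_eq_zero (List.mem_map.mpr ⟨a, ha, ?_⟩)
  have := hV a.1 ((List.le_sum_of_mem (List.mem_map_of_mem ha)).trans_lt hl)
  change Lambda.ι k V a.1 a.2 = 0
  rw [Subsingleton.elim a.2 0, map_zero]

theorem Lambda.eq_algebraMap_of_mem_zero (hV : ∀ n < 2, Subsingleton (V n)) {a : Lambda k V}
    (ha : a ∈ Lambda.grade k V 0) : ∃ c, a = algebraMap k _ c := by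
  rw [Lambda.grade, presGrade_eq_span] at ha
  induction ha using Submodule.span_induction with
  | mem x h =>
    obtain ⟨l, hl, rfl⟩ := h
    by_cases hl' : l = []
    · exact ⟨1, by rw [hl', map_one, List.map_nil, List.prod_nil]⟩
    · exact ⟨0, by rw [map_zero, Lambda.word_of_degree_lt_two hV l (hl.trans_lt two_pos) hl']⟩
  | zero => exact ⟨0, by rw [map_zero]⟩
  | add x y _ _ hx hy =>
    obtain ⟨c, rfl⟩ := hx
    obtain ⟨c', rfl⟩ := hy
    exact ⟨c + c', by rw [map_add]⟩
  | smul r x _ hx =>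
    obtain ⟨c, rfl⟩ := hx
    exact ⟨r * c, by rw [map_mul, Algebra.smul_def]⟩

theorem Lambda.eq_zero_of_mem_one (hV : ∀ n < 2, Subsingleton (V n)) {a : Lambda k V}
    (ha : a ∈ Lambda.grade k V 1) : a = 0 := by
  rw [Lambda.grade, presGrade_eq_span] at ha
  induction ha using Submodule.span_induction with
  | mem x h =>
    obtain ⟨l, hl, rfl⟩ := h
    refine Lambda.word_of_degree_lt_two hV l (hl.trans_lt one_lt_two) fun hl' => ?_
    simp [hl'] at hl
  | zero => rfl
  | add x y _ _ hx hy => rw [hx, hy, add_zero]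
  | smul r x _ hx => rw [hx, smul_zero]

end LowDegree

/-! ### Inclusions into graded tensor products. -/

section Injective

open GradedTensorProduct

variable {k : Type u} [Field k] {A : Type v} {B : Type w} [Ring A] [Ring B] [Algebra k A]
  [Algebra k B] {𝒜 : ℕ → Submodule k A} {ℬ : ℕ → Submodule k B} [GradedAlgebra 𝒜]
  [GradedAlgebra ℬ]

/-- An augmentation of the right factor gives the retraction `id ⊗ ε`. -/
theorem includeLeft_injective (ε : B →ₐ[k] k) : Function.Injective (includeLeft 𝒜 ℬ) := by
  let r : 𝒜 ᵍ⊗[k] ℬ →ₗ[k] A := ((TensorProduct.rid k A).toLinearMap.comp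
    (TensorProduct.map LinearMap.id ε.toLinearMap)).comp (of k 𝒜 ℬ).symm.toLinearMap
  refine Function.LeftInverse.injective (g := r) fun a => ?_
  change TensorProduct.rid k A (a ⊗ₜ ε 1) = a
  rw [map_one, TensorProduct.rid_tmul, one_smul]

theorem includeLeft_mul_tmul (a a' : A) (b : B) :
    includeLeft 𝒜 ℬ a * (a' ᵍ⊗ₜ[k] b) = (a * a') ᵍ⊗ₜ[k] b := by
  rw [← includeLeft_mul_includeRight, ← includeLeft_mul_includeRight, ← mul_assoc, ← map_mul]

theorem tensor_induction {p : 𝒜 ᵍ⊗[k] ℬ → Prop} (h0 : p 0) (htmul : ∀ a b, p (a ᵍ⊗ₜ[k] b))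
    (hadd : ∀ x y, p x → p y → p (x + y)) (x : 𝒜 ᵍ⊗[k] ℬ) : p x :=
  TensorProduct.induction_on x h0 htmul hadd

theorem tensorAug_includeLeft (ε : A →ₐ[k] k) (ε' : B →ₐ[k] k)
    (hε : ∀ n, 0 < n → ∀ a ∈ 𝒜 n, ε a = 0) (a : A) :
    tensorAug (ℬ := ℬ) ε ε' hε (includeLeft 𝒜 ℬ a) = ε a := by
  change ε a * ε' 1 = ε a
  rw [map_one, mul_one]

end Injective

/-! ### Augmentation and semifreeness of the factorisation algebra. -/

section Factor

open GradedTensorProduct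

variable {k : Type u} [Field k] {Y : ℕ → Type v} [∀ n, AddCommGroup (Y n)] [∀ n, Module k (Y n)]
  {X : ℕ → Type w} [∀ n, AddCommGroup (X n)] [∀ n, Module k (X n)]
  {Ψ : Lambda k Y →ₐ[k] Lambda k X}

theorem Factor.incl_injective : Function.Injective (Factor.incl Ψ) :=
  (includeLeft_injective (Gamma.aug k (SKer Ψ))).comp
    (includeLeft_injective (Lambda.aug k (Coker Ψ)))

theorem Factor.aug_comp_incl : (Factor.aug Ψ).comp (Factor.incl Ψ) = Lambda.aug k Y :=
  AlgHom.ext fun a => by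
    rw [AlgHom.comp_apply, Factor.aug, Factor.incl, AlgHom.comp_apply, tensorAug_includeLeft,
      tensorAug_includeLeft]

theorem Factor.aug_of_pos (n : ℕ) (hn : 0 < n) (x : Factor Ψ) (hx : x ∈ Factor.grade Ψ n) :
    Factor.aug Ψ x = 0 :=
  tensorAug_of_pos _ _ _ (fun _ hn _ hb => Gamma.aug_of_pos k (SKer Ψ) hn hb) n hn x hx

/-- The differential lands in positive degrees, where the augmentation vanishes. -/
theorem Factor.aug_map {D : Factor Ψ →ₗ[k] Factor Ψ}
    (hD : IsGradedDerivation (Factor.grade Ψ) D) (z : Factor Ψ) : Factor.aug Ψ (D z) = 0 := by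
  induction z using homogeneous_induction (Factor.grade Ψ) with
  | h n z hz => exact Factor.aug_of_pos _ n.succ_pos _ (hD.map_mem n z hz)
  | hadd x y hx hy => rw [map_add, map_add, hx, hy, add_zero]

theorem Factor.isSemifree {dY : Lambda k Y →ₗ[k] Lambda k Y} (hY : ∀ n < 2, Subsingleton (Y n))
    {D : Factor Ψ →ₗ[k] Factor Ψ} (hD : IsDifferential (Factor.grade Ψ) D)
    (hi : IsDGMorphism (Lambda.grade k Y) dY (Factor.grade Ψ) D (Factor.incl Ψ)) :
    IsSemifree (Factor.grade Ψ) D (Factor.incl Ψ) := by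
  let 𝒵 := Lambda.grade k (Coker Ψ)
  let 𝒲 := Gamma.grade k (SKer Ψ)
  -- Reassociating exhibits the algebra as `ΛY ⊗ B` with `B = Λ coker φ ⊗ Γ s ker φ`. Multiplication
  -- by `ΛY` on the left creates no sign, so the map is linear over `ΛY`.
  let m : Lambda k Y ⊗[k] (𝒵 ᵍ⊗[k] 𝒲) ≃ₗ[k] Factor Ψ :=
    (TensorProduct.assoc k (Lambda k Y) (Lambda k (Coker Ψ)) (Gamma k (SKer Ψ))).symm
  have hm : ∀ a z w, m (a ⊗ₜ (z ᵍ⊗ₜ[k] w)) =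
      ((a ᵍ⊗ₜ[k] z : Lambda.grade k Y ᵍ⊗[k] 𝒵) ᵍ⊗ₜ[k] w : Factor Ψ) := fun _ _ _ => rfl
  refine isSemifree_of_tensor (𝒜 := Lambda.grade k Y) (ℬ := tensorGrade 𝒵 𝒲) m
    (fun a b => ?_) (fun n => ?_) (fun n b hb => ?_)
    (fun a ha => Lambda.eq_algebraMap_of_mem_zero hY ha)
    (fun a ha => Lambda.eq_zero_of_mem_one hY ha) (Lambda.aug k Y)
    (fun n hn a ha => Lambda.aug_of_pos k Y hn ha) hD.map_mem hD.sq_zero fun a x =>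
      ⟨dY a, signHom (Lambda.grade k Y) a, ?_⟩
  · induction b using tensor_induction with
    | h0 => rw [TensorProduct.tmul_zero, TensorProduct.tmul_zero, map_zero, mul_zero]
    | htmul z w =>
      refine (hm a z w).trans (Eq.trans ?_ (congrArg (Factor.incl Ψ a * ·) (hm 1 z w)).symm)
      simp only [Factor.incl, AlgHom.comp_apply]
      rw [includeLeft_mul_tmul, includeLeft_mul_tmul, mul_one]
    | hadd x y hx hy =>
      rw [TensorProduct.tmul_add, TensorProduct.tmul_add, map_add, map_add, hx, hy, mul_add]
  · refine Submodule.span_le.mpr ?_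
    rintro _ ⟨p, q, rfl, y, hy, w, hw, rfl⟩
    induction hy using Submodule.span_induction with
    | mem y h =>
      obtain ⟨p₁, p₂, rfl, a, ha, z, hz, rfl⟩ := h
      exact Submodule.subset_span ⟨p₁, p₂ + q, by omega, a, ha, z ᵍ⊗ₜ[k] w,
        tmul_mem_tensorGrade hz hw, (hm a z w).symm⟩
    | zero =>
      rw [tmul, TensorProduct.zero_tmul]
      exact zero_mem _
    | add y y' _ _ h h' =>
      rw [tmul, TensorProduct.add_tmul]
      exact add_mem h h'
    | smul c y _ h =>
      rw [tmul, ← TensorProduct.smul_tmul']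
      exact Submodule.smul_mem _ c h
  · induction hb using Submodule.span_induction with
    | mem b h =>
      obtain ⟨p, q, rfl, z, hz, w, hw, rfl⟩ := h
      rw [hm]
      exact tmul_mem_tensorGrade (includeRight_mem p z hz) hw
    | zero =>
      rw [TensorProduct.tmul_zero, map_zero]
      exact zero_mem _
    | add y y' _ _ h h' =>
      rw [TensorProduct.tmul_add, map_add]
      exact add_mem h h'
    | smul c y _ h =>
      rw [TensorProduct.tmul_smul, map_smul]
      exact Submodule.smul_mem _ c h
  · rw [hD.leibniz_sign, hi.comm, signHom_map (Factor.incl Ψ) hi.map_mem]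

end Factor

/-! ### Transport of differentials and detection of quasi-isomorphisms. -/

section Transport

variable {k : Type u} [Field k] {A : Type v} {B : Type w} [Ring A] [Ring B] [Algebra k A]
  [Algebra k B] {𝒜 : ℕ → Submodule k A} {ℬ : ℕ → Submodule k B} [GradedAlgebra 𝒜]
  [GradedAlgebra ℬ]

/-- A differential can be transported along an isomorphism of graded algebras. -/
theorem IsDifferential.transport {D : A →ₗ[k] A} {D₀ : B →ₗ[k] B} (f : A →ₐ[k] B)
    (hf : ∀ n, ∀ a ∈ 𝒜 n, f a ∈ ℬ n) (hinj : Function.Injective f)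
    (hcomm : ∀ a, f (D a) = D₀ (f a)) (hodd : IsOddDerivation ℬ D₀)
    (hmem : ∀ n, ∀ b ∈ ℬ n, D₀ b ∈ ℬ (n + 1)) (hsq : ∀ b, D₀ (D₀ b) = 0) :
    IsDifferential 𝒜 D where
  map_mem n a ha := by
    refine mem_of_map_mem (f := f.toLinearMap) hf hinj ?_
    rw [AlgHom.toLinearMap_apply, hcomm]
    exact hmem n _ (hf n a ha)
  leibniz n a ha b := hinj (by
    rw [hcomm, map_mul, hodd.leibniz_of_mem (hf n a ha), map_add, map_smul, map_mul, map_mul,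
      hcomm, hcomm])
  sq_zero a := hinj (by rw [hcomm, hcomm, hsq, map_zero])

theorem isQuasiIso_of_exists {D : A →ₗ[k] A} {d : B →ₗ[k] B} {p : A →ₐ[k] B}
    (hp : ∀ a, p (D a) = d (p a)) (hsurj : ∀ b, d b = 0 → ∃ a, D a = 0 ∧ p a = b)
    (hinj : ∀ a b, D a = 0 → p a = d b → ∃ a', D a' = a) : IsQuasiIso D d p := by
  refine ⟨hp, ?_, ?_⟩
  · rw [injective_iff_map_eq_zero]
    intro x hx
    obtain ⟨⟨a, ha⟩, rfl⟩ := Submodule.Quotient.mk_surjective _ x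
    obtain ⟨b, hb⟩ := (Submodule.Quotient.mk_eq_zero _).mp hx
    rw [Submodule.Quotient.mk_eq_zero]
    exact hinj a b ha hb.symm
  · intro y
    obtain ⟨⟨b, hb⟩, rfl⟩ := Submodule.Quotient.mk_surjective _ y
    obtain ⟨a, ha, rfl⟩ := hsurj b hb
    exact ⟨Submodule.Quotient.mk ⟨a, ha⟩, rfl⟩

end Transport

end DGFact

end

/-! ### Assembling the factorisation. -/

theorem mainTheorem8 {k : Type*} [Field k] (h2 : (2 : k) ≠ 0)
    {Y : ℕ → Type*} [∀ n, AddCommGroup (Y n)] [∀ n, Module k (Y n)]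
    {X : ℕ → Type*} [∀ n, AddCommGroup (X n)] [∀ n, Module k (X n)]
    (dY : DGFact.Lambda k Y →ₗ[k] DGFact.Lambda k Y)
    (hY : DGFact.IsMinimalSullivan k Y dY)
    (dX : DGFact.Lambda k X →ₗ[k] DGFact.Lambda k X)
    (hX : DGFact.IsMinimalSullivan k X dX)
    (Ψ : DGFact.Lambda k Y →ₐ[k] DGFact.Lambda k X)
    (hΨ : DGFact.IsDGMorphism (DGFact.Lambda.grade k Y) dY (DGFact.Lambda.grade k X) dX Ψ) :
    ∃ (D : DGFact.Factor Ψ →ₗ[k] DGFact.Factor Ψ) (p : DGFact.Factor Ψ →ₐ[k] DGFact.Lambda k X),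
      -- the middle term is an augmented commutative cochain algebra
      DGFact.IsGradedCommutative (DGFact.Factor.grade Ψ) ∧
      DGFact.IsDifferential (DGFact.Factor.grade Ψ) D ∧
      (∀ z, DGFact.Factor.aug Ψ (D z) = 0) ∧
      -- `D` is a `Γ`-derivation
      DGFact.IsGammaDerivation (DGFact.SKer Ψ) (DGFact.baseGrade Ψ) D ∧
      -- `i` is a semifree inclusion of augmented cochain algebras
      DGFact.IsDGMorphism (DGFact.Lambda.grade k Y) dY (DGFact.Factor.grade Ψ) D
        (DGFact.Factor.incl Ψ) ∧
      Function.Injective (DGFact.Factor.incl Ψ) ∧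
      (DGFact.Factor.aug Ψ).comp (DGFact.Factor.incl Ψ) = DGFact.Lambda.aug k Y ∧
      DGFact.IsSemifree (DGFact.Factor.grade Ψ) D (DGFact.Factor.incl Ψ) ∧
      -- `p` is a surjective quasi-isomorphism of cochain algebras
      DGFact.IsDGMorphism (DGFact.Factor.grade Ψ) D (DGFact.Lambda.grade k X) dX p ∧
      Function.Surjective p ∧
      DGFact.IsQuasiIso D dX p ∧
      -- `p` vanishes on `Γ s ker φ` (that is, on its augmentation ideal)
      (∀ z, p (DGFact.Factor.inclGamma Ψ z) =
        algebraMap k (DGFact.Lambda k X) (DGFact.Gamma.aug k (DGFact.SKer Ψ) z)) ∧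
      -- factorisation
      p.comp (DGFact.Factor.incl Ψ) = Ψ := by
  open DGFact in
  have h0 : Subsingleton (Ker Ψ 0) := by
    have := hY.degree_ge_two 0 two_pos
    infer_instance
  obtain ⟨D₀, hD₀⟩ := Koszul.exists_differential (K := Ker Ψ) h2 hX.toIsDifferential
  choose s κ μ hs h1 h3 h4 h5 using fun n => exists_splitting (phi Ψ n)
  obtain ⟨i, hi, hproj, hlin⟩ := hD₀.exists_lift hX.toIsDifferential h2 h0 hY hΨ κ
  let θ := Factor.toKoszul i hi.map_mem s
  have hθ : Function.Bijective θ := Factor.toKoszul_bijective hY.degree_ge_two hX.degree_ge_two i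
    hi.map_mem s κ hlin μ hs h1 h3 h4 h5
  have hθ_mem : ∀ n, ∀ x ∈ Factor.grade Ψ n, θ x ∈ Koszul.grade k X (Ker Ψ) n :=
    Factor.toKoszul_mem i hi.map_mem s
  let Θ := AlgEquiv.ofBijective θ hθ
  -- The differential of the Koszul extension, transported to the factorisation algebra.
  let D : Factor Ψ →ₗ[k] Factor Ψ :=
    Θ.symm.toLinearEquiv.toLinearMap.comp (D₀.comp θ.toLinearMap)
  have hΘ : ∀ x, θ (Θ.symm x) = x := Θ.apply_symm_apply
  have hθD : ∀ x, θ (D x) = D₀ (θ x) := fun x => hΘ _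
  have hD : IsDifferential (Factor.grade Ψ) D :=
    IsDifferential.transport θ hθ_mem hθ.1 hθD hD₀.odd hD₀.map_mem hD₀.sq_zero
  have hincl : ∀ a, θ (Factor.incl Ψ a) = i a := Factor.toKoszul_incl i hi.map_mem s
  have hgamma : ∀ a, θ (Factor.inclGamma Ψ a) = LG.inR k _ _ a :=
    Factor.toKoszul_inclGamma i hi.map_mem s
  have hinclDG : IsDGMorphism (Lambda.grade k Y) dY (Factor.grade Ψ) D (Factor.incl Ψ) :=
    ⟨Factor.incl_mem, fun a => hθ.1 (by rw [hincl, hθD, hincl, hi.comm])⟩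
  let p : Factor Ψ →ₐ[k] Lambda k X := (Koszul.proj k X (Ker Ψ)).comp θ
  have hp : ∀ x, p (D x) = dX (p x) := fun x => by
    simp only [p, AlgHom.comp_apply]
    rw [hθD, hD₀.proj_comm hX.toIsGradedDerivation]
  have hpX : ∀ a, p (Θ.symm (Koszul.inX k X (Ker Ψ) a)) = a := fun a => by
    simp only [p, AlgHom.comp_apply]
    rw [hΘ, Koszul.proj_inX]
  refine ⟨D, p, Factor.gradedCommutative Ψ, hD, Factor.aug_map hD.toIsGradedDerivation,
    ⟨hD.toIsGradedDerivation, fun n hn x i => ?_⟩, hinclDG, Factor.incl_injective,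
    Factor.aug_comp_incl, Factor.isSemifree hY.degree_ge_two hD hinclDG,
    ⟨fun n x hx => Koszul.proj_mem (hθ_mem n x hx), hp⟩, fun a => ⟨_, hpX a⟩,
    isQuasiIso_of_exists hp (fun a ha => ⟨_, ?_, hpX a⟩) fun x b hx hb => ?_, fun z => ?_, ?_⟩
  · change D (Factor.inclGamma Ψ (Gamma.γ k _ (i + 1) x)) =
      D (Factor.inclGamma Ψ (Gamma.γ k _ 1 x)) * Factor.inclGamma Ψ (Gamma.γ k _ i x)
    refine hθ.1 ?_
    rw [map_mul, hθD, hθD, hgamma, hgamma, hgamma]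
    exact (hD₀.map_γ n (i + 1) x).trans ((gammaDer_even _ hn i x).trans
      (congrArg (· * _) (hD₀.map_γ n 1 x).symm))
  · refine hθ.1 ?_
    rw [hθD, hΘ, hD₀.map_inX, ha, map_zero, map_zero]
  · have hx' : D₀ (θ x) = 0 := by rw [← hθD, hx, map_zero]
    obtain ⟨v, hv⟩ := hD₀.exists_sub_proj_eq h2 h0 hx'
    -- If `x` projects to `dX b`, then `θ x` differs by the boundary of `v` from the image of `dX b`
    -- in the Koszul extension, which is itself the boundary of the image of `b`.
    refine ⟨Θ.symm (v + Koszul.inX k X (Ker Ψ) b), hθ.1 ?_⟩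
    have hb' : Koszul.proj k X (Ker Ψ) (θ x) = dX b := hb
    rw [hθD, hΘ, map_add, ← hv, hD₀.map_inX, hb', sub_add_cancel]
  · simp only [p, AlgHom.comp_apply]
    rw [hgamma]
    exact Koszul.proj_inR (k := k) (X := X) (K := Ker Ψ) z
  · refine AlgHom.ext fun a => ?_
    simp only [p, AlgHom.comp_apply]
    rw [hincl]
    exact DFunLike.congr_fun hproj a
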